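/- Let $l\ge -\tfrac12$ and let $q\in L^1_{\mathrm{loc}}(0,\infty)$ be real-valued with $x\,q(x)\in L^1(0,1)$ if $l>-\tfrac12$ and $x(1-\log x)\,q(x)\in L^1(0,1)$ if $l=-\tfrac12$. Assume that $\tau=-\frac{d^2}{dx^2}+\frac{l(l+1)}{x^2}+q(x)$ is in the limit point case at $\infty$ (i.e. for some, equivalently every, $z\in\mathbb C$ not all solutions of $\tau u=zu$ are square integrable near $\infty$). Let $H$ be the operator $Hf=\tau f$ in $L^2(\mathbb R_+)$, $\mathbb R_+=(0,\infty)$, whose domain consists of all $f\in L^2(\mathbb R_+)$ such that $f,f'$ are absolutely continuous on compact subintervals of $(0,\infty)$, $\tau f\in L^2(\mathbb R_+)$ and, if $l<\tfrac12$, $\lim_{x\to0}x^l\big((l+1)f(x)-xf'(x)\big)=0$. Assume that $H$ is bounded from below, and let $\mathfrak Q(H)$ be its form domain, i.e. the domain of the closure of the quadratic form $f\mapsto\langle f,Hf\rangle$, $f\in\mathfrak D(H)$. (i) Let $\lambda\in\mathbb R$ lie strictly below the spectrum of $H$. There is a real solution $\phi(\lambda,\cdot)$ of $\tau u=\lambda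 u$ on $(0,\infty)$ with $\phi(\lambda,x)=x^{l+1}(1+o(1))$ as $x\to0$; every such solution is positive on $(0,\infty)$, and for every such solution $$\mathfrak Q(H)=\Big\{f\in L^2(\mathbb R_+)\;:\; f\in AC(\mathbb R_+),\ -f'+\frac{\phi'(\lambda,\cdot)}{\phi(\lambda,\cdot)}f\in L^2(\mathbb R_+)\Big\},$$ where $AC(\mathbb R_+)$ denotes the functions that are absolutely continuous on every compact subinterval of $(0,\infty)$. (ii) If $l>-\tfrac12$, then every $f\in\mathfrak Q(H)$ is of the form $f(x)=x\tilde f(x)$ with $\tilde f\in L^2(0,1)$ and $|\tilde f(x)|\le C\,x^{-1/2}$ for all $x\in(0,1)$, with a constant $C$ depending on $f$. -/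

import Mathlib

open MeasureTheory Set Filter Topology
open scoped ENNReal

noncomputable section

namespace Bessel

/-! ### Locally absolutely continuous functions and the differential expression -/

/-- `f` is (locally) absolutely continuous on `(0, ∞)`: absolutely continuous on every compact
subinterval of `(0, ∞)`. -/
def LocAC {E : Type*} [PseudoMetricSpace E] (f : ℝ → E) : Prop :=
  ∀ a b : ℝ, 0 < a → a ≤ b → AbsolutelyContinuousOnInterval f a b

/-- `f` is differentiable on `(0, ∞)` and `f'` is locally absolutely continuous there. -/
def LocAC2 {E : Type*} [NormedAddCommGroup E] [NormedSpace ℝ E] (f : ℝ → E) : Prop :=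
  DifferentiableOn ℝ f (Ioi 0) ∧ LocAC (deriv f)

/-- The differential expression `τ f = - f'' + (l (l + 1) / x ^ 2 + q) f`. -/
def tau (l : ℝ) (q : ℝ → ℝ) {E : Type*} [NormedAddCommGroup E] [NormedSpace ℝ E]
    (f : ℝ → E) (x : ℝ) : E :=
  -deriv (deriv f) x + (l * (l + 1) / x ^ 2 + q x) • f x

/-- `u` is a (Carathéodory) solution of `τ u = z u` on `(0, ∞)`. -/
def IsSolution (l : ℝ) (q : ℝ → ℝ) {𝕜 : Type*} [RCLike 𝕜] (z : 𝕜) (u : ℝ → 𝕜) : Prop :=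
  LocAC2 u ∧ ∀ᵐ x ∂(volume.restrict (Ioi (0 : ℝ))), tau l q u x = z * u x

/-- The solution `φ(lam, ·)` of `τ u = lam u` that is regular at the origin, normalized by
`φ(lam, x) = x ^ (l + 1) (1 + o(1))` as `x → 0`. -/
def IsRegularSolution (l : ℝ) (q : ℝ → ℝ) (lam : ℝ) (φ : ℝ → ℝ) : Prop :=
  IsSolution l q lam φ ∧ Tendsto (fun x => φ x / x ^ (l + 1)) (𝓝[>] 0) (𝓝 1)

/-- Weyl's limit point case at `∞`: for some `z ∈ ℂ`, not all solutions of `τ u = z u` are square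
integrable near `∞`. (By Weyl's alternative it is equivalent to ask this for every `z`.) -/
def LimitPointAtInfty (l : ℝ) (q : ℝ → ℝ) : Prop :=
  ∃ (z : ℂ) (u : ℝ → ℂ), IsSolution l q z u ∧ ¬ MemLp u 2 (volume.restrict (Ioi (1 : ℝ)))

/-- The standing hypothesis on the angular momentum `l` and the potential `q`. -/
structure Hyp (l : ℝ) (q : ℝ → ℝ) : Prop where
  le_l : -(1 / 2) ≤ l
  locInt : LocallyIntegrableOn q (Ioi 0)
  int_zero : -(1 / 2) < l → IntegrableOn (fun x => x * q x) (Ioo 0 1)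
  int_zero_log : l = -(1 / 2) →
    IntegrableOn (fun x => x * (1 - Real.log x) * q x) (Ioo 0 1)
  limitPoint : LimitPointAtInfty l q

/-! ### The Hilbert space and the operator `H` -/

/-- The Hilbert space `L²(ℝ₊)`. -/
abbrev L2 : Type := Lp ℂ 2 (volume.restrict (Ioi (0 : ℝ)))

/-- The boundary condition `lim_{x → 0} x ^ l ((l + 1) f(x) - x f'(x)) = 0`, imposed only if
`l < 1 / 2`. -/
def BdryCond (l : ℝ) (F : ℝ → ℂ) : Prop :=
  l < 1 / 2 → Tendsto (fun x : ℝ => (x ^ l : ℝ) • (((l + 1 : ℝ) : ℂ) * F x - (x : ℂ) * deriv F x))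
    (𝓝[>] 0) (𝓝 0)

theorem LocAC.ae_differentiableAt {f : ℝ → ℂ} (hf : LocAC f) :
    ∀ᵐ x ∂(volume.restrict (Ioi (0 : ℝ))), DifferentiableAt ℝ f x := by
  rw [ae_restrict_iff' measurableSet_Ioi]
  have h : ∀ n : ℕ, ∀ᵐ x : ℝ, x ∈ uIcc (1 / ((n : ℝ) + 1)) ((n : ℝ) + 1) →
      DifferentiableAt ℝ f x := by
    intro n
    have hn : (0 : ℝ) ≤ n := Nat.cast_nonneg n
    refine (hf _ _ (by positivity) ?_).boundedVariationOn.ae_differentiableAt_of_mem_uIcc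
    rw [div_le_iff₀ (by positivity)]
    nlinarith
  filter_upwards [ae_all_iff.2 h] with x hx hx0
  have hx0' : (0 : ℝ) < x := hx0
  obtain ⟨n, hn⟩ := exists_nat_ge (max x (1 / x))
  have h1 : x ≤ n := (le_max_left _ _).trans hn
  have h2 : 1 / x ≤ n := (le_max_right _ _).trans hn
  refine hx n (Icc_subset_uIcc ⟨?_, by linarith⟩)
  rw [div_le_iff₀ hx0'] at h2
  rw [div_le_iff₀ (by positivity)]
  nlinarith

theorem deriv_add_eqOn {F G : ℝ → ℂ} (hF : DifferentiableOn ℝ F (Ioi 0))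
    (hG : DifferentiableOn ℝ G (Ioi 0)) :
    EqOn (deriv (F + G)) (deriv F + deriv G) (Ioi 0) := fun _ hx =>
  deriv_add (hF.differentiableAt (Ioi_mem_nhds hx)) (hG.differentiableAt (Ioi_mem_nhds hx))

theorem LocAC.congr {E : Type*} [PseudoMetricSpace E] {f g : ℝ → E} (hf : LocAC f)
    (h : EqOn f g (Ioi 0)) : LocAC g := by
  intro a b ha hab
  have key := hf a b ha hab
  rw [absolutelyContinuousOnInterval_iff] at key ⊢
  intro ε hε
  obtain ⟨δ, hδ, H⟩ := key ε hε
  refine ⟨δ, hδ, fun E hE hlt => ?_⟩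
  have := H E hE hlt
  convert this using 1
  refine Finset.sum_congr rfl fun i hi => ?_
  have hm := hE.1 i hi
  rw [uIcc_of_le hab] at hm
  rw [h (show (E.2 i).1 ∈ Ioi (0 : ℝ) from ha.trans_le hm.1.1),
    h (show (E.2 i).2 ∈ Ioi (0 : ℝ) from ha.trans_le hm.2.1)]

theorem LocAC2.add {F G : ℝ → ℂ} (hF : LocAC2 F) (hG : LocAC2 G) : LocAC2 (F + G) :=
  ⟨hF.1.add hG.1, LocAC.congr (fun a b ha hab => (hF.2 a b ha hab).add (hG.2 a b ha hab))
    (deriv_add_eqOn hF.1 hG.1).symm⟩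

theorem deriv_smul_eq (c : ℂ) (F : ℝ → ℂ) : deriv (c • F) = c • deriv F := by
  funext x
  exact deriv_const_smul_field c F

theorem LocAC2.smul {F : ℝ → ℂ} (c : ℂ) (hF : LocAC2 F) : LocAC2 (c • F) := by
  refine ⟨hF.1.const_smul c, ?_⟩
  rw [deriv_smul_eq]
  exact fun a b ha hab => (hF.2 a b ha hab).const_smul c

theorem tau_add_ae (l : ℝ) (q : ℝ → ℝ) {F G : ℝ → ℂ} (hF : LocAC2 F) (hG : LocAC2 G) :
    tau l q (F + G) =ᵐ[volume.restrict (Ioi (0 : ℝ))] tau l q F + tau l q G := by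
  filter_upwards [hF.2.ae_differentiableAt, hG.2.ae_differentiableAt,
    ae_restrict_mem measurableSet_Ioi] with x h1 h2 hx
  have e : deriv (deriv (F + G)) x = deriv (deriv F) x + deriv (deriv G) x := by
    rw [((deriv_add_eqOn hF.1 hG.1).eventuallyEq_of_mem (Ioi_mem_nhds hx)).deriv_eq]
    exact deriv_add h1 h2
  simp only [tau, Pi.add_apply, e, smul_add]
  abel

theorem tau_smul (l : ℝ) (q : ℝ → ℝ) (c : ℂ) (F : ℝ → ℂ) :
    tau l q (c • F) = c • tau l q F := by
  funext x
  simp only [tau, deriv_smul_eq, Pi.smul_apply, smul_add, smul_neg]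
  rw [smul_comm]

/-- The graph of `H`: all pairs `(f, τ f)` with `f ∈ L²(ℝ₊)`, `f` and `f'` locally absolutely
continuous on `(0, ∞)`, `τ f ∈ L²(ℝ₊)`, and `f` subject to the boundary condition at `0`. -/
def graphH (l : ℝ) (q : ℝ → ℝ) : Submodule ℂ (L2 × L2) where
  carrier := {p | ∃ F : ℝ → ℂ, LocAC2 F ∧ BdryCond l F ∧
    p.1 =ᵐ[volume.restrict (Ioi (0 : ℝ))] F ∧
    p.2 =ᵐ[volume.restrict (Ioi (0 : ℝ))] tau l q F}
  add_mem' := by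
    rintro p r ⟨F, hF, bF, f1, f2⟩ ⟨G, hG, bG, g1, g2⟩
    refine ⟨F + G, hF.add hG, fun hl => ?_, ?_, ?_⟩
    · have h := (bF hl).add (bG hl)
      rw [add_zero] at h
      refine h.congr' ?_
      filter_upwards [self_mem_nhdsWithin] with x hx
      rw [deriv_add_eqOn hF.1 hG.1 hx, ← smul_add]
      simp only [Pi.add_apply]
      congr 1
      ring
    · exact (Lp.coeFn_add p.1 r.1).trans (f1.add g1)
    · exact (Lp.coeFn_add p.2 r.2).trans ((f2.add g2).trans (tau_add_ae l q hF hG).symm)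
  zero_mem' := by
    refine ⟨0, ⟨differentiableOn_const 0, ?_⟩, fun _ => ?_, Lp.coeFn_zero _ _ _, ?_⟩
    · have : deriv (0 : ℝ → ℂ) = 0 := by funext x; simp
      rw [this]
      intro a b _ _
      simp [AbsolutelyContinuousOnInterval, tendsto_const_nhds]
    · simp
    · refine (Lp.coeFn_zero _ _ _).trans (Eventually.of_forall fun x => ?_)
      have : deriv (0 : ℝ → ℂ) = 0 := by funext x; simp
      simp [tau, this]
  smul_mem' := by
    rintro c p ⟨F, hF, bF, f1, f2⟩
    refine ⟨c • F, hF.smul c, fun hl => ?_, ?_, ?_⟩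
    · have h := (bF hl).const_smul c
      rw [smul_zero] at h
      refine h.congr fun x => ?_
      rw [deriv_smul_eq, smul_comm]
      simp only [Pi.smul_apply, smul_eq_mul]
      congr 1
      ring
    · exact (Lp.coeFn_smul c p.1).trans (f1.const_smul c)
    · rw [tau_smul]
      exact (Lp.coeFn_smul c p.2).trans (f2.const_smul c)

/-- `graphH l q` is the graph of a function. -/
theorem graphH_single_valued (l : ℝ) (q : ℝ → ℝ) :
    ∀ p : L2 × L2, p ∈ graphH l q → p.1 = 0 → p.2 = 0 := by
  rintro p ⟨F, hF, -, f1, f2⟩ h0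
  have hz : F =ᵐ[volume.restrict (Ioi (0 : ℝ))] (fun _ => (0 : ℂ)) := by
    rw [h0] at f1
    exact f1.symm.trans (Lp.coeFn_zero _ _ _)
  have e0 : EqOn F (fun _ => (0 : ℂ)) (Ioi 0) :=
    Measure.eqOn_open_of_ae_eq hz isOpen_Ioi hF.1.continuousOn continuousOn_const
  have e1 : EqOn (deriv F) (fun _ => (0 : ℂ)) (Ioi 0) := fun x hx => by
    rw [(e0.eventuallyEq_of_mem (Ioi_mem_nhds hx)).deriv_eq]
    simp
  refine Lp.ext (f2.trans ?_)
  refine EventuallyEq.trans ?_ (Lp.coeFn_zero _ _ _).symm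
  filter_upwards [ae_restrict_mem measurableSet_Ioi] with x hx
  have e2 : deriv (deriv F) x = 0 := by
    rw [(e1.eventuallyEq_of_mem (Ioi_mem_nhds hx)).deriv_eq]
    simp
  simp [tau, e2, e0 hx]

/-- The operator `H` in `L²(ℝ₊)`. -/
def H (l : ℝ) (q : ℝ → ℝ) : L2 →ₗ.[ℂ] L2 := (graphH l q).toLinearPMap

theorem H_graph (l : ℝ) (q : ℝ → ℝ) : (H l q).graph = graphH l q :=
  Submodule.toLinearPMap_graph_eq _ (graphH_single_valued l q)

/-! ### Unbounded operators in a Hilbert space -/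

section Operators

variable {E : Type*} [NormedAddCommGroup E] [InnerProductSpace ℂ E]

/-- `z` is in the resolvent set of `T`: `T - z` maps the domain of `T` bijectively onto the whole
space and has a bounded inverse `R`. -/
def InResolventSet (T : E →ₗ.[ℂ] E) (z : ℂ) : Prop :=
  ∃ R : E →L[ℂ] E,
    (∀ g : E, ∃ h : R g ∈ T.domain, T ⟨R g, h⟩ - z • R g = g) ∧
    (∀ f : T.domain, R (T f - z • (f : E)) = f)

/-- The spectrum of the unbounded operator `T`. -/
def opSpectrum (T : E →ₗ.[ℂ] E) : Set ℂ := {z | ¬ InResolventSet T z}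

/-- `T` is bounded from below: `⟨f, T f⟩ ≥ γ ‖f‖ ^ 2` on the domain of `T`. -/
def BoundedBelow (T : E →ₗ.[ℂ] E) : Prop :=
  ∃ γ : ℝ, ∀ f : T.domain, γ * ‖(f : E)‖ ^ 2 ≤ (inner ℂ (f : E) (T f)).re

/-- The form domain of a (self-adjoint) operator `T` that is bounded from below: the domain of the
closure of the quadratic form `u ↦ ⟨u, T u⟩` defined on the domain of `T`, that is, the set of all
limits `f` of sequences `u n` in the domain of `T` that are Cauchy with respect to the form. -/
def formDomain (T : E →ₗ.[ℂ] E) : Set E :=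
  {f | ∃ u : ℕ → T.domain, Tendsto (fun n => (u n : E)) atTop (𝓝 f) ∧
    Tendsto (fun p : ℕ × ℕ => inner ℂ ((u p.1 - u p.2 : T.domain) : E) (T (u p.1 - u p.2)))
      atTop (𝓝 0)}

end Operators

end Bessel

end

noncomputable section

namespace Bessel

/-! ### Locally absolutely continuous functions as primitives -/

/-! The operator factorizes. If `φ` is a positive regular solution at `lam` and `A = -d/dx + φ'/φ`,
taken maximally in L², then `H - lam` is formally `A* A`: for `f` in the domain of `A` and `u` in
that of `H`, ⟨A f, A u⟩ = ⟨f, (H - lam) u⟩ (`InDom.integral_factor_eq`). On the domain of `H` the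
form is therefore ‖A u‖² + lam ‖u‖². As `A` is closed (`factorGraph_isClosed`), form limits lie in
its domain. Conversely, the domain of `H` is a core of `A`: if `(f, A f)` is orthogonal to all `(u,
A u)`, then `f` is orthogonal to the range of `H - (lam - 1)`, which is everything because `lam - 1`
lies below the spectrum. This Hilbert space argument is `IsFactor`.

The identity needs three analytic facts. The regular solution exists by a contraction argument for a
Volterra equation (`Hyp.exists_isRegularSolution`). It is positive and not square integrable at
infinity, since otherwise `φ`, or `φ` cut off before a zero, would violate a form bound strictly
above `lam` (`IsRegularSolution.pos`, `IsRegularSolution.not_memLp`). The boundary terms vanish: at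
the origin the Wronskian of `φ` and `u` tends to 0, by the boundary condition if `l < 1/2` and by
square integrability if `l ≥ 1/2`; at infinity the boundary term has a limit and is integrable.

The strict form bound at `lam` comes in two stages. The assumed lower bound `γ` is strict at `γ -
1`, so the factorization there already makes `H` symmetric. For a symmetric semibounded operator the
best lower bound cannot lie in the resolvent set, hence it exceeds `lam` (`exists_lower_bound`).

The second claim is a Hardy inequality: `A F ∈ L²` controls `F / φ` in weighted norms, and `φ` is
comparable to `x ^ (l + 1)` on `(0, 1]` (`IsRegularSolution.hardy`). -/

theorem LocAC.comp_lipschitz {E F : Type*} [PseudoMetricSpace E] [PseudoMetricSpace F]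
    {f : ℝ → E} (hf : LocAC f) {g : E → F} {K : NNReal} (hg : LipschitzWith K g) :
    LocAC (fun x => g (f x)) := by
  intro a b ha hab
  have key := hf a b ha hab
  unfold AbsolutelyContinuousOnInterval at key ⊢
  refine squeeze_zero (fun t => Finset.sum_nonneg fun i _ => dist_nonneg) (fun t => ?_)
    (by simpa using key.const_mul (K : ℝ))
  rw [Finset.mul_sum]
  exact Finset.sum_le_sum fun i _ => hg.dist_le_mul _ _

theorem LocAC.continuousOn {E : Type*} [NormedAddCommGroup E] {f : ℝ → E} (hf : LocAC f) :
    ContinuousOn f (Ioi 0) := by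
  intro x hx
  have hx' : (0 : ℝ) < x := hx
  have hle : x / 2 ≤ 2 * x := by linarith
  have h : ContinuousOn f (Icc (x / 2) (2 * x)) := by
    rw [← uIcc_of_le hle]
    exact AbsolutelyContinuousOnInterval.continuousOn (hf (x / 2) (2 * x) (by positivity) hle)
  have hm : Icc (x / 2) (2 * x) ∈ 𝓝 x := Icc_mem_nhds (by linarith) (by linarith)
  exact (h.continuousAt hm).continuousWithinAt

theorem LocAC.of_contDiffOn {E : Type*} [NormedAddCommGroup E] [NormedSpace ℝ E] {f : ℝ → E}
    (hf : ContDiffOn ℝ 1 f (Ioi 0)) : LocAC f := by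
  intro a b ha hab
  refine (hf.mono ?_).absolutelyContinuousOnInterval
  rw [uIcc_of_le hab]
  exact fun x hx => ha.trans_le hx.1

theorem LocAC.of_hasDerivAt {E : Type*} [NormedAddCommGroup E] [NormedSpace ℝ E] {f f' : ℝ → E}
    (hf : ∀ x, 0 < x → HasDerivAt f (f' x) x) (hc : ContinuousOn f' (Ioi 0)) : LocAC f := by
  refine LocAC.of_contDiffOn ((contDiffOn_succ_iff_deriv_of_isOpen (n := 0) isOpen_Ioi).2
    ⟨fun x hx => (hf x hx).differentiableAt.differentiableWithinAt, by simp, ?_⟩)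
  exact contDiffOn_zero.2 (hc.congr fun x hx => (hf x hx).deriv)

/-- `F` is locally absolutely continuous on `(0, ∞)` with derivative `k` almost everywhere. -/
def Prim {E : Type*} [NormedAddCommGroup E] [NormedSpace ℝ E] (F k : ℝ → E) : Prop :=
  LocAC F ∧ ∀ᵐ x ∂(volume.restrict (Ioi (0 : ℝ))), HasDerivAt F (k x) x

theorem ae_restrict_of_forall_pos {p : ℝ → Prop} (h : ∀ x, 0 < x → p x) :
    ∀ᵐ x ∂(volume.restrict (Ioi (0 : ℝ))), p x :=
  (ae_restrict_mem measurableSet_Ioi).mono fun x hx => h x hx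

namespace Prim

variable {E : Type*} [NormedAddCommGroup E] [NormedSpace ℝ E]

theorem of_hasDerivAt {f f' : ℝ → E}
    (hf : ∀ x, 0 < x → HasDerivAt f (f' x) x) (hc : ContinuousOn f' (Ioi 0)) : Prim f f' :=
  ⟨LocAC.of_hasDerivAt hf hc, ae_restrict_of_forall_pos hf⟩

theorem continuousOn {F k : ℝ → E} (h : Prim F k) : ContinuousOn F (Ioi 0) := h.1.continuousOn

theorem congr_ae {F k k' : ℝ → E} (h : Prim F k)
    (hk : ∀ᵐ x ∂(volume.restrict (Ioi (0 : ℝ))), k x = k' x) :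
    Prim F k' := ⟨h.1, by filter_upwards [h.2, hk] with x h1 h2; rwa [← h2]⟩

theorem congr_left {F G k : ℝ → E} (h : Prim F k) (hk : EqOn F G (Ioi 0)) :
    Prim G k := by
  refine ⟨h.1.congr hk, ?_⟩
  filter_upwards [h.2, ae_restrict_mem measurableSet_Ioi] with x h1 h2
  exact h1.congr_of_eventuallyEq (hk.symm.eventuallyEq_of_mem (Ioi_mem_nhds h2))

theorem deriv_ae {F k : ℝ → E} (h : Prim F k) :
    ∀ᵐ x ∂(volume.restrict (Ioi (0 : ℝ))), deriv F x = k x := h.2.mono fun _ hx => hx.deriv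

theorem mul {A : Type*} [NormedRing A] [NormMulClass A] [NormedAlgebra ℝ A] {F F' G G' : ℝ → A}
    (hF : Prim F F') (hG : Prim G G') :
    Prim (fun x => F x * G x) (fun x => F' x * G x + F x * G' x) :=
  ⟨fun a b ha hab => (hF.1 a b ha hab).smul (hG.1 a b ha hab), by
    filter_upwards [hF.2, hG.2] with x h1 h2 using h1.mul h2⟩

theorem add {F F' G G' : ℝ → E} (hF : Prim F F') (hG : Prim G G') :
    Prim (fun x => F x + G x) (fun x => F' x + G' x) :=
  ⟨fun a b ha hab => (hF.1 a b ha hab).add (hG.1 a b ha hab), by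
    filter_upwards [hF.2, hG.2] with x h1 h2 using h1.add h2⟩

theorem sub {F F' G G' : ℝ → E} (hF : Prim F F') (hG : Prim G G') :
    Prim (fun x => F x - G x) (fun x => F' x - G' x) :=
  ⟨fun a b ha hab => (hF.1 a b ha hab).sub (hG.1 a b ha hab), by
    filter_upwards [hF.2, hG.2] with x h1 h2 using h1.sub h2⟩

theorem clm {E' : Type*} [NormedAddCommGroup E'] [NormedSpace ℝ E'] {F F' : ℝ → E}
    (hF : Prim F F') (L : E →L[ℝ] E') : Prim (fun x => L (F x)) (fun x => L (F' x)) :=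
  ⟨hF.1.comp_lipschitz L.lipschitz, by
    filter_upwards [hF.2] with x h1 using L.hasFDerivAt.comp_hasDerivAt x h1⟩

theorem ofReal {f f' : ℝ → ℝ} (hf : Prim f f') :
    Prim (fun x => (f x : ℂ)) (fun x => (f' x : ℂ)) := hf.clm Complex.ofRealCLM

theorem re {F F' : ℝ → ℂ} (hF : Prim F F') :
    Prim (fun x => (F x).re) (fun x => (F' x).re) := hF.clm Complex.reCLM

theorem im {F F' : ℝ → ℂ} (hF : Prim F F') :
    Prim (fun x => (F x).im) (fun x => (F' x).im) := hF.clm Complex.imCLM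

theorem conj {F F' : ℝ → ℂ} (hF : Prim F F') :
    Prim (fun x => starRingEnd ℂ (F x)) (fun x => starRingEnd ℂ (F' x)) :=
  hF.clm (Complex.conjCLE : ℂ →L[ℝ] ℂ)

theorem ae_mem {F k : ℝ → E} (h : Prim F k) {a b : ℝ} (ha : 0 < a) (hb : 0 < b) :
    ∀ᵐ x : ℝ, x ∈ uIoc a b → HasDerivAt F (k x) x := by
  have h2 := h.2
  rw [ae_restrict_iff' measurableSet_Ioi] at h2
  filter_upwards [h2] with x hx hm
  exact hx ((lt_min ha hb).trans hm.1)

theorem real_integral {f k : ℝ → ℝ} (h : Prim f k) {a b : ℝ} (ha : 0 < a) (hb : 0 < b) :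
    IntervalIntegrable k volume a b ∧ ∫ x in a..b, k x = f b - f a := by
  have hac : AbsolutelyContinuousOnInterval f a b := by
    rcases le_total a b with hab | hab
    · exact h.1 a b ha hab
    · exact (h.1 b a hb hab).symm
  have hae := h.ae_mem ha hb
  refine ⟨hac.intervalIntegrable_deriv.congr_ae ?_, ?_⟩
  · rw [EventuallyEq, ae_restrict_iff' measurableSet_uIoc]
    filter_upwards [hae] with x hx hm using (hx hm).deriv
  · rw [← hac.integral_deriv_eq_sub]
    refine intervalIntegral.integral_congr_ae ?_
    filter_upwards [hae] with x hx hm using (hx hm).deriv.symm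

theorem _root_.Bessel.intervalIntegrable_re_im {k : ℝ → ℂ} {a b : ℝ}
    (h1 : IntervalIntegrable (fun x => (k x).re) volume a b)
    (h3 : IntervalIntegrable (fun x => (k x).im) volume a b) :
    IntervalIntegrable k volume a b ∧ ∫ x in a..b, k x =
      ((∫ x in a..b, (k x).re : ℝ) : ℂ) + ((∫ x in a..b, (k x).im : ℝ) : ℂ) * Complex.I := by
  have e : k = fun x => ((k x).re : ℂ) + ((k x).im : ℂ) * Complex.I := by
    funext x; exact (Complex.re_add_im _).symm
  have i1 : IntervalIntegrable (fun x => ((k x).re : ℂ)) volume a b :=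
    ⟨h1.1.ofReal, h1.2.ofReal⟩
  have i2 : IntervalIntegrable (fun x => ((k x).im : ℂ) * Complex.I) volume a b :=
    IntervalIntegrable.mul_const ⟨h3.1.ofReal, h3.2.ofReal⟩ _
  constructor
  · rw [e]; exact i1.add i2
  · rw [← intervalIntegral.integral_ofReal, ← intervalIntegral.integral_ofReal,
      ← intervalIntegral.integral_mul_const, ← intervalIntegral.integral_add i1 i2, ← e]

theorem complex_integral {F k : ℝ → ℂ} (h : Prim F k) {a b : ℝ} (ha : 0 < a) (hb : 0 < b) :
    IntervalIntegrable k volume a b ∧ ∫ x in a..b, k x = F b - F a := by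
  obtain ⟨h1, h2⟩ := h.re.real_integral ha hb
  obtain ⟨h3, h4⟩ := h.im.real_integral ha hb
  obtain ⟨h5, h6⟩ := intervalIntegrable_re_im h1 h3
  refine ⟨h5, ?_⟩
  rw [h6, h2, h4]
  apply Complex.ext <;> simp

theorem of_real_locAC {f : ℝ → ℝ} (h : LocAC f) : Prim f (deriv f) := by
  have hc : LocAC (fun x => (f x : ℂ)) := h.comp_lipschitz Complex.isometry_ofReal.lipschitz
  refine ⟨h, ?_⟩
  filter_upwards [hc.ae_differentiableAt] with x hx
  have := (Complex.reCLM.differentiableAt (x := (f x : ℂ))).comp x hx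
  exact (show DifferentiableAt ℝ f x from this).hasDerivAt

theorem of_locAC {f : ℝ → ℂ} (h : LocAC f) : Prim f (deriv f) :=
  ⟨h, h.ae_differentiableAt.mono fun _ hx => hx.hasDerivAt⟩

/-- Lebesgue differentiation, in the direction converse to `real_integral`. The base point is 1
because `k` need not be integrable up to 0. -/
theorem of_real_integral {k : ℝ → ℝ} (hk : ∀ a b, 0 < a → a ≤ b → IntervalIntegrable k volume a b)
    (c : ℝ) : Prim (fun x => c + ∫ t in (1 : ℝ)..x, k t) k := by
  constructor
  · intro a b ha hab
    have h1 : (1 : ℝ) ∈ uIcc (min a 1) (max b 1) := by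
      rw [uIcc_of_le ((min_le_right _ _).trans (le_max_right _ _))]
      exact ⟨min_le_right _ _, le_max_right _ _⟩
    have h2 := (hk (min a 1) (max b 1) (lt_min ha one_pos)
      ((min_le_right _ _).trans (le_max_right _ _))).absolutelyContinuousOnInterval_intervalIntegral h1
    have h3 := h2.mono (c := a) (d := b) (by
      rw [uIcc_of_le hab, uIcc_of_le ((min_le_right _ _).trans (le_max_right _ _))]
      exact Icc_subset_Icc (min_le_left _ _) (le_max_left _ _))
    have h4 : AbsolutelyContinuousOnInterval (fun _ : ℝ => c) a b :=
      (LipschitzWith.const (α := ℝ) c).lipschitzOnWith.absolutelyContinuousOnInterval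
    exact h4.add h3
  · rw [ae_restrict_iff' measurableSet_Ioi]
    -- A countable exhaustion of the half-line by compact intervals, so that the exceptional null
    -- sets can be united.
    have h : ∀ n : ℕ, ∀ᵐ x : ℝ, x ∈ uIcc (1 / ((n : ℝ) + 1)) ((n : ℝ) + 1) →
        HasDerivAt (fun x => ∫ t in (1 : ℝ)..x, k t) (k x) x := by
      intro n
      have hn : (0 : ℝ) ≤ n := Nat.cast_nonneg n
      have hle : 1 / ((n : ℝ) + 1) ≤ 1 := by rw [div_le_one (by positivity)]; linarith
      filter_upwards [(hk (1 / ((n : ℝ) + 1)) ((n : ℝ) + 1) (by positivity)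
        (by linarith)).ae_hasDerivAt_integral] with x hx hm
      exact hx hm 1 (by rw [uIcc_of_le (by linarith)]; exact ⟨hle, by linarith⟩)
    filter_upwards [ae_all_iff.2 h] with x hx hx0
    have hx0' : (0 : ℝ) < x := hx0
    obtain ⟨n, hn⟩ := exists_nat_ge (max x (1 / x))
    have h1 : x ≤ n := (le_max_left _ _).trans hn
    have h2 : 1 / x ≤ n := (le_max_right _ _).trans hn
    refine (hx n (Icc_subset_uIcc ⟨?_, by linarith⟩)).const_add c
    rw [div_le_iff₀ hx0'] at h2
    rw [div_le_iff₀ (by positivity)]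
    nlinarith

theorem of_complex_integral {k : ℝ → ℂ}
    (hk : ∀ a b, 0 < a → a ≤ b → IntervalIntegrable k volume a b)
    (c : ℂ) : Prim (fun x => c + ∫ t in (1 : ℝ)..x, k t) k := by
  have hr : ∀ a b, 0 < a → a ≤ b → IntervalIntegrable (fun x => (k x).re) volume a b :=
    fun a b ha hab => ⟨(hk a b ha hab).1.re, (hk a b ha hab).2.re⟩
  have hi : ∀ a b, 0 < a → a ≤ b → IntervalIntegrable (fun x => (k x).im) volume a b :=
    fun a b ha hab => ⟨(hk a b ha hab).1.im, (hk a b ha hab).2.im⟩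
  have h3 := (of_real_integral hr c.re).ofReal.add
    ((of_real_integral hi c.im).clm ((ContinuousLinearMap.id ℝ ℝ).smulRight Complex.I))
  refine (h3.congr_left fun x hx => ?_).congr_ae (Eventually.of_forall fun x => ?_)
  · have hx' : (0 : ℝ) < x := hx
    have hor : ∀ g : ℝ → ℝ, (∀ a b, 0 < a → a ≤ b → IntervalIntegrable g volume a b) →
        IntervalIntegrable g volume 1 x := fun g hg => by
      rcases le_total 1 x with h | h
      · exact hg 1 x one_pos h
      · exact (hg x 1 hx' h).symm
    rw [(intervalIntegrable_re_im (hor _ hr) (hor _ hi)).2]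
    apply Complex.ext <;> simp
  · apply Complex.ext <;> simp

end Prim

end Bessel

/-! ### Comparison of primitives, and their limits at the origin -/

namespace Bessel

namespace Prim

/-- Growth at the origin is estimated by comparing derivatives with that of an explicit `G`,
typically a multiple of `recPow`. -/
theorem norm_sub_le {F k : ℝ → ℂ} {G g : ℝ → ℝ} (hF : Prim F k) (hG : Prim G g) {a b : ℝ}
    (ha : 0 < a) (hab : a ≤ b)
    (h : ∀ᵐ x ∂(volume.restrict (Ioi (0 : ℝ))), x ∈ Ioc a b → ‖k x‖ ≤ g x) :
    ‖F b - F a‖ ≤ G b - G a := by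
  obtain ⟨_, h2⟩ := hF.complex_integral ha (ha.trans_le hab)
  obtain ⟨h3, h4⟩ := hG.real_integral ha (ha.trans_le hab)
  rw [← h2, ← h4]
  refine intervalIntegral.norm_integral_le_of_norm_le hab ?_ h3
  rw [ae_restrict_iff' measurableSet_Ioi] at h
  filter_upwards [h] with x hx hm using hx (ha.trans hm.1) hm

theorem sub_le_sub {F k G g : ℝ → ℝ} (hF : Prim F k) (hG : Prim G g) {a b : ℝ}
    (ha : 0 < a) (hab : a ≤ b)
    (h : ∀ᵐ x ∂(volume.restrict (Ioi (0 : ℝ))), x ∈ Ioc a b → k x ≤ g x) :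
    F b - F a ≤ G b - G a := by
  obtain ⟨h1, h2⟩ := hF.real_integral ha (ha.trans_le hab)
  obtain ⟨h3, h4⟩ := hG.real_integral ha (ha.trans_le hab)
  rw [← h2, ← h4, intervalIntegral.integral_of_le hab, intervalIntegral.integral_of_le hab]
  refine setIntegral_mono_ae_restrict h1.1 h3.1 ?_
  rw [ae_restrict_iff' measurableSet_Ioi] at h
  rw [EventuallyLE, ae_restrict_iff' measurableSet_Ioc]
  filter_upwards [h] with x hx hm using hx (ha.trans hm.1) hm

variable {E : Type*} [NormedAddCommGroup E] [NormedSpace ℝ E]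

theorem tendsto_integral_zero {k : ℝ → E} {d : ℝ} (hd : 0 < d)
    (hk : IntervalIntegrable k volume 0 d) :
    Tendsto (fun x => ∫ t in (0 : ℝ)..x, k t) (𝓝[>] 0) (𝓝 0) := by
  have h := intervalIntegral.continuousOn_primitive_interval'
    hk (left_mem_uIcc)
  have h0 := h 0 left_mem_uIcc
  rw [ContinuousWithinAt, intervalIntegral.integral_same, uIcc_of_le hd.le] at h0
  refine h0.mono_left ?_
  rw [← nhdsWithin_Ioc_eq_nhdsGT hd]
  exact nhdsWithin_mono _ Ioc_subset_Icc_self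

/-- A derivative integrable up to the origin forces a limit there. The fundamental theorem is taken
as a hypothesis so that the real and complex cases are both covered. -/
theorem exists_eq_add_integral {F k : ℝ → E}
    (hF : ∀ a b, 0 < a → 0 < b → IntervalIntegrable k volume a b ∧ ∫ x in a..b, k x = F b - F a)
    {d : ℝ} (hd : 0 < d) (hk : IntervalIntegrable k volume 0 d) :
    ∃ w, Tendsto F (𝓝[>] 0) (𝓝 w) ∧ ∀ x ∈ Ioc 0 d, F x = w + ∫ t in (0 : ℝ)..x, k t := by
  have key : ∀ x ∈ Ioc 0 d, F x = (F d - ∫ t in (0 : ℝ)..d, k t) + ∫ t in (0 : ℝ)..x, k t := by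
    intro x hx
    have h1 : IntervalIntegrable k volume 0 x := hk.mono_set (by
      rw [uIcc_of_le hx.1.le, uIcc_of_le hd.le]; exact Icc_subset_Icc_right hx.2)
    have h2 := hF x d hx.1 hd
    rw [← intervalIntegral.integral_add_adjacent_intervals h1 h2.1, h2.2]
    abel
  refine ⟨_, ?_, key⟩
  have h := (tendsto_integral_zero hd hk).const_add (F d - ∫ t in (0 : ℝ)..d, k t)
  rw [add_zero] at h
  refine h.congr' ?_
  filter_upwards [Ioc_mem_nhdsGT hd] with x hx using (key x hx).symm

end Prim

/-! ### The comparison functions at the origin -/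

/-- An antiderivative of `x ^ (-(2 l + 2))` on `(0, ∞)`. -/
def recPow (l x : ℝ) : ℝ := if l = -(1 / 2) then Real.log x else -(x ^ (-(2 * l + 1))) / (2 * l + 1)

theorem hasDerivAt_recPow (l : ℝ) {x : ℝ} (hx : 0 < x) :
    HasDerivAt (recPow l) (x ^ (-(2 * l + 2))) x := by
  unfold recPow
  split_ifs with h
  · have := Real.hasDerivAt_log hx.ne'
    convert this using 1
    rw [h, ← Real.rpow_neg_one]; norm_num
  · have h' : 2 * l + 1 ≠ 0 := fun h0 => h (by linarith)
    have := ((Real.hasDerivAt_rpow_const (p := -(2 * l + 1)) (Or.inl hx.ne')).neg).div_const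
      (2 * l + 1)
    refine this.congr_deriv ?_
    rw [show -(2 * l + 1) - 1 = -(2 * l + 2) by ring]
    field_simp

theorem continuousOn_rpow_Ioi (r : ℝ) : ContinuousOn (fun x : ℝ => x ^ r) (Ioi 0) :=
  fun x hx => (Real.continuousAt_rpow_const x r (Or.inl (ne_of_gt hx))).continuousWithinAt

theorem prim_recPow (l : ℝ) : Prim (recPow l) (fun x => x ^ (-(2 * l + 2))) :=
  Prim.of_hasDerivAt (fun _ hx => hasDerivAt_recPow l hx) (continuousOn_rpow_Ioi _)

theorem prim_rpow (r : ℝ) : Prim (fun x : ℝ => x ^ r) (fun x => r * x ^ (r - 1)) :=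
  Prim.of_hasDerivAt (fun _ hx => Real.hasDerivAt_rpow_const (Or.inl hx.ne'))
    (continuousOn_const.mul (continuousOn_rpow_Ioi _))

theorem recPow_mono (l : ℝ) {x y : ℝ} (hx : 0 < x) (hxy : x ≤ y) : recPow l x ≤ recPow l y := by
  have h := Prim.sub_le_sub (F := fun _ => (0 : ℝ)) (k := fun _ => 0)
    (Prim.of_hasDerivAt (fun x _ => hasDerivAt_const x _) continuousOn_const) (prim_recPow l) hx hxy
    (ae_restrict_of_forall_pos fun t ht _ => (Real.rpow_pos_of_pos ht _).le)
  linarith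

theorem recPow_nonpos {l x : ℝ} (hl : -(1 / 2) ≤ l) (hx : 0 < x) (hx1 : x ≤ 1) :
    recPow l x ≤ 0 := by
  unfold recPow
  split_ifs with h
  · exact Real.log_nonpos hx.le hx1
  · have : 0 ≤ 2 * l + 1 := by linarith
    have := Real.rpow_nonneg hx.le (-(2 * l + 1))
    rw [neg_div]
    have : 0 ≤ x ^ (-(2 * l + 1)) / (2 * l + 1) := by positivity
    linarith

/-- The weight in the integrability hypothesis on `q` at the origin, in a form common to all `l`. -/
def wgt (l x : ℝ) : ℝ := x ^ (2 * l + 2) * (1 - recPow l x)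

theorem continuousOn_wgt (l : ℝ) : ContinuousOn (wgt l) (Ioi 0) :=
  (continuousOn_rpow_Ioi _).mul (continuousOn_const.sub (prim_recPow l).continuousOn)

theorem wgt_neg_half (x : ℝ) : wgt (-(1 / 2)) x = x * (1 - Real.log x) := by
  unfold wgt recPow
  norm_num

theorem wgt_eq {l x : ℝ} (hl : -(1 / 2) < l) (hx : 0 < x) :
    wgt l x = x ^ (2 * l + 2) + x / (2 * l + 1) := by
  have h : l ≠ -(1 / 2) := hl.ne'
  have h' : 2 * l + 1 ≠ 0 := fun h0 => h (by linarith)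
  unfold wgt recPow
  rw [if_neg h, mul_sub, mul_one]
  have : x ^ (2 * l + 2) * x ^ (-(2 * l + 1)) = x := by
    rw [← Real.rpow_add hx, show 2 * l + 2 + -(2 * l + 1) = 1 by ring, Real.rpow_one]
  rw [← mul_div_assoc, mul_neg, this]
  ring

theorem one_le_one_sub_recPow {l x : ℝ} (hl : -(1 / 2) ≤ l) (hx : 0 < x) (hx1 : x ≤ 1) :
    1 ≤ 1 - recPow l x := by linarith [recPow_nonpos hl hx hx1]

theorem Hyp.aestronglyMeasurable {l : ℝ} {q : ℝ → ℝ} (hyp : Hyp l q) :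
    AEStronglyMeasurable q (volume.restrict (Ioi 0)) := hyp.locInt.aestronglyMeasurable

theorem Hyp.intervalIntegrable {l : ℝ} {q : ℝ → ℝ} (hyp : Hyp l q) {a b : ℝ} (ha : 0 < a)
    (hb : 0 < b) : IntervalIntegrable q volume a b := by
  rw [intervalIntegrable_iff']
  refine hyp.locInt.integrableOn_compact_subset (fun x hx => ?_) isCompact_uIcc
  exact (lt_min ha hb).trans_le hx.1

/-- Makes the spectral parameter harmless at the origin: `q - lam` is as integrable against the
weight as `q`. -/
theorem wgt_integrable {l : ℝ} (hl : -(1 / 2) ≤ l) : IntegrableOn (wgt l) (Ioo 0 1) := by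
  have hb : ∃ C, ∀ x ∈ Ioo (0 : ℝ) 1, ‖wgt l x‖ ≤ C := by
    rcases hl.eq_or_lt with h | h
    · refine ⟨2, fun x hx => ?_⟩
      rw [← h, wgt_neg_half]
      have h1 : |x * Real.log x| ≤ 1 := by
        have := Real.abs_log_mul_self_lt x hx.1 hx.2.le
        rw [mul_comm]; exact this.le
      rw [mul_sub, mul_one]
      calc ‖x - x * Real.log x‖ ≤ ‖x‖ + ‖x * Real.log x‖ := norm_sub_le _ _
        _ ≤ 1 + 1 := by
          gcongr
          · rw [Real.norm_of_nonneg hx.1.le]; exact hx.2.le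
          · exact h1
        _ = 2 := by norm_num
    · refine ⟨1 + 1 / (2 * l + 1), fun x hx => ?_⟩
      have h1 : 0 < 2 * l + 1 := by linarith
      have h2 := Real.rpow_le_one hx.1.le hx.2.le (show 0 ≤ 2 * l + 2 by linarith)
      have h3 := Real.rpow_nonneg hx.1.le (2 * l + 2)
      have h4 : x / (2 * l + 1) ≤ 1 / (2 * l + 1) := by gcongr; exact hx.2.le
      have h5 : 0 ≤ x / (2 * l + 1) := div_nonneg hx.1.le h1.le
      rw [wgt_eq h hx.1, Real.norm_of_nonneg (by linarith)]
      linarith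
  obtain ⟨C, hC⟩ := hb
  refine IntegrableOn.of_bound (by simp) ?_ C ?_
  · exact (continuousOn_wgt l).mono Ioo_subset_Ioi_self |>.aestronglyMeasurable measurableSet_Ioo
  · exact (ae_restrict_mem measurableSet_Ioo).mono hC

/-- For `l = -1/2` the weight is exactly `x (1 - log x)`. For `l > -1/2` it is at most `(1 + 1 / (2
l + 1)) x` on `(0, 1)`, because `2 l + 2 ≥ 1`. -/
theorem Hyp.wgt_mul_integrable {l : ℝ} {q : ℝ → ℝ} (hyp : Hyp l q) (lam : ℝ) :
    IntegrableOn (fun x => wgt l x * (q x - lam)) (Ioo 0 1) := by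
  have h1 : IntegrableOn (fun x => wgt l x * q x) (Ioo 0 1) := by
    rcases hyp.le_l.eq_or_lt with h | h
    · refine (hyp.int_zero_log h.symm).congr_fun (fun x hx => ?_) measurableSet_Ioo
      simp only [← h, wgt_neg_half]
    · have h0 : 0 < 2 * l + 1 := by linarith
      refine ((hyp.int_zero h).norm.const_mul (1 + 1 / (2 * l + 1))).mono' ?_ ?_
      · exact ((continuousOn_wgt l).mono Ioo_subset_Ioi_self |>.aestronglyMeasurable
          measurableSet_Ioo).mul (hyp.aestronglyMeasurable.mono_set Ioo_subset_Ioi_self)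
      · refine (ae_restrict_mem measurableSet_Ioo).mono fun x hx => ?_
        have h2 : x ^ (2 * l + 2) ≤ x := by
          have := Real.rpow_le_rpow_of_exponent_ge hx.1 hx.2.le (show 1 ≤ 2 * l + 2 by linarith)
          rwa [Real.rpow_one] at this
        have h3 := Real.rpow_nonneg hx.1.le (2 * l + 2)
        have h5 : 0 ≤ x / (2 * l + 1) := div_nonneg hx.1.le h0.le
        rw [wgt_eq h hx.1, norm_mul, norm_mul, Real.norm_of_nonneg (by linarith),
          Real.norm_of_nonneg hx.1.le, ← mul_assoc]
        gcongr
        have : (1 + 1 / (2 * l + 1)) * x = x + x / (2 * l + 1) := by ring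
        rw [this]; gcongr
  have h2 := h1.sub ((wgt_integrable hyp.le_l).const_mul lam)
  refine h2.congr (Eventually.of_forall fun x => ?_)
  simp only [Pi.sub_apply]; ring

theorem Hyp.wgt_mul_intervalIntegrable {l : ℝ} {q : ℝ → ℝ} (hyp : Hyp l q) (lam : ℝ) {d : ℝ}
    (hd : 0 < d) : IntervalIntegrable (fun x => wgt l x * (q x - lam)) volume 0 d := by
  have h1 : IntervalIntegrable (fun x => wgt l x * (q x - lam)) volume 0 1 := by
    rw [intervalIntegrable_iff_integrableOn_Ioo_of_le zero_le_one]
    exact hyp.wgt_mul_integrable lam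
  refine h1.trans ?_
  refine IntervalIntegrable.continuousOn_mul ?_ ?_
  · exact (hyp.intervalIntegrable one_pos hd).sub intervalIntegrable_const
  · exact (continuousOn_wgt l).mono fun x hx => (lt_min one_pos hd).trans_le hx.1

end Bessel

namespace Bessel

/-! ### Solutions -/

variable {l lam : ℝ} {q φ : ℝ → ℝ}

theorem LocAC2.hasDerivAt {E : Type*} [NormedAddCommGroup E] [NormedSpace ℝ E] {u : ℝ → E}
    (hu : LocAC2 u) {x : ℝ} (hx : 0 < x) : HasDerivAt u (deriv u x) x :=
  (hu.1.differentiableAt (Ioi_mem_nhds hx)).hasDerivAt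

theorem LocAC2.prim {E : Type*} [NormedAddCommGroup E] [NormedSpace ℝ E] {u : ℝ → E}
    (hu : LocAC2 u) : Prim u (deriv u) :=
  Prim.of_hasDerivAt (fun _ hx => hu.hasDerivAt hx) hu.2.continuousOn

theorem IsSolution.prim_deriv (hφ : IsSolution l q lam φ) :
    Prim (deriv φ) (fun x => (l * (l + 1) / x ^ 2 + q x - lam) * φ x) := by
  refine (Prim.of_real_locAC hφ.1.2).congr_ae ?_
  filter_upwards [hφ.2] with x hx
  simp only [tau, smul_eq_mul] at hx
  rw [sub_mul]
  linarith

theorem LocAC2.prim_deriv {u : ℝ → ℂ} (hu : LocAC2 u) :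
    Prim (deriv u) (fun x => (((l * (l + 1) / x ^ 2 + q x : ℝ) : ℂ)) * u x - tau l q u x) := by
  refine (Prim.of_locAC hu.2).congr_ae (Eventually.of_forall fun x => ?_)
  simp only [tau, Complex.real_smul]
  ring

/-- `x ^ (2 l + 2)` times the derivative of `x ^ (-(l + 1)) φ`. -/
def quasiDeriv (l : ℝ) (φ : ℝ → ℝ) (x : ℝ) : ℝ :=
  x ^ (l + 1) * deriv φ x - (l + 1) * x ^ l * φ x

/-- `quasiDeriv` is the Wronskian of `x ^ (l + 1)` and `φ`. Since `x ^ (l + 1)` solves the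
unperturbed equation, the singular term `l (l + 1) / x ^ 2` cancels and only `q - lam` remains. -/
theorem IsSolution.prim_quasiDeriv (hφ : IsSolution l q lam φ) :
    Prim (quasiDeriv l φ) (fun x => x ^ (l + 1) * (q x - lam) * φ x) := by
  have h1 := (prim_rpow (l + 1)).mul hφ.prim_deriv
  have h2 := (Prim.of_hasDerivAt (fun x _ => hasDerivAt_const x (l + 1)) continuousOn_const).mul
    ((prim_rpow l).mul hφ.1.prim)
  refine ((h1.sub h2).congr_left fun x _ => ?_).congr_ae (ae_restrict_of_forall_pos fun x hx => ?_)
  · simp only [quasiDeriv]; ring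
  · have e1 : x ^ (l + 1) = x ^ l * x := Real.rpow_add_one hx.ne' l
    have e2 : x ^ l = x ^ (l - 1) * x := by
      rw [← Real.rpow_add_one hx.ne']; ring_nf
    simp only [add_sub_cancel_right, zero_mul, zero_add]
    rw [e1, e2]
    field_simp
    ring

theorem IsSolution.prim_quot (hφ : IsSolution l q lam φ) :
    Prim (fun x => φ x / x ^ (l + 1)) (fun x => quasiDeriv l φ x * x ^ (-(2 * l + 2))) := by
  have h1 := (prim_rpow (-(l + 1))).mul hφ.1.prim
  refine (h1.congr_left fun x hx => ?_).congr_ae (ae_restrict_of_forall_pos fun x hx => ?_)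
  · simp only [Real.rpow_neg (le_of_lt (show (0 : ℝ) < x from hx))]
    ring
  · have hp := Real.rpow_pos_of_pos hx l
    have e1 : x ^ (l + 1) = x ^ l * x := Real.rpow_add_one hx.ne' l
    have e2 : x ^ (-(l + 1) - 1) = (x ^ l * x * x)⁻¹ := by
      rw [show -(l + 1) - 1 = -(l + 1 + 1) by ring, Real.rpow_neg hx.le, Real.rpow_add_one hx.ne', e1]
    have e3 : x ^ (-(2 * l + 2)) = (x ^ l * x * (x ^ l * x))⁻¹ := by
      rw [← e1, ← Real.rpow_add hx, ← Real.rpow_neg hx.le]; ring_nf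
    have e4 : x ^ (-(l + 1)) = (x ^ l * x)⁻¹ := by rw [Real.rpow_neg hx.le, e1]
    simp only [quasiDeriv]
    rw [e1, e2, e3, e4]
    field_simp
    ring

namespace IsRegularSolution

theorem exists_bounds (hφ : IsRegularSolution l q lam φ) :
    ∃ d, 0 < d ∧ d ≤ 1 ∧ ∀ x ∈ Ioc 0 d, 1 / 2 * x ^ (l + 1) ≤ φ x ∧ φ x ≤ 2 * x ^ (l + 1) := by
  have h := hφ.2.eventually (Ioo_mem_nhds (show (1 / 2 : ℝ) < 1 by norm_num) one_lt_two)
  rw [eventually_nhdsWithin_iff, Metric.eventually_nhds_iff] at h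
  obtain ⟨ε, hε, h⟩ := h
  refine ⟨min (ε / 2) 1, by positivity, min_le_right _ _, fun x hx => ?_⟩
  have hx1 : x ≤ ε / 2 := hx.2.trans (min_le_left _ _)
  have h1 := h (y := x) (by rw [Real.dist_eq, sub_zero, abs_of_pos hx.1]; linarith) hx.1
  have hp := Real.rpow_pos_of_pos hx.1 (l + 1)
  rw [lt_div_iff₀ hp, div_lt_iff₀ hp] at h1
  exact ⟨h1.1.le, h1.2.le⟩

/-- The asymptotics of `φ` alone determine those of `φ'`. The derivative of the quasi-derivative,
even multiplied by `1 - recPow`, is dominated by the integrable `wgt * (q - lam)`, so the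
quasi-derivative has a limit, necessarily 0; integrating from 0 then gives the decay rate. -/
theorem tendsto_quasiDeriv_mul (hφ : IsRegularSolution l q lam φ) (hyp : Hyp l q) :
    Tendsto (fun x => quasiDeriv l φ x * (1 - recPow l x)) (𝓝[>] 0) (𝓝 0) := by
  obtain ⟨d, hd, hd1, hb⟩ := hφ.exists_bounds
  set k : ℝ → ℝ := fun x => x ^ (l + 1) * (q x - lam) * φ x with hk
  have hP : Prim (quasiDeriv l φ) k := hφ.1.prim_quasiDeriv
  have hw := hyp.wgt_mul_intervalIntegrable lam hd
  have hwn : IntervalIntegrable (fun x => 2 * ‖wgt l x * (q x - lam)‖) volume 0 d :=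
    hw.norm.const_mul 2
  have hkb : ∀ x ∈ Ioc 0 d, ‖k x‖ * (1 - recPow l x) ≤ 2 * ‖wgt l x * (q x - lam)‖ := by
    intro x hx
    have hp := Real.rpow_pos_of_pos hx.1 (l + 1)
    have hD := one_le_one_sub_recPow hyp.le_l hx.1 (hx.2.trans hd1)
    have hφ0 : 0 ≤ φ x := le_trans (by positivity) (hb x hx).1
    have e : x ^ (2 * l + 2) = x ^ (l + 1) * x ^ (l + 1) := by
      rw [← Real.rpow_add hx.1]; ring_nf
    have hDn : 0 ≤ 1 - recPow l x := by linarith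
    simp only [hk, wgt, e, norm_mul]
    rw [Real.norm_of_nonneg hp.le, Real.norm_of_nonneg hφ0, Real.norm_of_nonneg hDn]
    have := (hb x hx).2
    calc x ^ (l + 1) * ‖q x - lam‖ * φ x * (1 - recPow l x)
        ≤ x ^ (l + 1) * ‖q x - lam‖ * (2 * x ^ (l + 1)) * (1 - recPow l x) := by gcongr
      _ = _ := by ring
  have hkb1 : ∀ x ∈ Ioc 0 d, ‖k x‖ ≤ 2 * ‖wgt l x * (q x - lam)‖ := by
    intro x hx
    have hD := one_le_one_sub_recPow hyp.le_l hx.1 (hx.2.trans hd1)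
    exact (le_mul_of_one_le_right (norm_nonneg _) hD).trans (hkb x hx)
  have hkm : AEStronglyMeasurable k (volume.restrict (Ioi 0)) :=
    (((continuousOn_rpow_Ioi (l + 1)).aestronglyMeasurable measurableSet_Ioi).mul
      (hyp.aestronglyMeasurable.sub aestronglyMeasurable_const)).mul
      (hφ.1.1.prim.continuousOn.aestronglyMeasurable measurableSet_Ioi)
  have hki : IntervalIntegrable k volume 0 d := by
    refine hwn.mono_fun' ?_ ?_
    · rw [uIoc_of_le hd.le]; exact hkm.mono_set Ioc_subset_Ioi_self
    · rw [uIoc_of_le hd.le]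
      exact (ae_restrict_mem measurableSet_Ioc).mono hkb1
  obtain ⟨w, hw1, hw2⟩ := Prim.exists_eq_add_integral (fun a b ha hb => hP.real_integral ha hb) hd hki
  -- If `w ≠ 0`, then `w` times the derivative of `φ / x ^ (l + 1)` exceeds a positive multiple of
  -- `1 / x`. The quotient would diverge logarithmically at the origin instead of tending to 1.
  have hw0 : w = 0 := by
    by_contra hne
    have hww : 0 < w * w := mul_self_pos.2 hne
    have hev : ∀ᶠ x in 𝓝[>] (0 : ℝ), w * w / 2 < w * quasiDeriv l φ x :=
      (hw1.const_mul w).eventually (lt_mem_nhds (by linarith))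
    rw [eventually_nhdsWithin_iff, Metric.eventually_nhds_iff] at hev
    obtain ⟨ε, hε, hev⟩ := hev
    set b := min (ε / 2) 1 with hbdef
    have hb0 : 0 < b := by positivity
    have hW := ((Prim.of_hasDerivAt (fun x _ => hasDerivAt_const x w) continuousOn_const).mul
        hφ.1.prim_quot)
    have hL := (Prim.of_hasDerivAt (fun x _ => hasDerivAt_const x (w * w / 2))
      continuousOn_const).mul (Prim.of_hasDerivAt (fun x hx => Real.hasDerivAt_log (ne_of_gt hx))
        (continuousOn_id.inv₀ fun x hx => ne_of_gt hx))
    have hle : ∀ a ∈ Ioc 0 b, w * (φ a / a ^ (l + 1)) + -(w * w / 2 * Real.log a) ≤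
        w * (φ b / b ^ (l + 1)) - w * w / 2 * Real.log b := by
      intro a ha
      have := hL.sub_le_sub hW ha.1 ha.2 (ae_restrict_of_forall_pos fun x hx hm => by
        have hx1 : x ≤ 1 := hm.2.trans (min_le_right _ _)
        have hxe : x ≤ ε / 2 := hm.2.trans (min_le_left _ _)
        have h1 := hev (y := x) (by rw [Real.dist_eq, sub_zero, abs_of_pos hx]; linarith) hx
        have h2 : x⁻¹ ≤ x ^ (-(2 * l + 2)) := by
          rw [← Real.rpow_neg_one]
          exact Real.rpow_le_rpow_of_exponent_ge hx hx1 (by linarith [hyp.le_l])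
        simp only [zero_mul, zero_add]
        rw [← mul_assoc]
        exact mul_le_mul h1.le h2 (inv_nonneg.2 hx.le) (by linarith))
      linarith
    have hlog : Tendsto (fun a => -(w * w / 2 * Real.log a)) (𝓝[>] 0) atTop :=
      tendsto_neg_atBot_atTop.comp
        (Real.tendsto_log_nhdsGT_zero.const_mul_atBot (by linarith))
    have htop := (hφ.2.const_mul w).add_atTop hlog
    obtain ⟨a, ha1, ha2⟩ := ((htop.eventually_gt_atTop
      (w * (φ b / b ^ (l + 1)) - w * w / 2 * Real.log b)).and (Ioc_mem_nhdsGT hb0)).exists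
    exact absurd (hle a ha2) (not_le.2 ha1)
  refine squeeze_zero_norm' ?_ (Prim.tendsto_integral_zero hd hwn)
  filter_upwards [Ioc_mem_nhdsGT hd] with x hx
  have hD := one_le_one_sub_recPow hyp.le_l hx.1 (hx.2.trans hd1)
  have hsub : uIcc 0 x ⊆ uIcc 0 d := by
    rw [uIcc_of_le hx.1.le, uIcc_of_le hd.le]; exact Icc_subset_Icc_right hx.2
  rw [hw2 x hx, hw0, zero_add, mul_comm, ← intervalIntegral.integral_const_mul]
  refine intervalIntegral.norm_integral_le_of_norm_le hx.1.le
    (Eventually.of_forall fun t ht => ?_) (hwn.mono_set hsub)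
  -- Monotonicity lets the factor `1 - recPow l x` outside the integral be replaced by the larger `1
  -- - recPow l t` inside.
  have hDt := recPow_mono l ht.1 ht.2
  rw [norm_mul, Real.norm_of_nonneg (by linarith), mul_comm]
  refine le_trans ?_ (hkb t ⟨ht.1, ht.2.trans hx.2⟩)
  gcongr

theorem tendsto_quasiDeriv (hφ : IsRegularSolution l q lam φ) (hyp : Hyp l q) :
    Tendsto (quasiDeriv l φ) (𝓝[>] 0) (𝓝 0) := by
  refine squeeze_zero_norm' ?_ ((hφ.tendsto_quasiDeriv_mul hyp).norm.trans_eq (by simp))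
  filter_upwards [Ioc_mem_nhdsGT one_pos] with x hx
  have hD := one_le_one_sub_recPow hyp.le_l hx.1 hx.2
  rw [norm_mul]
  exact le_mul_of_one_le_right (norm_nonneg _) (hD.trans (le_abs_self _))

end IsRegularSolution

end Bessel

namespace Bessel

variable {l lam : ℝ} {q : ℝ → ℝ}

/-! ### Existence of the regular solution -/

theorem _root_.AbsolutelyContinuousOnInterval.comp_lipschitzOnWith {E F : Type*}
    [PseudoMetricSpace E] [PseudoMetricSpace F] {f : ℝ → E} {g : E → F} {a b : ℝ} {K : NNReal}
    (hf : AbsolutelyContinuousOnInterval f a b) (hg : LipschitzOnWith K g (f '' uIcc a b)) :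
    AbsolutelyContinuousOnInterval (fun x => g (f x)) a b := by
  rw [absolutelyContinuousOnInterval_iff] at hf ⊢
  intro ε hε
  obtain ⟨δ, hδ, h⟩ := hf (ε / (K + 1)) (by positivity)
  refine ⟨δ, hδ, fun E hE hlt => ?_⟩
  have h1 := h E hE hlt
  have h2 : ∑ i ∈ Finset.range E.1, dist (g (f (E.2 i).1)) (g (f (E.2 i).2)) ≤
      K * ∑ i ∈ Finset.range E.1, dist (f (E.2 i).1) (f (E.2 i).2) := by
    rw [Finset.mul_sum]
    exact Finset.sum_le_sum fun i hi =>
      hg.dist_le_mul _ (mem_image_of_mem _ (hE.1 i hi).1) _ (mem_image_of_mem _ (hE.1 i hi).2)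
  rw [lt_div_iff₀ (by positivity)] at h1
  have h3 : 0 ≤ ∑ i ∈ Finset.range E.1, dist (f (E.2 i).1) (f (E.2 i).2) :=
    Finset.sum_nonneg fun i _ => dist_nonneg
  nlinarith

namespace Prim

/-- On a compact interval `f` is bounded, and `exp` is Lipschitz on bounded sets. -/
theorem exp {f k : ℝ → ℝ} (h : Prim f k) :
    Prim (fun x => Real.exp (f x)) (fun x => Real.exp (f x) * k x) := by
  refine ⟨fun a b ha hab => ?_, h.2.mono fun x hx => hx.exp⟩
  obtain ⟨C, hC⟩ := (h.1 a b ha hab).exists_bound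
  obtain ⟨K, hK⟩ := (Real.contDiff_exp (n := 1)).contDiffOn.exists_lipschitzOnWith
    (s := Icc (-C) C) (by decide) (convex_Icc _ _) isCompact_Icc
  refine (h.1 a b ha hab).comp_lipschitzOnWith (hK.mono ?_)
  rintro _ ⟨x, hx, rfl⟩
  exact abs_le.1 (hC x hx)

theorem hasDerivAt_of_continuousOn {f k : ℝ → ℝ} (h : Prim f k) (hk : ContinuousOn k (Ioi 0))
    {x : ℝ} (hx : 0 < x) : HasDerivAt f (k x) x := by
  have h1 : HasDerivAt (fun y => f 1 + ∫ t in (1 : ℝ)..y, k t) (k x) x := by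
    refine (intervalIntegral.integral_hasDerivAt_right (h.real_integral one_pos hx).1 ?_
      (hk.continuousAt (Ioi_mem_nhds hx))).const_add _
    exact hk.stronglyMeasurableAtFilter isOpen_Ioi x hx
  refine h1.congr_of_eventuallyEq ?_
  filter_upwards [Ioi_mem_nhds hx] with y hy
  rw [(h.real_integral one_pos hy).2]
  ring

theorem integral_zero {k : ℝ → ℝ} (hk : ∀ R, 0 < R → IntervalIntegrable k volume 0 R) :
    Prim (fun x => ∫ t in (0 : ℝ)..x, k t) k := by
  refine (of_real_integral (fun a b ha hab => ?_) (∫ t in (0 : ℝ)..1, k t)).congr_left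
    fun x hx => ?_
  · refine (hk b (ha.trans_le hab)).mono_set ?_
    rw [uIcc_of_le hab, uIcc_of_le (ha.le.trans hab)]
    exact Icc_subset_Icc_left ha.le
  · exact intervalIntegral.integral_add_adjacent_intervals (hk 1 one_pos)
      ((hk 1 one_pos).symm.trans (hk x hx))

end Prim

theorem recPow_le (hl : -(1 / 2) ≤ l) {x : ℝ} (hx : 0 < x) : recPow l x ≤ x := by
  unfold recPow
  split_ifs with h
  · linarith [Real.log_le_sub_one_of_pos hx]
  · have h1 : 0 ≤ 2 * l + 1 := by linarith
    have h2 := Real.rpow_nonneg hx.le (-(2 * l + 1))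
    rw [neg_div]
    have : 0 ≤ x ^ (-(2 * l + 1)) / (2 * l + 1) := by positivity
    linarith

/-- The weight `x ^ (2 l + 2) (1 + |recPow l x|)`, which agrees with `wgt` on `(0, 1]`. -/
def absWgt (l x : ℝ) : ℝ := x ^ (2 * l + 2) * (1 + |recPow l x|)

theorem absWgt_nonneg {x : ℝ} (hx : 0 < x) : 0 ≤ absWgt l x :=
  mul_nonneg (Real.rpow_nonneg hx.le _) (by positivity)

theorem Hyp.absWgt_integrable (hyp : Hyp l q) (lam : ℝ) {R : ℝ} (hR : 0 < R) :
    IntervalIntegrable (fun x => absWgt l x * |q x - lam|) volume 0 R := by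
  have h1 : IntervalIntegrable (fun x => absWgt l x * |q x - lam|) volume 0 1 := by
    rw [intervalIntegrable_iff_integrableOn_Ioo_of_le zero_le_one]
    have h0 : IntegrableOn (fun x => ‖wgt l x * (q x - lam)‖) (Ioo 0 1) :=
      (hyp.wgt_mul_integrable lam).norm
    refine h0.congr_fun (fun x hx => ?_) measurableSet_Ioo
    have h2 := recPow_nonpos hyp.le_l hx.1 hx.2.le
    have h3 := Real.rpow_nonneg hx.1.le (2 * l + 2)
    simp only [absWgt, wgt]
    rw [norm_mul, norm_mul, Real.norm_of_nonneg h3, abs_of_nonpos h2,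
      Real.norm_of_nonneg (show 0 ≤ 1 - recPow l x by linarith), Real.norm_eq_abs]
    ring
  refine h1.trans (IntervalIntegrable.continuousOn_mul ?_ ?_)
  · exact ((hyp.intervalIntegrable one_pos hR).sub intervalIntegrable_const).norm
  · exact ((continuousOn_rpow_Ioi _).mul (continuousOn_const.add
      (prim_recPow l).continuousOn.abs)).mono fun x hx => (lt_min one_pos hR).trans_le hx.1

/-- The exponent of the weight for which the Volterra operator is a contraction. -/
def expo (l : ℝ) (q : ℝ → ℝ) (lam x : ℝ) : ℝ :=
  ∫ t in (0 : ℝ)..x, 2 * (1 + t) * (absWgt l t * |q t - lam|)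

/-- The weight for which the Volterra operator is a contraction. -/
def growth (l : ℝ) (q : ℝ → ℝ) (lam x : ℝ) : ℝ := (1 + x) * Real.exp (expo l q lam x)

theorem Hyp.expo_integrable (hyp : Hyp l q) (lam : ℝ) {R : ℝ} (hR : 0 < R) :
    IntervalIntegrable (fun t => 2 * (1 + t) * (absWgt l t * |q t - lam|)) volume 0 R :=
  (hyp.absWgt_integrable lam hR).continuousOn_mul (by fun_prop)

theorem Hyp.prim_expo (hyp : Hyp l q) (lam : ℝ) :
    Prim (expo l q lam) (fun t => 2 * (1 + t) * (absWgt l t * |q t - lam|)) :=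
  Prim.integral_zero fun _ hR => hyp.expo_integrable lam hR

theorem Hyp.expo_mono (hyp : Hyp l q) {x y : ℝ} (hx : 0 < x) (hxy : x ≤ y) :
    expo l q lam x ≤ expo l q lam y := by
  have h := Prim.sub_le_sub (F := fun _ => (0 : ℝ)) (k := fun _ => 0)
    (Prim.of_hasDerivAt (fun x _ => hasDerivAt_const x _) continuousOn_const) (hyp.prim_expo lam)
    hx hxy (ae_restrict_of_forall_pos fun t ht _ => by
      have := absWgt_nonneg (l := l) ht
      positivity)
  linarith

theorem growth_pos {x : ℝ} (hx : 0 < x) : 0 < growth l q lam x :=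
  mul_pos (by linarith) (Real.exp_pos _)

theorem Hyp.growth_mono (hyp : Hyp l q) {x y : ℝ} (hx : 0 < x) (hxy : x ≤ y) :
    growth l q lam x ≤ growth l q lam y :=
  mul_le_mul (by linarith) (Real.exp_le_exp.2 (hyp.expo_mono hx hxy)) (Real.exp_pos _).le
    (by linarith)

theorem one_le_growth {x : ℝ} (hx : 0 < x) : 1 ≤ growth l q lam x := by
  have h1 : 0 ≤ expo l q lam x := intervalIntegral.integral_nonneg_of_ae_restrict hx.le (by
    rw [EventuallyLE, ae_restrict_iff' measurableSet_Icc]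
    filter_upwards [Measure.ae_ne volume (0 : ℝ)] with t ht htm
    have ht0 : 0 < t := lt_of_le_of_ne htm.1 (Ne.symm ht)
    have := absWgt_nonneg (l := l) ht0
    simp only [Pi.zero_apply]
    positivity)
  have h2 := Real.one_le_exp h1
  unfold growth
  nlinarith

theorem Hyp.continuousOn_growth (hyp : Hyp l q) : ContinuousOn (growth l q lam) (Ioi 0) :=
  (continuousOn_const.add continuousOn_id).mul
    (Real.continuous_exp.comp_continuousOn (hyp.prim_expo lam).continuousOn)

/-- The integrand is half the derivative of `exp (expo)`; this is why `expo` carries the factor `2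
(1 + t)`. The nonnegative boundary value at 0 is dropped. -/
theorem Hyp.integral_exp_le (hyp : Hyp l q) {x : ℝ} (hx : 0 < x) :
    IntervalIntegrable (fun t => growth l q lam t * (absWgt l t * |q t - lam|)) volume 0 x ∧
    ∫ t in (0 : ℝ)..x, growth l q lam t * (absWgt l t * |q t - lam|) ≤
      1 / 2 * Real.exp (expo l q lam x) := by
  have hP := (hyp.prim_expo lam).exp
  have hi : IntervalIntegrable (fun t => growth l q lam t * (absWgt l t * |q t - lam|))
      volume 0 x := by
    refine ((hyp.absWgt_integrable lam hx).const_mul (growth l q lam x)).mono_fun' ?_ ?_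
    · rw [uIoc_of_le hx.le]
      exact ((hyp.continuousOn_growth.mono Ioc_subset_Ioi_self).aestronglyMeasurable
        measurableSet_Ioc).mul (hyp.absWgt_integrable lam hx).1.1
    · rw [uIoc_of_le hx.le]
      refine (ae_restrict_mem measurableSet_Ioc).mono fun t ht => ?_
      have h1 := absWgt_nonneg (l := l) ht.1
      have h2 := growth_pos (l := l) (q := q) (lam := lam) ht.1
      beta_reduce
      rw [norm_mul, Real.norm_of_nonneg h2.le, Real.norm_of_nonneg (by positivity)]
      gcongr
      exact hyp.growth_mono ht.1 ht.2
  refine ⟨hi, ?_⟩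
  have e : ∀ t, Real.exp (expo l q lam t) * (2 * (1 + t) * (absWgt l t * |q t - lam|)) =
      2 * (growth l q lam t * (absWgt l t * |q t - lam|)) := fun t => by
    unfold growth; ring
  simp only [e] at hP
  obtain ⟨w, hw1, hw2⟩ := Prim.exists_eq_add_integral
    (fun a b ha hb => hP.real_integral ha hb) hx (hi.const_mul 2)
  have hw0 : 0 ≤ w := ge_of_tendsto' hw1 fun t => (Real.exp_pos _).le
  have := hw2 x ⟨hx, le_rfl⟩
  rw [intervalIntegral.integral_const_mul] at this
  linarith

/-- The Volterra operator of the equation for `x ^ (-(l + 1)) φ`. -/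
def volterra (l : ℝ) (q : ℝ → ℝ) (lam : ℝ) (ψ : ℝ → ℝ) (x : ℝ) : ℝ :=
  recPow l x * (∫ t in (0 : ℝ)..x, t ^ (2 * l + 2) * (q t - lam) * ψ t) -
    ∫ t in (0 : ℝ)..x, t ^ (2 * l + 2) * recPow l t * (q t - lam) * ψ t

/-- Continuous functions on `(0, ∞)` that are bounded by `M` times the weight. -/
structure Admissible (l : ℝ) (q : ℝ → ℝ) (lam : ℝ) (ψ : ℝ → ℝ) (M : ℝ) : Prop where
  cont : ContinuousOn ψ (Ioi 0)
  bound : ∀ x, 0 < x → |ψ x| ≤ M * growth l q lam x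

namespace Admissible

variable {ψ ψ' : ℝ → ℝ} {M : ℝ}

/-- Serves both integrals in `volterra`: the two factors `t ^ (2 l + 2)` and `t ^ (2 l + 2) * recPow
l t` are each dominated by `absWgt`. -/
theorem integrable_mul (h : Admissible l q lam ψ M) (hyp : Hyp l q) {w : ℝ → ℝ}
    (hwc : ContinuousOn w (Ioi 0)) (hw : ∀ x, 0 < x → |w x| ≤ absWgt l x) {R : ℝ} (hR : 0 < R) :
    IntervalIntegrable (fun t => w t * (q t - lam) * ψ t) volume 0 R := by
  refine ((hyp.integral_exp_le (lam := lam) hR).1.const_mul M).mono_fun' ?_ ?_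
  · rw [uIoc_of_le hR.le]
    refine AEStronglyMeasurable.mono_set Ioc_subset_Ioi_self ?_
    exact ((hwc.aestronglyMeasurable measurableSet_Ioi).mul
      (hyp.aestronglyMeasurable.sub aestronglyMeasurable_const)).mul
      (h.cont.aestronglyMeasurable measurableSet_Ioi)
  · rw [uIoc_of_le hR.le]
    refine (ae_restrict_mem measurableSet_Ioc).mono fun t ht => ?_
    beta_reduce
    rw [norm_mul, norm_mul, Real.norm_eq_abs, Real.norm_eq_abs, Real.norm_eq_abs]
    calc |w t| * |q t - lam| * |ψ t| ≤ absWgt l t * |q t - lam| * (M * growth l q lam t) :=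
          mul_le_mul (mul_le_mul_of_nonneg_right (hw t ht.1) (abs_nonneg _)) (h.bound t ht.1)
            (abs_nonneg _) (mul_nonneg (absWgt_nonneg ht.1) (abs_nonneg _))
      _ = _ := by ring

theorem integrable_left (h : Admissible l q lam ψ M) (hyp : Hyp l q) {R : ℝ} (hR : 0 < R) :
    IntervalIntegrable (fun t => t ^ (2 * l + 2) * (q t - lam) * ψ t) volume 0 R := by
  refine h.integrable_mul hyp (continuousOn_rpow_Ioi _) (fun x hx => ?_) hR
  rw [abs_of_nonneg (Real.rpow_nonneg hx.le _)]
  exact le_mul_of_one_le_right (Real.rpow_nonneg hx.le _) (by linarith [abs_nonneg (recPow l x)])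

theorem integrable_right (h : Admissible l q lam ψ M) (hyp : Hyp l q) {R : ℝ} (hR : 0 < R) :
    IntervalIntegrable (fun t => t ^ (2 * l + 2) * recPow l t * (q t - lam) * ψ t) volume 0 R := by
  refine h.integrable_mul hyp ((continuousOn_rpow_Ioi _).mul (prim_recPow l).continuousOn)
    (fun x hx => ?_) hR
  change |x ^ (2 * l + 2) * recPow l x| ≤ _
  rw [abs_mul, abs_of_nonneg (Real.rpow_nonneg hx.le _)]
  exact mul_le_mul_of_nonneg_left (by linarith) (Real.rpow_nonneg hx.le _)

theorem prim_left (h : Admissible l q lam ψ M) (hyp : Hyp l q) :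
    Prim (fun x => ∫ t in (0 : ℝ)..x, t ^ (2 * l + 2) * (q t - lam) * ψ t)
      (fun t => t ^ (2 * l + 2) * (q t - lam) * ψ t) :=
  Prim.integral_zero fun _ hR => h.integrable_left hyp hR

theorem prim_volterra (h : Admissible l q lam ψ M) (hyp : Hyp l q) :
    Prim (volterra l q lam ψ) (fun x => x ^ (-(2 * l + 2)) *
      ∫ t in (0 : ℝ)..x, t ^ (2 * l + 2) * (q t - lam) * ψ t) := by
  have h1 := ((prim_recPow l).mul (h.prim_left hyp)).sub
    (Prim.integral_zero fun _ hR => h.integrable_right hyp hR)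
  refine h1.congr_ae (Eventually.of_forall fun x => ?_)
  ring

/-- The two integrals are merged into one with kernel `recPow l x - recPow l t ≥ 0`. As `recPow l x
≤ x`, the kernel is at most `(1 + x) (1 + |recPow l t|)`, which separates the variables. -/
theorem abs_volterra_le_integral (h : Admissible l q lam ψ M) (hyp : Hyp l q) {x : ℝ}
    (hx : 0 < x) : |volterra l q lam ψ x| ≤
      (1 + x) * M * ∫ t in (0 : ℝ)..x, growth l q lam t * (absWgt l t * |q t - lam|) := by
  rw [volterra, ← intervalIntegral.integral_const_mul, ← intervalIntegral.integral_sub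
    ((h.integrable_left hyp hx).const_mul _) (h.integrable_right hyp hx),
    ← intervalIntegral.integral_const_mul, ← Real.norm_eq_abs]
  refine intervalIntegral.norm_integral_le_of_norm_le hx.le
    (Eventually.of_forall fun t ht => ?_) ((hyp.integral_exp_le hx).1.const_mul _)
  have hp := Real.rpow_nonneg ht.1.le (2 * l + 2)
  have h1 := recPow_mono l ht.1 ht.2
  have h2 := recPow_le hyp.le_l hx
  have e : recPow l x * (t ^ (2 * l + 2) * (q t - lam) * ψ t) -
      t ^ (2 * l + 2) * recPow l t * (q t - lam) * ψ t =
      t ^ (2 * l + 2) * (recPow l x - recPow l t) * (q t - lam) * ψ t := by ring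
  rw [e, norm_mul, norm_mul, norm_mul, Real.norm_of_nonneg hp,
    Real.norm_of_nonneg (sub_nonneg.2 h1), Real.norm_eq_abs, Real.norm_eq_abs]
  have h3 : recPow l x - recPow l t ≤ (1 + x) * (1 + |recPow l t|) := by
    nlinarith [abs_nonneg (recPow l t), neg_abs_le (recPow l t)]
  have h4 := h.bound t ht.1
  calc t ^ (2 * l + 2) * (recPow l x - recPow l t) * |q t - lam| * |ψ t|
      ≤ t ^ (2 * l + 2) * ((1 + x) * (1 + |recPow l t|)) * |q t - lam| *
          (M * growth l q lam t) := by gcongr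
    _ = _ := by unfold absWgt; ring

theorem nonneg (h : Admissible l q lam ψ M) : 0 ≤ M := by
  have h1 := (abs_nonneg _).trans (h.bound 1 one_pos)
  exact nonneg_of_mul_nonneg_left h1 (growth_pos one_pos)

/-- The factor `1/2` is the contraction constant in the norm weighted by `growth`. -/
theorem abs_volterra_le (h : Admissible l q lam ψ M) (hyp : Hyp l q) {x : ℝ} (hx : 0 < x) :
    |volterra l q lam ψ x| ≤ 1 / 2 * M * growth l q lam x := by
  have hM := h.nonneg
  calc |volterra l q lam ψ x| ≤ (1 + x) * M *
        ∫ t in (0 : ℝ)..x, growth l q lam t * (absWgt l t * |q t - lam|) :=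
        h.abs_volterra_le_integral hyp hx
    _ ≤ (1 + x) * M * (1 / 2 * Real.exp (expo l q lam x)) := by
        gcongr; exact (hyp.integral_exp_le hx).2
    _ = _ := by unfold growth; ring

theorem volterra_sub {M' : ℝ} (h : Admissible l q lam ψ M) (h' : Admissible l q lam ψ' M')
    (hyp : Hyp l q) {x : ℝ} (hx : 0 < x) :
    volterra l q lam (fun t => ψ t - ψ' t) x = volterra l q lam ψ x - volterra l q lam ψ' x := by
  have e1 : ∀ t, t ^ (2 * l + 2) * (q t - lam) * (ψ t - ψ' t) =
      t ^ (2 * l + 2) * (q t - lam) * ψ t - t ^ (2 * l + 2) * (q t - lam) * ψ' t :=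
    fun t => by ring
  have e2 : ∀ t, t ^ (2 * l + 2) * recPow l t * (q t - lam) * (ψ t - ψ' t) =
      t ^ (2 * l + 2) * recPow l t * (q t - lam) * ψ t -
        t ^ (2 * l + 2) * recPow l t * (q t - lam) * ψ' t := fun t => by ring
  simp only [volterra, e1, e2]
  rw [intervalIntegral.integral_sub (h.integrable_left hyp hx) (h'.integrable_left hyp hx),
    intervalIntegral.integral_sub (h.integrable_right hyp hx) (h'.integrable_right hyp hx)]
  ring

end Admissible

open BoundedContinuousFunction in
theorem Hyp.admissible (hyp : Hyp l q) (lam : ℝ) (χ : ℝ →ᵇ ℝ) :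
    Admissible l q lam (fun x => growth l q lam x * χ (Real.log x)) ‖χ‖ := by
  refine ⟨hyp.continuousOn_growth.mul (χ.continuous.comp_continuousOn
    (Real.continuousOn_log.mono fun x hx => ne_of_gt hx)), fun x hx => ?_⟩
  rw [abs_mul, abs_of_pos (growth_pos hx), mul_comm]
  exact mul_le_mul_of_nonneg_right (χ.norm_coe_le_norm _) (growth_pos hx).le

open BoundedContinuousFunction in
theorem Hyp.exists_fixed (hyp : Hyp l q) (lam : ℝ) :
    ∃ ψ M, Admissible l q lam ψ M ∧ ∀ x, 0 < x → ψ x = 1 + volterra l q lam ψ x := by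
  -- Dividing by the weight and substituting `x = exp t` identifies the weighted space with bounded
  -- continuous functions on the line, a complete space on which Banach's theorem applies.
  let Ψ : (ℝ →ᵇ ℝ) → ℝ → ℝ := fun χ x => growth l q lam x * χ (Real.log x)
  have hΨ : ∀ χ, Admissible l q lam (Ψ χ) ‖χ‖ := hyp.admissible lam
  let f : (ℝ →ᵇ ℝ) → ℝ → ℝ := fun χ t =>
    (1 + volterra l q lam (Ψ χ) (Real.exp t)) / growth l q lam (Real.exp t)
  have hmaps : MapsTo Real.exp univ (Ioi 0) := fun t _ => Real.exp_pos t
  have hfc : ∀ χ, Continuous (f χ) := fun χ => by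
    rw [← continuousOn_univ]
    exact (continuousOn_const.add (((hΨ χ).prim_volterra hyp).continuousOn.comp
      Real.continuous_exp.continuousOn hmaps)).div
      (hyp.continuousOn_growth.comp Real.continuous_exp.continuousOn hmaps)
      fun t _ => (growth_pos (Real.exp_pos t)).ne'
  have hfb : ∀ χ t, ‖f χ t‖ ≤ 1 + 1 / 2 * ‖χ‖ := fun χ t => by
    have hg := growth_pos (l := l) (q := q) (lam := lam) (Real.exp_pos t)
    rw [norm_div, Real.norm_of_nonneg hg.le, div_le_iff₀ hg]
    have h1 := (hΨ χ).abs_volterra_le hyp (Real.exp_pos t)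
    have h2 := one_le_growth (l := l) (q := q) (lam := lam) (Real.exp_pos t)
    calc ‖1 + volterra l q lam (Ψ χ) (Real.exp t)‖ ≤
          ‖(1 : ℝ)‖ + ‖volterra l q lam (Ψ χ) (Real.exp t)‖ := norm_add_le _ _
      _ ≤ 1 * growth l q lam (Real.exp t) + 1 / 2 * ‖χ‖ * growth l q lam (Real.exp t) := by
          rw [norm_one, one_mul]; exact add_le_add h2 h1
      _ = _ := by ring
  let Φ : (ℝ →ᵇ ℝ) → (ℝ →ᵇ ℝ) := fun χ =>
    BoundedContinuousFunction.ofNormedAddCommGroup (f χ) (hfc χ) _ (hfb χ)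
  have hΦ : ContractingWith (1 / 2) Φ := by
    refine ⟨by norm_num, LipschitzWith.of_dist_le_mul fun χ χ' => ?_⟩
    rw [BoundedContinuousFunction.dist_le (by positivity)]
    intro t
    have hg := growth_pos (l := l) (q := q) (lam := lam) (Real.exp_pos t)
    have hsub : Ψ (χ - χ') = fun x => Ψ χ x - Ψ χ' x := by
      funext x
      simp only [Ψ, BoundedContinuousFunction.sub_apply]; ring
    have h1 := (hΨ (χ - χ')).abs_volterra_le hyp (Real.exp_pos t)
    rw [hsub, (hΨ χ).volterra_sub (hΨ χ') hyp (Real.exp_pos t)] at h1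
    change dist (f χ t) (f χ' t) ≤ _
    rw [Real.dist_eq, dist_eq_norm, ← sub_div, abs_div, abs_of_pos hg, div_le_iff₀ hg]
    simpa using h1
  obtain ⟨χ, hχ⟩ := hΦ.exists_fixedPoint 0 (edist_ne_top _ _)
  refine ⟨Ψ χ, ‖χ‖, hΨ χ, fun x hx => ?_⟩
  have h1 : f χ (Real.log x) = χ (Real.log x) := DFunLike.congr_fun hχ.1 (Real.log x)
  have hg := growth_pos (l := l) (q := q) (lam := lam) hx
  simp only [f, Real.exp_log hx] at h1
  change growth l q lam x * χ (Real.log x) = _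
  rw [← h1]
  field_simp

theorem Hyp.exists_isRegularSolution (hyp : Hyp l q) (lam : ℝ) :
    ∃ φ : ℝ → ℝ, IsRegularSolution l q lam φ := by
  obtain ⟨ψ, M, hψ, hfix⟩ := hyp.exists_fixed lam
  have hl := hyp.le_l
  set P : ℝ → ℝ := fun x => ∫ t in (0 : ℝ)..x, t ^ (2 * l + 2) * (q t - lam) * ψ t with hPdef
  have hP : Prim P (fun t => t ^ (2 * l + 2) * (q t - lam) * ψ t) := hψ.prim_left hyp
  have hψP : Prim ψ (fun x => x ^ (-(2 * l + 2)) * P x) := by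
    have h1 := (Prim.of_hasDerivAt (fun x _ => hasDerivAt_const x (1 : ℝ))
      continuousOn_const).add (hψ.prim_volterra hyp)
    refine (h1.congr_left fun x hx => (hfix x hx).symm).congr_ae (Eventually.of_forall fun x => ?_)
    rw [zero_add]
  -- The derivative of `ψ` is continuous, so it is a derivative everywhere and not merely almost
  -- everywhere.
  have hd : ∀ x, 0 < x → HasDerivAt (fun x => x ^ (l + 1) * ψ x)
      ((l + 1) * (x ^ l * ψ x) + x ^ (-(l + 1)) * P x) x := by
    intro x hx
    have h1 : HasDerivAt ψ (x ^ (-(2 * l + 2)) * P x) x :=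
      hψP.hasDerivAt_of_continuousOn ((continuousOn_rpow_Ioi _).mul hP.continuousOn) hx
    refine ((Real.hasDerivAt_rpow_const (p := l + 1) (Or.inl hx.ne')).mul h1).congr_deriv ?_
    have e : x ^ (-(l + 1)) = x ^ (l + 1) * x ^ (-(2 * l + 2)) := by
      rw [← Real.rpow_add hx]; ring_nf
    rw [add_sub_cancel_right, e]
    ring
  have hd2 := ((Prim.of_hasDerivAt (fun x _ => hasDerivAt_const x (l + 1))
    continuousOn_const).mul ((prim_rpow l).mul hψP)).add ((prim_rpow (-(l + 1))).mul hP)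
  have hd3 := hd2.congr_left (G := deriv (fun x => x ^ (l + 1) * ψ x)) fun x hx => (hd x hx).deriv.symm
  refine ⟨fun x => x ^ (l + 1) * ψ x, ⟨⟨fun x hx =>
    (hd x hx).differentiableAt.differentiableWithinAt, hd3.1⟩, ?_⟩, ?_⟩
  · filter_upwards [hd3.deriv_ae, ae_restrict_mem measurableSet_Ioi] with x h1 hx
    have hx0 : (0 : ℝ) < x := hx
    have hp := Real.rpow_pos_of_pos hx0 l
    have e1 : x ^ (l + 1) = x ^ l * x := Real.rpow_add_one hx0.ne' l
    have e2 : x ^ l = x ^ (l - 1) * x := by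
      rw [← Real.rpow_add_one hx0.ne']; ring_nf
    have e3 : x ^ (-(l + 1) - 1) = x ^ l * x ^ (-(2 * l + 2)) := by
      rw [← Real.rpow_add hx0]; ring_nf
    have e4 : x ^ (-(l + 1)) * x ^ (2 * l + 2) = x ^ (l + 1) := by
      rw [← Real.rpow_add hx0]; ring_nf
    rw [tau, h1]
    simp only [smul_eq_mul, zero_mul, zero_add]
    have e5 : x ^ (-(l + 1)) * (x ^ (2 * l + 2) * (q x - lam) * ψ x) =
        x ^ l * x * (q x - lam) * ψ x := by
      rw [← e1, ← e4]; ring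
    have e6 : l * (l + 1) / x ^ 2 * (x ^ l * x * ψ x) = l * (l + 1) * x ^ (l - 1) * ψ x := by
      rw [e2]; field_simp
    have e7 : (l * (l + 1) / x ^ 2 + q x) * (x ^ l * x * ψ x) =
        l * (l + 1) * x ^ (l - 1) * ψ x + q x * (x ^ l * x * ψ x) := by
      rw [← e6]; ring
    rw [e5, e3, e1, e7]
    ring
  -- The Volterra term is at most `(1 + x) M` times an integral over `(0, x)`; the constant `2 M`
  -- below uses `x ≤ 1`.
  · have h1 : Tendsto (volterra l q lam ψ) (𝓝[>] 0) (𝓝 0) := by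
      have h2 := (Prim.tendsto_integral_zero one_pos
        (hyp.integral_exp_le (lam := lam) one_pos).1).const_mul (2 * M)
      rw [mul_zero] at h2
      refine squeeze_zero_norm' ?_ h2
      filter_upwards [Ioc_mem_nhdsGT one_pos] with x hx
      refine (hψ.abs_volterra_le_integral hyp hx.1).trans ?_
      have h3 : 0 ≤ ∫ t in (0 : ℝ)..x, growth l q lam t * (absWgt l t * |q t - lam|) := by
        rw [intervalIntegral.integral_of_le hx.1.le]
        refine setIntegral_nonneg measurableSet_Ioc fun t ht => ?_
        have := growth_pos (l := l) (q := q) (lam := lam) ht.1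
        have := absWgt_nonneg (l := l) ht.1
        positivity
      have := hψ.nonneg
      gcongr
      linarith [hx.2]
    have h2 := h1.const_add 1
    rw [add_zero] at h2
    refine h2.congr' ?_
    filter_upwards [self_mem_nhdsWithin] with x hx
    have hx0 : (0 : ℝ) < x := hx
    have hp := Real.rpow_pos_of_pos hx0 (l + 1)
    rw [← hfix x hx0]
    field_simp

end Bessel

/-! ### The first order factor and the Wronskian near the origin -/

namespace Bessel

variable {l lam : ℝ} {q φ : ℝ → ℝ}

/-- `u` belongs to the domain of `H`, on the level of functions. -/
structure InDom (l : ℝ) (q : ℝ → ℝ) (u : ℝ → ℂ) : Prop where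
  locAC2 : LocAC2 u
  bdry : BdryCond l u
  memLp : MemLp u 2 (volume.restrict (Ioi (0 : ℝ)))
  memLp_tau : MemLp (tau l q u) 2 (volume.restrict (Ioi (0 : ℝ)))

/-- The first order differential expression `- d/dx + φ' / φ`. -/
def factor (φ : ℝ → ℝ) (F : ℝ → ℂ) (x : ℝ) : ℂ :=
  -deriv F x + ((deriv φ x / φ x : ℝ) : ℂ) * F x

/-- The Wronskian of `φ` and `u`. -/
def wronskian (φ : ℝ → ℝ) (u : ℝ → ℂ) (x : ℝ) : ℂ := φ x * deriv u x - deriv φ x * u x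

/-- Lagrange's identity: the potentials cancel. -/
theorem IsSolution.prim_wronskian (hφ : IsSolution l q lam φ) {u : ℝ → ℂ} (hu : LocAC2 u) :
    Prim (wronskian φ u) (fun x => -(φ x * (tau l q u x - lam * u x))) := by
  have h1 := hφ.1.prim.ofReal.mul (hu.prim_deriv (l := l) (q := q))
  have h2 := hφ.prim_deriv.ofReal.mul hu.prim
  refine (h1.sub h2).congr_ae (Eventually.of_forall fun x => ?_)
  push_cast
  ring

/-- The factor is `-φ (d/dx) φ⁻¹`, so `F` is recovered from its image by one integration of `F / φ`.
-/
theorem prim_div (hφ : LocAC2 φ) (hpos : ∀ x, 0 < x → 0 < φ x) {F : ℝ → ℂ} (hF : LocAC F) :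
    Prim (fun x => F x / φ x) (fun x => -factor φ F x / φ x) := by
  have h0 : Prim (fun x => (φ x)⁻¹) (fun x => -deriv φ x / φ x ^ 2) := by
    refine Prim.of_hasDerivAt (fun x hx => (hφ.hasDerivAt hx).inv (hpos x hx).ne') ?_
    refine hφ.2.continuousOn.neg.div (hφ.prim.continuousOn.pow 2) fun x hx => ?_
    exact pow_ne_zero 2 (hpos x hx).ne'
  refine ((h0.ofReal.mul (Prim.of_locAC hF)).congr_left fun x _ => ?_).congr_ae
    (ae_restrict_of_forall_pos fun x hx => ?_)
  · push_cast
    rw [div_eq_mul_inv, mul_comm]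
  · have : (φ x : ℂ) ≠ 0 := by exact_mod_cast (hpos x hx).ne'
    simp only [factor]
    push_cast
    field_simp
    ring

theorem factor_eq (hpos : ∀ x, 0 < x → 0 < φ x) (u : ℝ → ℂ) {x : ℝ} (hx : 0 < x) :
    factor φ u x = -wronskian φ u x / φ x := by
  have : (φ x : ℂ) ≠ 0 := by exact_mod_cast (hpos x hx).ne'
  simp only [factor, wronskian]
  push_cast
  field_simp
  ring

theorem prim_div_solution (hφ : LocAC2 φ) (hpos : ∀ x, 0 < x → 0 < φ x) {u : ℝ → ℂ}
    (hu : LocAC2 u) : Prim (fun x => u x / φ x) (fun x => wronskian φ u x / (φ x) ^ 2) := by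
  refine (prim_div hφ hpos hu.prim.1).congr_ae (ae_restrict_of_forall_pos fun x hx => ?_)
  have : (φ x : ℂ) ≠ 0 := by exact_mod_cast (hpos x hx).ne'
  rw [factor_eq hpos u hx]
  field_simp

theorem MemLp.norm_sq_integrable {μ : Measure ℝ} {u : ℝ → ℂ} (hu : MemLp u 2 μ) :
    Integrable (fun x => ‖u x‖ ^ 2) μ :=
  (memLp_two_iff_integrable_sq_norm hu.1).1 hu

theorem MemLp.conj_mul_integrable {μ : Measure ℝ} {u v : ℝ → ℂ} (hu : MemLp u 2 μ)
    (hv : MemLp v 2 μ) : Integrable (fun x => starRingEnd ℂ (u x) * v x) μ := by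
  have := MemLp.integrable_mul (p := 2) (q := 2) hu.star hv
  exact this

/-- A square integrable function is not bounded below by a multiple of `x ^ (-1 / 2)` near `0`. -/
theorem not_le_mul_sqrt {u : ℝ → ℂ} (hu : MemLp u 2 (volume.restrict (Ioi (0 : ℝ)))) {b c : ℝ}
    (hb : 0 < b) (hc : 0 < c) : ¬ ∀ x ∈ Ioc 0 b, c ≤ ‖u x‖ * Real.sqrt x := by
  intro h
  have h1 : IntegrableOn (fun x => ‖u x‖ ^ 2) (Ioc 0 b) :=
    (MemLp.norm_sq_integrable hu).mono_measure (Measure.restrict_mono Ioc_subset_Ioi_self le_rfl)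
  have h2 : IntegrableOn (fun x : ℝ => x⁻¹) (Ioc 0 b) := by
    refine (h1.const_mul ((c ^ 2)⁻¹)).mono' measurable_inv.aestronglyMeasurable ?_
    refine (ae_restrict_mem measurableSet_Ioc).mono fun x hx => ?_
    have h3 := pow_le_pow_left₀ hc.le (h x hx) 2
    rw [mul_pow, Real.sq_sqrt hx.1.le] at h3
    rw [Real.norm_of_nonneg (inv_nonneg.2 hx.1.le), inv_mul_eq_div, le_div_iff₀ (by positivity),
      inv_mul_le_iff₀ hx.1]
    linarith
  have h3 : IntervalIntegrable (fun x : ℝ => x⁻¹) volume 0 b :=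
    (intervalIntegrable_iff_integrableOn_Ioc_of_le hb.le).2 h2
  rw [intervalIntegrable_inv_iff] at h3
  rcases h3 with h3 | h3
  · exact hb.ne h3
  · exact h3 left_mem_uIcc

/-- A Cauchy–Schwarz estimate with a cruder constant, from the pointwise bound `‖h‖ ≤ s⁻¹ + s ‖h‖ ^
2` with `s = √x`. -/
theorem integral_norm_le_sqrt {h : ℝ → ℂ} (hh : MemLp h 2 (volume.restrict (Ioi (0 : ℝ)))) {x : ℝ}
    (hx : 0 < x) : IntervalIntegrable h volume 0 x ∧
      ∫ t in (0 : ℝ)..x, ‖h t‖ ≤ (1 + ∫ t in Ioi (0 : ℝ), ‖h t‖ ^ 2) * Real.sqrt x := by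
  have hsub : Ioc 0 x ⊆ Ioi (0 : ℝ) := Ioc_subset_Ioi_self
  have hN := MemLp.norm_sq_integrable hh
  have hN1 : IntegrableOn (fun x => ‖h x‖ ^ 2) (Ioc 0 x) :=
    hN.mono_measure (Measure.restrict_mono hsub le_rfl)
  have hs : 0 < Real.sqrt x := Real.sqrt_pos.2 hx
  have hb : ∀ t, ‖h t‖ ≤ (Real.sqrt x)⁻¹ + Real.sqrt x * ‖h t‖ ^ 2 := by
    intro t
    have h1 : (Real.sqrt x)⁻¹ * Real.sqrt x = 1 := inv_mul_cancel₀ hs.ne'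
    have h2 : (Real.sqrt x)⁻¹ + Real.sqrt x * ‖h t‖ ^ 2 - 2 * ‖h t‖ =
        (Real.sqrt x)⁻¹ * (1 - Real.sqrt x * ‖h t‖) ^ 2 := by field_simp; ring
    have h3 : 0 ≤ (Real.sqrt x)⁻¹ * (1 - Real.sqrt x * ‖h t‖) ^ 2 := by positivity
    linarith [norm_nonneg (h t)]
  have hdom : IntegrableOn (fun t => (Real.sqrt x)⁻¹ + Real.sqrt x * ‖h t‖ ^ 2) (Ioc 0 x) :=
    (integrableOn_const (by simp)).add (hN1.const_mul _)
  have hi : IntegrableOn h (Ioc 0 x) := by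
    refine hdom.mono' (hh.1.mono_set hsub) (Eventually.of_forall hb)
  refine ⟨(intervalIntegrable_iff_integrableOn_Ioc_of_le hx.le).2 hi, ?_⟩
  rw [intervalIntegral.integral_of_le hx.le]
  calc ∫ t in Ioc 0 x, ‖h t‖ ≤ ∫ t in Ioc 0 x, ((Real.sqrt x)⁻¹ + Real.sqrt x * ‖h t‖ ^ 2) :=
        setIntegral_mono hi.norm hdom hb
    _ = x * (Real.sqrt x)⁻¹ + Real.sqrt x * ∫ t in Ioc 0 x, ‖h t‖ ^ 2 := by
        rw [integral_add (integrable_const _) (hN1.const_mul _), integral_const_mul]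
        simp [hx.le]
    _ ≤ x * (Real.sqrt x)⁻¹ + Real.sqrt x * ∫ t in Ioi (0 : ℝ), ‖h t‖ ^ 2 := by
        gcongr
        exact Eventually.of_forall fun t => by positivity
    _ = _ := by
        have : x * (Real.sqrt x)⁻¹ = Real.sqrt x := by
          rw [← div_eq_mul_inv, Real.div_sqrt]
        rw [this]; ring

namespace InDom

variable {u : ℝ → ℂ}

theorem memLp_sub (hu : InDom l q u) (lam : ℝ) :
    MemLp (fun x => tau l q u x - lam * u x) 2 (volume.restrict (Ioi (0 : ℝ))) :=
  hu.memLp_tau.sub (hu.memLp.const_mul (lam : ℂ))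

/-- The derivative of the Wronskian is `φ` times an L² function and `φ = O(x ^ (l + 1))`, so a limit
exists and is approached at rate `x ^ (l + 1) √x`. -/
theorem exists_wronskian_eq (hu : InDom l q u) (hyp : Hyp l q) (hφ : IsRegularSolution l q lam φ) :
    ∃ d C : ℝ, ∃ w : ℂ, 0 < d ∧ d ≤ 1 ∧ 0 ≤ C ∧
      (∀ x ∈ Ioc 0 d, 1 / 2 * x ^ (l + 1) ≤ φ x ∧ φ x ≤ 2 * x ^ (l + 1)) ∧
      Tendsto (wronskian φ u) (𝓝[>] 0) (𝓝 w) ∧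
      ∀ x ∈ Ioc 0 d, ‖wronskian φ u x - w‖ ≤ C * x ^ (l + 1) * Real.sqrt x := by
  obtain ⟨d, hd, hd1, hb⟩ := hφ.exists_bounds
  have hh := hu.memLp_sub lam
  set h : ℝ → ℂ := fun x => tau l q u x - lam * u x with hdef
  set N := ∫ t in Ioi (0 : ℝ), ‖h t‖ ^ 2
  have hl : 0 ≤ l + 1 := by linarith [hyp.le_l]
  have hP := hφ.1.prim_wronskian hu.locAC2
  have hkb : ∀ x ∈ Ioc 0 d, ∀ t ∈ Ioc 0 x, ‖-(φ t * h t)‖ ≤ 2 * x ^ (l + 1) * ‖h t‖ := by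
    intro x hx t ht
    have ht' : t ∈ Ioc 0 d := ⟨ht.1, ht.2.trans hx.2⟩
    have hφ0 : 0 ≤ φ t := le_trans (by have := Real.rpow_pos_of_pos ht.1 (l + 1); positivity)
      (hb t ht').1
    rw [norm_neg, norm_mul, Complex.norm_real, Real.norm_of_nonneg hφ0]
    gcongr
    exact (hb t ht').2.trans (by gcongr; exacts [ht.1.le, ht.2])
  have hki : IntervalIntegrable (fun x => -(φ x * h x)) volume 0 d := by
    refine ((integral_norm_le_sqrt hh hd).1.norm.const_mul (2 * d ^ (l + 1))).mono_fun' ?_ ?_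
    · rw [uIoc_of_le hd.le]
      refine AEStronglyMeasurable.mono_set Ioc_subset_Ioi_self (AEStronglyMeasurable.neg ?_)
      exact (hφ.1.1.prim.ofReal.continuousOn.aestronglyMeasurable measurableSet_Ioi).mul hh.1
    · rw [uIoc_of_le hd.le]
      exact (ae_restrict_mem measurableSet_Ioc).mono fun t ht => hkb d ⟨hd, le_rfl⟩ t ht
  obtain ⟨w, hw1, hw2⟩ := Prim.exists_eq_add_integral
    (fun a b ha hb => hP.complex_integral ha hb) hd hki
  have hN : 0 ≤ N := integral_nonneg fun t => by positivity
  refine ⟨d, 2 * (1 + N), w, hd, hd1, by positivity, hb, hw1, fun x hx => ?_⟩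
  obtain ⟨i1, i2⟩ := integral_norm_le_sqrt hh hx.1
  have hxp := Real.rpow_nonneg hx.1.le (l + 1)
  rw [hw2 x hx, add_sub_cancel_left]
  calc ‖∫ t in (0 : ℝ)..x, -(φ t * h t)‖ ≤ ∫ t in (0 : ℝ)..x, 2 * x ^ (l + 1) * ‖h t‖ :=
        intervalIntegral.norm_integral_le_of_norm_le hx.1.le
          (Eventually.of_forall fun t ht => hkb x hx t ht) (i1.norm.const_mul _)
    _ = 2 * x ^ (l + 1) * ∫ t in (0 : ℝ)..x, ‖h t‖ := by rw [intervalIntegral.integral_const_mul]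
    _ ≤ 2 * x ^ (l + 1) * ((1 + N) * Real.sqrt x) := by gcongr
    _ = _ := by ring

end InDom

end Bessel

/-! ### Vanishing of the Wronskian at the origin on the domain of the operator -/

namespace Bessel

variable {l lam : ℝ} {q φ : ℝ → ℝ} {u : ℝ → ℂ}

/-- Expresses the boundary condition through the Wronskian of `φ` and `u`, up to a term that the
decay of `quasiDeriv` makes negligible. -/
theorem bdry_expr_eq (hpos : ∀ x, 0 < x → 0 < φ x) (u : ℝ → ℂ) {x : ℝ} (hx : 0 < x) :
    (x ^ l : ℝ) • (((l + 1 : ℝ) : ℂ) * u x - (x : ℂ) * deriv u x) =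
      -(quasiDeriv l φ x * (u x / φ x)) - (x ^ (l + 1) / φ x : ℝ) * wronskian φ u x := by
  have hφ : (φ x : ℂ) ≠ 0 := by exact_mod_cast (hpos x hx).ne'
  have e1 : x ^ (l + 1) = x ^ l * x := Real.rpow_add_one hx.ne' l
  simp only [quasiDeriv, wronskian, e1, Complex.real_smul]
  push_cast
  field_simp
  ring

namespace InDom

/-- Integrating `(u / φ)' = W / φ ^ 2` with bounded `W` gives `u / φ = O(1 - recPow)`, so
`quasiDeriv * (u / φ)` tends to 0. The boundary expression then tends to minus the limit of `W`,
while the boundary condition says it tends to 0. -/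
theorem tendsto_wronskian_zero_of_lt (hu : InDom l q u) (hyp : Hyp l q)
    (hφ : IsRegularSolution l q lam φ) (hpos : ∀ x, 0 < x → 0 < φ x) (hl : l < 1 / 2) :
    Tendsto (wronskian φ u) (𝓝[>] 0) (𝓝 0) := by
  obtain ⟨d, C, w, hd, hd1, hC, hb, hw, hwb⟩ := hu.exists_wronskian_eq hyp hφ
  set M := ‖w‖ + C * d ^ (l + 1) * Real.sqrt d with hM
  have hl1 : 0 ≤ l + 1 := by linarith [hyp.le_l]
  have hdp := Real.rpow_nonneg hd.le (l + 1)
  have hM0 : 0 ≤ M := by positivity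
  have hWM : ∀ x ∈ Ioc 0 d, ‖wronskian φ u x‖ ≤ M := by
    intro x hx
    have h1 := hwb x hx
    have h2 : C * x ^ (l + 1) * Real.sqrt x ≤ C * d ^ (l + 1) * Real.sqrt d := by
      have := hx.1.le
      have := hx.2
      gcongr
    calc ‖wronskian φ u x‖ ≤ ‖w‖ + ‖wronskian φ u x - w‖ := norm_le_insert' _ _
      _ ≤ M := by rw [hM]; gcongr; exact h1.trans h2
  have hm := prim_div_solution hφ.1.1 hpos hu.locAC2
  have hmb : ∀ x ∈ Ioc 0 d, ‖u x / φ x‖ ≤ (‖u d / φ d‖ + 4 * M) * (1 - recPow l x) := by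
    intro x hx
    have hG := (Prim.of_hasDerivAt (fun x _ => hasDerivAt_const x (4 * M)) continuousOn_const).mul
      (prim_recPow l)
    have h1 := hm.norm_sub_le hG hx.1 hx.2 (ae_restrict_of_forall_pos fun t ht htm => by
      have ht' : t ∈ Ioc 0 d := ⟨ht, htm.2⟩
      have hp := Real.rpow_pos_of_pos ht (l + 1)
      have e : t ^ (-(2 * l + 2)) = ((t ^ (l + 1)) ^ 2)⁻¹ := by
        rw [Real.rpow_neg ht.le, sq, ← Real.rpow_add ht]; ring_nf
      have h2 : (1 / 2 * t ^ (l + 1)) ^ 2 ≤ φ t ^ 2 :=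
        pow_le_pow_left₀ (by positivity) (hb t ht').1 2
      have := hWM t ht'
      rw [norm_div, norm_pow, Complex.norm_real, Real.norm_of_nonneg (hpos t ht).le, zero_mul,
        zero_add, e]
      calc ‖wronskian φ u t‖ / φ t ^ 2 ≤ M / (1 / 2 * t ^ (l + 1)) ^ 2 := by gcongr
        _ = _ := by field_simp; norm_num)
    have h3 := recPow_nonpos hyp.le_l hd hd1
    have hD := one_le_one_sub_recPow hyp.le_l hx.1 (hx.2.trans hd1)
    calc ‖u x / φ x‖ ≤ ‖u d / φ d‖ + ‖u d / φ d - u x / φ x‖ := norm_le_insert _ _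
      _ ≤ ‖u d / φ d‖ * (1 - recPow l x) + 4 * M * (1 - recPow l x) := by
        refine add_le_add (le_mul_of_one_le_right (norm_nonneg _) hD) (h1.trans ?_)
        rw [← mul_sub]; gcongr; linarith
      _ = _ := by ring
  have hfirst : Tendsto (fun x => (quasiDeriv l φ x : ℂ) * (u x / φ x)) (𝓝[>] 0) (𝓝 0) := by
    refine squeeze_zero_norm' ?_ (((hφ.tendsto_quasiDeriv_mul hyp).norm.mul_const
      (‖u d / φ d‖ + 4 * M)).trans_eq (by simp))
    filter_upwards [Ioc_mem_nhdsGT hd] with x hx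
    rw [norm_mul, norm_mul, Complex.norm_real, mul_assoc]
    have hD := one_le_one_sub_recPow hyp.le_l hx.1 (hx.2.trans hd1)
    rw [Real.norm_of_nonneg (show 0 ≤ 1 - recPow l x by linarith), mul_comm (1 - recPow l x)]
    gcongr
    exact hmb x hx
  have hquot : Tendsto (fun x => ((x ^ (l + 1) / φ x : ℝ) : ℂ)) (𝓝[>] 0) (𝓝 1) := by
    have h1 := hφ.2.inv₀ one_ne_zero
    rw [inv_one] at h1
    have h2 : Tendsto (fun x => x ^ (l + 1) / φ x) (𝓝[>] 0) (𝓝 1) :=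
      h1.congr fun x => inv_div _ _
    exact_mod_cast (Complex.continuous_ofReal.tendsto 1).comp h2
  have hlim := hfirst.neg.sub (hquot.mul hw)
  have hlim0 := hu.bdry hl
  have heq := tendsto_nhds_unique (hlim0.congr' (by
    filter_upwards [self_mem_nhdsWithin] with x hx using bdry_expr_eq hpos u hx)) hlim
  have : w = 0 := by simpa using heq
  rwa [this] at hw

/-- A nonzero limit `w` would make `u` grow at least like `x ^ (-l)`, which is not square integrable
at the origin when `l ≥ 1/2`. -/
theorem tendsto_wronskian_zero_of_le (hu : InDom l q u) (hyp : Hyp l q)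
    (hφ : IsRegularSolution l q lam φ) (hpos : ∀ x, 0 < x → 0 < φ x) (hl : 1 / 2 ≤ l) :
    Tendsto (wronskian φ u) (𝓝[>] 0) (𝓝 0) := by
  obtain ⟨d, C, w, hd, hd1, hC, hb, hw, -⟩ := hu.exists_wronskian_eq hyp hφ
  by_cases hw0 : w = 0
  · rwa [hw0] at hw
  exfalso
  have hs : 0 < 2 * l + 1 := by linarith
  have hwn : 0 < ‖w‖ := norm_pos_iff.2 hw0
  have hev : ∀ᶠ x in 𝓝[>] (0 : ℝ), ‖w‖ ^ 2 / 2 < (starRingEnd ℂ w * wronskian φ u x).re := by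
    have h1 : Tendsto (fun x => (starRingEnd ℂ w * wronskian φ u x).re) (𝓝[>] 0)
        (𝓝 (starRingEnd ℂ w * w).re) :=
      (Complex.continuous_re.tendsto _).comp (hw.const_mul _)
    have h2 : (starRingEnd ℂ w * w).re = ‖w‖ ^ 2 := by
      rw [mul_comm, Complex.mul_conj, Complex.ofReal_re, Complex.normSq_eq_norm_sq]
    rw [h2] at h1
    exact h1.eventually (lt_mem_nhds (by nlinarith))
  obtain ⟨b', hb'0, hb'⟩ := mem_nhdsGT_iff_exists_Ioc_subset.1 (hev.and (Ioc_mem_nhdsGT hd))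
  have hb'0 : 0 < b' := hb'0
  -- Half of `‖w‖ ^ 2` survives near the limit, and `φ ^ 2 ≤ 4 x ^ (2 l + 2)` costs another factor
  -- 4.
  set c := ‖w‖ ^ 2 / 8 with hc
  set m : ℝ → ℂ := fun x => u x / φ x with hm
  have hmp := ((Prim.of_hasDerivAt (fun x _ => hasDerivAt_const x (starRingEnd ℂ w))
    continuousOn_const).mul (prim_div_solution hφ.1.1 hpos hu.locAC2)).re
  have hG := (Prim.of_hasDerivAt (fun x _ => hasDerivAt_const x c) continuousOn_const).mul
      (prim_recPow l)
  set K := (starRingEnd ℂ w * m b').re - c * recPow l b' with hK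
  have hmono : ∀ x ∈ Ioc 0 b', (starRingEnd ℂ w * m x).re ≤ K + c * recPow l x := by
    intro x hx
    have := hG.sub_le_sub hmp hx.1 hx.2 (ae_restrict_of_forall_pos fun t ht htm => by
      obtain ⟨h1, ht'⟩ := hb' (show t ∈ Ioc 0 b' from ⟨ht, htm.2⟩)
      have hp := Real.rpow_pos_of_pos ht (l + 1)
      have hφt := hpos t ht
      have e : t ^ (-(2 * l + 2)) = ((t ^ (l + 1)) ^ 2)⁻¹ := by
        rw [Real.rpow_neg ht.le, sq, ← Real.rpow_add ht]; ring_nf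
      have h2 : φ t ^ 2 ≤ (2 * t ^ (l + 1)) ^ 2 := pow_le_pow_left₀ hφt.le (hb t ht').2 2
      have e2 : (0 * m t + starRingEnd ℂ w * (wronskian φ u t / (φ t : ℂ) ^ 2)).re =
          (starRingEnd ℂ w * wronskian φ u t).re / φ t ^ 2 := by
        rw [zero_mul, zero_add, ← mul_div_assoc, ← Complex.ofReal_pow, Complex.div_ofReal_re]
      simp only [hm] at e2
      rw [e2, zero_mul, zero_add, e]
      calc c * ((t ^ (l + 1)) ^ 2)⁻¹ = (‖w‖ ^ 2 / 2) / (2 * t ^ (l + 1)) ^ 2 := by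
            rw [hc]; field_simp; norm_num
        _ ≤ (starRingEnd ℂ w * wronskian φ u t).re / φ t ^ 2 :=
            div_le_div₀ (le_trans (by positivity) h1.le) h1.le (by positivity) h2)
    simp only [hK]
    linarith
  set c' := c / (2 * l + 1) with hc'
  have hcpos : 0 < c := by positivity
  have hc'pos : 0 < c' := by positivity
  have hrec : ∀ x, c * recPow l x = -(c' * x ^ (-(2 * l + 1))) := by
    intro x
    rw [recPow, if_neg (by linarith), hc']; ring
  have hlow : ∀ x ∈ Ioc 0 b', c' * x ^ (-(2 * l + 1)) - |K| ≤ ‖w‖ * ‖m x‖ := by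
    intro x hx
    have h1 := hmono x hx
    have h2 := (Complex.abs_re_le_norm (starRingEnd ℂ w * m x))
    rw [norm_mul, RCLike.norm_conj] at h2
    rw [hrec] at h1
    linarith [neg_abs_le (starRingEnd ℂ w * m x).re, le_abs_self K]
  -- Below this `b` the integration constant `K` absorbs at most half of the singular term.
  set b := min b' (c' / (2 * (|K| + 1))) with hbdef
  have hb0 : 0 < b := by positivity
  refine not_le_mul_sqrt hu.memLp hb0 (c := c' / (4 * ‖w‖)) (by positivity) fun x hx => ?_
  have hxb' : x ∈ Ioc 0 b' := ⟨hx.1, hx.2.trans (min_le_left _ _)⟩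
  have hxd := (hb' hxb').2
  have hx1 : x ≤ 1 := hxd.2.trans hd1
  have hxK : x * (|K| + 1) ≤ c' / 2 := by
    have := hx.2.trans (min_le_right _ _)
    rw [le_div_iff₀ (by positivity)] at this
    linarith
  have hp := Real.rpow_pos_of_pos hx.1 (l + 1)
  have hsq := Real.sqrt_nonneg x
  have hφx := hpos x hx.1
  have hum : ‖u x‖ = φ x * ‖m x‖ := by
    simp only [hm]
    rw [norm_div, Complex.norm_real, Real.norm_of_nonneg hφx.le]
    field_simp
  have h1 : x ^ (l + 1) * Real.sqrt x ≤ x := by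
    rw [Real.sqrt_eq_rpow, ← Real.rpow_add hx.1]
    conv_rhs => rw [← Real.rpow_one x]
    exact Real.rpow_le_rpow_of_exponent_ge hx.1 hx1 (by linarith)
  have h2 : 1 ≤ x ^ (l + 1) * Real.sqrt x * x ^ (-(2 * l + 1)) := by
    rw [Real.sqrt_eq_rpow, ← Real.rpow_add hx.1, ← Real.rpow_add hx.1]
    exact Real.one_le_rpow_of_pos_of_le_one_of_nonpos hx.1 hx1 (by linarith)
  have h3 := mul_le_mul_of_nonneg_left (hlow x hxb') (show 0 ≤ x ^ (l + 1) * Real.sqrt x by positivity)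
  have h4 : x ^ (l + 1) * Real.sqrt x * |K| ≤ c' / 2 := by
    calc _ ≤ x * (|K| + 1) := by
          have := hx.1.le
          gcongr; linarith
      _ ≤ _ := hxK
  have h5 : c' / 2 ≤ x ^ (l + 1) * Real.sqrt x * (‖w‖ * ‖m x‖) := by
    nlinarith
  have h6 : x ^ (l + 1) ≤ 2 * φ x := by linarith [(hb x hxd).1]
  have h7 : x ^ (l + 1) * Real.sqrt x * (‖w‖ * ‖m x‖) ≤
      2 * φ x * Real.sqrt x * (‖w‖ * ‖m x‖) := by gcongr
  rw [hum, div_le_iff₀ (by positivity)]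
  nlinarith

theorem exists_factor_bound (hu : InDom l q u) (hyp : Hyp l q)
    (hφ : IsRegularSolution l q lam φ) (hpos : ∀ x, 0 < x → 0 < φ x) :
    ∃ d C : ℝ, 0 < d ∧ 0 ≤ C ∧ ∀ x ∈ Ioc 0 d, ‖factor φ u x‖ ≤ C * Real.sqrt x := by
  obtain ⟨d, C, w, hd, hd1, hC, hb, hw, hwb⟩ := hu.exists_wronskian_eq hyp hφ
  have hw0 : w = 0 := by
    rcases lt_or_ge l (1 / 2) with hl | hl
    · exact tendsto_nhds_unique hw (hu.tendsto_wronskian_zero_of_lt hyp hφ hpos hl)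
    · exact tendsto_nhds_unique hw (hu.tendsto_wronskian_zero_of_le hyp hφ hpos hl)
  refine ⟨d, 2 * C, hd, by positivity, fun x hx => ?_⟩
  have h1 := hwb x hx
  have hφx := hpos x hx.1
  rw [hw0, sub_zero] at h1
  rw [factor_eq hpos u hx.1, norm_div, norm_neg, Complex.norm_real, Real.norm_of_nonneg hφx.le,
    div_le_iff₀ hφx]
  refine h1.trans ?_
  have h2 : x ^ (l + 1) ≤ 2 * φ x := by linarith [(hb x hx).1]
  calc C * x ^ (l + 1) * Real.sqrt x ≤ C * (2 * φ x) * Real.sqrt x := by gcongr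
    _ = _ := by ring

end InDom

end Bessel

/-! ### Integration by parts for the first order factor -/

namespace Bessel

variable {l lam : ℝ} {q φ : ℝ → ℝ} {u F : ℝ → ℂ}

theorem aestronglyMeasurable_factor (hφ : LocAC2 φ) (hF : LocAC F) :
    AEStronglyMeasurable (factor φ F) (volume.restrict (Ioi (0 : ℝ))) := by
  refine (aestronglyMeasurable_deriv _ _).neg.add (AEStronglyMeasurable.mul ?_
    (hF.continuousOn.aestronglyMeasurable measurableSet_Ioi))
  refine Complex.continuous_ofReal.comp_aestronglyMeasurable (AEMeasurable.aestronglyMeasurable ?_)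
  exact (measurable_deriv φ).aemeasurable.div
    (hφ.prim.continuousOn.aestronglyMeasurable measurableSet_Ioi).aemeasurable

theorem IsSolution.prim_bdry (hφ : IsSolution l q lam φ) (hpos : ∀ x, 0 < x → 0 < φ x)
    (hF : LocAC F) (hu : LocAC2 u) :
    Prim (fun x => starRingEnd ℂ (F x / φ x) * wronskian φ u x)
      (fun x => starRingEnd ℂ (factor φ F x) * factor φ u x -
        starRingEnd ℂ (F x) * (tau l q u x - lam * u x)) := by
  refine ((prim_div hφ.1 hpos hF).conj.mul (hφ.prim_wronskian hu)).congr_ae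
    (ae_restrict_of_forall_pos fun x hx => ?_)
  have h0 : (φ x : ℂ) ≠ 0 := by exact_mod_cast (hpos x hx).ne'
  rw [factor_eq hpos u hx]
  simp only [map_div₀, map_neg, Complex.conj_ofReal]
  field_simp
  ring

theorem norm_bdry (hpos : ∀ x, 0 < x → 0 < φ x) (F u : ℝ → ℂ) {x : ℝ} (hx : 0 < x) :
    ‖starRingEnd ℂ (F x / φ x) * wronskian φ u x‖ = ‖F x‖ * ‖factor φ u x‖ := by
  rw [factor_eq hpos u hx, norm_mul, RCLike.norm_conj, norm_div, norm_div, norm_neg]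
  ring

namespace InDom

/-- With `h = Re (conj (u / φ) W)` one has `h' = ‖A u‖ ^ 2 - Re (conj u (τ u - lam u))`, whose last
term is integrable. Only an upper bound for `h` at arbitrarily large points is needed, and its
failure would put `φ` in L² at infinity. Near the origin `A u` is bounded. -/
theorem memLp_factor (hu : InDom l q u) (hyp : Hyp l q) (hφ : IsRegularSolution l q lam φ)
    (hpos : ∀ x, 0 < x → 0 < φ x)
    (hnot : ∀ X, 0 < X → ¬ MemLp φ 2 (volume.restrict (Ioi X))) :
    MemLp (factor φ u) 2 (volume.restrict (Ioi (0 : ℝ))) := by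
  have hmeas := aestronglyMeasurable_factor hφ.1.1 hu.locAC2.prim.1
  rw [memLp_two_iff_integrable_sq_norm hmeas]
  obtain ⟨d, C, hd, hC, hb⟩ := hu.exists_factor_bound hyp hφ hpos
  set k : ℝ → ℂ := fun x => tau l q u x - lam * u x with hk
  set h : ℝ → ℝ := fun x => (starRingEnd ℂ (u x / φ x) * wronskian φ u x).re with hh
  have hci : Integrable (fun x => starRingEnd ℂ (u x) * k x) (volume.restrict (Ioi (0 : ℝ))) :=
    MemLp.conj_mul_integrable hu.memLp (hu.memLp_sub lam)
  have hP : Prim h (fun x => ‖factor φ u x‖ ^ 2 - (starRingEnd ℂ (u x) * k x).re) := by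
    refine (hφ.1.prim_bdry hpos hu.locAC2.prim.1 hu.locAC2).re.congr_ae
      (Eventually.of_forall fun x => ?_)
    rw [Complex.sub_re, mul_comm (starRingEnd ℂ (factor φ u x)), Complex.mul_conj,
      Complex.ofReal_re, Complex.normSq_eq_norm_sq]
  have hri : ∀ a b : ℝ, 0 < a → 0 < b →
      IntervalIntegrable (fun x => (starRingEnd ℂ (u x) * k x).re) volume a b := by
    intro a b ha hb
    rw [intervalIntegrable_iff]
    exact IntegrableOn.mono_set hci.re fun x hx => (lt_min ha hb).trans hx.1
  have hAi : ∀ a b : ℝ, 0 < a → 0 < b →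
      IntervalIntegrable (fun x => ‖factor φ u x‖ ^ 2) volume a b := by
    intro a b ha hb
    have := (hP.real_integral ha hb).1.add (hri a b ha hb)
    simpa using this
  have hnear : IntegrableOn (fun x => ‖factor φ u x‖ ^ 2) (Ioc 0 d) := by
    refine IntegrableOn.of_bound (by simp) ((hmeas.norm.pow 2).mono_set Ioc_subset_Ioi_self)
      ((C * Real.sqrt d) ^ 2) ?_
    refine (ae_restrict_mem measurableSet_Ioc).mono fun x hx => ?_
    rw [norm_pow, norm_norm]
    exact pow_le_pow_left₀ (norm_nonneg _) ((hb x hx).trans (by gcongr; exact hx.2)) 2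
  have hfar : IntegrableOn (fun x => ‖factor φ u x‖ ^ 2) (Ioi d) := by
    -- Here `‖u / φ‖ ^ 2` has derivative `2 h / φ ^ 2 > 0` beyond `X`. So `‖u / φ‖` stays above a
    -- positive constant and `φ` is dominated by a multiple of `u`.
    by_cases hcase : ∃ X, ∀ x, X ≤ x → 1 ≤ h x
    · exfalso
      obtain ⟨X', hX'⟩ := hcase
      set X := max X' d with hXdef
      have hX : ∀ x, X ≤ x → 1 ≤ h x := fun x hx => hX' x ((le_max_left _ _).trans hx)
      have hX0 : 0 < X := hd.trans_le (le_max_right _ _)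
      have hm := prim_div_solution hφ.1.1 hpos hu.locAC2
      have hsq := (hm.conj.mul hm).re
      have hmono : ∀ y, X ≤ y → ‖u X / φ X‖ ^ 2 ≤ ‖u y / φ y‖ ^ 2 := by
        intro y hy
        have h0 := Prim.sub_le_sub (F := fun _ => (0 : ℝ)) (k := fun _ => 0)
          (Prim.of_hasDerivAt (fun x _ => hasDerivAt_const x _) continuousOn_const) hsq hX0 hy
          (ae_restrict_of_forall_pos fun t ht htm => by
            have h1 := hX t htm.1.le
            have e : (starRingEnd ℂ (wronskian φ u t / (φ t : ℂ) ^ 2) * (u t / φ t) +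
                starRingEnd ℂ (u t / φ t) * (wronskian φ u t / (φ t : ℂ) ^ 2)).re =
                2 * (h t / φ t ^ 2) := by
              have e1 : starRingEnd ℂ (wronskian φ u t / (φ t : ℂ) ^ 2) * (u t / φ t) =
                  starRingEnd ℂ (starRingEnd ℂ (u t / φ t) * (wronskian φ u t / (φ t : ℂ) ^ 2)) := by
                rw [map_mul, Complex.conj_conj, mul_comm]
              rw [e1, Complex.add_re, Complex.conj_re, ← mul_div_assoc, ← Complex.ofReal_pow,
                Complex.div_ofReal_re]
              ring
            rw [e]
            positivity)
        have e : ∀ z : ℂ, (starRingEnd ℂ z * z).re = ‖z‖ ^ 2 := fun z => by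
          rw [mul_comm, Complex.mul_conj, Complex.ofReal_re, Complex.normSq_eq_norm_sq]
        rw [e, e] at h0
        linarith
      have hc : 0 < ‖u X / φ X‖ := by
        rw [norm_pos_iff]
        intro h0
        have := hX X le_rfl
        simp only [hh, h0, map_zero, zero_mul, Complex.zero_re] at this
        linarith
      refine hnot X hX0 ?_
      have hφm : AEStronglyMeasurable φ (volume.restrict (Ioi X)) :=
        (hφ.1.1.prim.continuousOn.mono (Ioi_subset_Ioi hX0.le)).aestronglyMeasurable
          measurableSet_Ioi
      have huX : MemLp u 2 (volume.restrict (Ioi X)) :=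
        hu.memLp.mono_measure (Measure.restrict_mono (Ioi_subset_Ioi hX0.le) le_rfl)
      refine MemLp.of_le_mul huX hφm (c := ‖u X / φ X‖⁻¹)
        ((ae_restrict_mem measurableSet_Ioi).mono fun y hy => ?_)
      have hy' : X < y := hy
      have hφy := hpos y (hX0.trans hy')
      have h1 := le_of_sq_le_sq (hmono y hy'.le) (norm_nonneg _)
      rw [norm_div (u y), Complex.norm_real, Real.norm_of_nonneg hφy.le, le_div_iff₀ hφy] at h1
      rwa [Real.norm_of_nonneg hφy.le, le_inv_mul_iff₀ hc]
    · push Not at hcase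
      refine integrableOn_Ioi_of_intervalIntegral_norm_bounded
        (1 - h d + ∫ x in Ioi (0 : ℝ), ‖starRingEnd ℂ (u x) * k x‖) d
        (b := id) (l := atTop) (fun b => ?_) tendsto_id ?_
      · rcases le_total b d with hbd | hbd
        · simp [Ioc_eq_empty (not_lt.2 hbd)]
        · exact (hAi d b hd (hd.trans_le hbd)).1
      · filter_upwards [eventually_ge_atTop d] with b hbd
        obtain ⟨x, hx, hx1⟩ := hcase b
        have hdx : d ≤ x := hbd.trans hx
        have hx0 : 0 < x := hd.trans_le hdx
        have h1 := (hP.real_integral hd hx0).2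
        rw [intervalIntegral.integral_sub (hAi d x hd hx0) (hri d x hd hx0)] at h1
        have h2 : ∫ t in d..x, (starRingEnd ℂ (u t) * k t).re ≤
            ∫ x in Ioi (0 : ℝ), ‖starRingEnd ℂ (u x) * k x‖ := by
          rw [intervalIntegral.integral_of_le hdx]
          calc ∫ t in Ioc d x, (starRingEnd ℂ (u t) * k t).re
              ≤ ∫ t in Ioc d x, ‖starRingEnd ℂ (u t) * k t‖ :=
                setIntegral_mono (hri d x hd hx0).1
                  (IntegrableOn.mono_set hci.norm fun t ht => hd.trans ht.1)
                  fun t => Complex.re_le_norm _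
            _ ≤ _ := setIntegral_mono_set hci.norm (Eventually.of_forall fun t => norm_nonneg _)
                (LE.le.eventuallyLE fun t ht => hd.trans ht.1)
        have h3 : ∫ t in d..id b, ‖(‖factor φ u t‖ ^ 2)‖ ≤ ∫ t in d..x, ‖factor φ u t‖ ^ 2 := by
          simp only [norm_pow, norm_norm, id]
          rw [intervalIntegral.integral_of_le hbd, intervalIntegral.integral_of_le hdx]
          exact setIntegral_mono_set (hAi d x hd hx0).1
            (Eventually.of_forall fun t => by positivity)
            (LE.le.eventuallyLE (Ioc_subset_Ioc_right hx))
        linarith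
  have := hnear.union hfar
  rwa [Ioc_union_Ioi_eq_Ioi hd.le] at this

/-- The boundary term has modulus `‖F‖ ‖A u‖` and, its derivative being integrable, has limits at
both ends. Both limits vanish by integrability alone, with no pointwise decay assumed of `F`. -/
theorem integral_factor_eq (hu : InDom l q u) (hyp : Hyp l q) (hφ : IsRegularSolution l q lam φ)
    (hpos : ∀ x, 0 < x → 0 < φ x)
    (hAu : MemLp (factor φ u) 2 (volume.restrict (Ioi (0 : ℝ))))
    (hF : LocAC F) (hF2 : MemLp F 2 (volume.restrict (Ioi (0 : ℝ))))
    (hAF : MemLp (factor φ F) 2 (volume.restrict (Ioi (0 : ℝ)))) :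
    ∫ x in Ioi (0 : ℝ), starRingEnd ℂ (factor φ F x) * factor φ u x =
      ∫ x in Ioi (0 : ℝ), starRingEnd ℂ (F x) * (tau l q u x - lam * u x) := by
  obtain ⟨d, C, hd, hC, hb⟩ := hu.exists_factor_bound hyp hφ hpos
  set J : ℝ → ℂ := fun x => starRingEnd ℂ (F x / φ x) * wronskian φ u x with hJ
  set j : ℝ → ℂ := fun x => starRingEnd ℂ (factor φ F x) * factor φ u x -
        starRingEnd ℂ (F x) * (tau l q u x - lam * u x) with hj
  have hP : Prim J j := hφ.1.prim_bdry hpos hF hu.locAC2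
  have i1 := MemLp.conj_mul_integrable hAF hAu
  have i2 := MemLp.conj_mul_integrable hF2 (hu.memLp_sub lam)
  have hji : IntegrableOn j (Ioi 0) := i1.sub i2
  have hji1 : IntervalIntegrable j volume 0 d :=
    (intervalIntegrable_iff_integrableOn_Ioc_of_le hd.le).2 (hji.mono_set Ioc_subset_Ioi_self)
  obtain ⟨w, hw1, hw2⟩ := Prim.exists_eq_add_integral
    (fun a b ha hb => hP.complex_integral ha hb) hd hji1
  -- Since `‖A u‖ ≤ C √x`, a nonzero limit would bound `‖F‖ √x` below near 0.
  have hw0 : w = 0 := by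
    by_contra hne
    have hwn : 0 < ‖w‖ := norm_pos_iff.2 hne
    have hev := hw1.norm.eventually (lt_mem_nhds (half_lt_self hwn))
    obtain ⟨b, hb0, hb'⟩ := mem_nhdsGT_iff_exists_Ioc_subset.1 (hev.and (Ioc_mem_nhdsGT hd))
    refine not_le_mul_sqrt hF2 hb0 (c := ‖w‖ / 2 / (C + 1)) (by positivity) fun x hx => ?_
    obtain ⟨h1, h2⟩ := hb' hx
    have h3 : ‖w‖ / 2 < ‖J x‖ := h1
    rw [hJ, norm_bdry hpos F u hx.1] at h3
    rw [div_le_iff₀ (by positivity)]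
    have := hb x h2
    calc ‖w‖ / 2 ≤ ‖F x‖ * ‖factor φ u x‖ := h3.le
      _ ≤ ‖F x‖ * (C * Real.sqrt x) := by gcongr
      _ ≤ ‖F x‖ * ((C + 1) * Real.sqrt x) := by gcongr; linarith
      _ = _ := by ring
  have hJeq : ∀ b, d ≤ b → ∫ t in (0 : ℝ)..b, j t = J b := by
    intro b hdb
    obtain ⟨h1, h2⟩ := hP.complex_integral hd (hd.trans_le hdb)
    rw [← intervalIntegral.integral_add_adjacent_intervals hji1 h1, h2, hw2 d ⟨hd, le_rfl⟩, hw0]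
    ring
  have hlim : Tendsto J atTop (𝓝 (∫ x in Ioi (0 : ℝ), j x)) := by
    refine (intervalIntegral_tendsto_integral_Ioi 0 hji tendsto_id).congr' ?_
    filter_upwards [eventually_ge_atTop d] with b hdb using hJeq b hdb
  -- This integral is the limit of `J` at infinity, and `‖J‖ = ‖F‖ ‖A u‖` is integrable.
  have hz : ∫ x in Ioi (0 : ℝ), j x = 0 := by
    by_contra hne
    have hwn : 0 < ‖∫ x in Ioi (0 : ℝ), j x‖ := norm_pos_iff.2 hne
    set c := ‖∫ x in Ioi (0 : ℝ), j x‖ with hc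
    obtain ⟨X', hX'⟩ := eventually_atTop.1 (hlim.norm.eventually (lt_mem_nhds (half_lt_self hwn)))
    set X := max X' 1
    have hX0 : (0 : ℝ) < X := lt_max_of_lt_right one_pos
    have hFA : Integrable (fun x => ‖F x‖ * ‖factor φ u x‖) (volume.restrict (Ioi (0 : ℝ))) :=
      MemLp.integrable_mul (p := 2) (q := 2) hF2.norm hAu.norm
    have hcon : IntegrableOn (fun _ : ℝ => c / 2) (Ioi X) := by
      refine Integrable.mono' (hFA.mono_measure (Measure.restrict_mono (Ioi_subset_Ioi hX0.le) le_rfl))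
        aestronglyMeasurable_const ((ae_restrict_mem measurableSet_Ioi).mono fun x hx => ?_)
      have hx' : X < x := hx
      rw [← norm_bdry hpos F u (hX0.trans hx'), Real.norm_of_nonneg (by positivity)]
      exact (hX' x ((le_max_left _ _).trans hx'.le)).le
    rw [integrableOn_const_iff] at hcon
    rcases hcon with h | h
    · have := enorm_eq_zero.1 h
      linarith
    · simp at h
  rw [hj, integral_sub i1 i2, sub_eq_zero] at hz
  exact hz

end InDom

end Bessel

/-! ### Positivity and growth of the regular solution below the form bound -/

namespace Bessel

variable {l lam : ℝ} {q φ g : ℝ → ℝ}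

theorem memLp_of_bounded_support {f : ℝ → ℂ}
    (hf : AEStronglyMeasurable f (volume.restrict (Ioi (0 : ℝ)))) {B X : ℝ}
    (hB : ∀ x ∈ Ioc 0 X, ‖f x‖ ≤ B) (hX : ∀ x, X < x → f x = 0) :
    MemLp f 2 (volume.restrict (Ioi (0 : ℝ))) := by
  have h1 : MemLp ((Ioc 0 X).indicator fun _ => B) 2 (volume.restrict (Ioi (0 : ℝ))) := by
    refine memLp_indicator_const 2 measurableSet_Ioc B (Or.inr (ne_of_lt ?_))
    exact (Measure.restrict_apply_le _ _).trans_lt (by simp)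
  refine h1.of_le hf (ae_restrict_of_forall_pos fun x hx => ?_)
  by_cases hxX : x ≤ X
  · rw [indicator_of_mem (show x ∈ Ioc 0 X from ⟨hx, hxX⟩)]
    exact (hB x ⟨hx, hxX⟩).trans (le_abs_self B)
  · rw [hX x (not_le.1 hxX), norm_zero]
    exact norm_nonneg _

namespace IsRegularSolution

theorem exists_bound (hφ : IsRegularSolution l q lam φ) (hl : -(1 / 2) ≤ l) (X : ℝ) :
    ∃ B, ∀ x ∈ Ioc 0 X, ‖φ x‖ ≤ B := by
  obtain ⟨d, hd, hd1, hb⟩ := hφ.exists_bounds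
  obtain ⟨C, hC⟩ := isCompact_Icc.exists_bound_of_continuousOn (s := Icc d X) (f := φ)
    (hφ.1.1.prim.continuousOn.mono fun x hx => hd.trans_le hx.1)
  refine ⟨max 2 C, fun x hx => ?_⟩
  rcases le_total x d with hxd | hxd
  · have h1 := hb x ⟨hx.1, hxd⟩
    have hp := Real.rpow_pos_of_pos hx.1 (l + 1)
    have h2 : x ^ (l + 1) ≤ 1 := Real.rpow_le_one hx.1.le (hxd.trans hd1) (by linarith)
    rw [Real.norm_of_nonneg (le_trans (by positivity) h1.1)]
    exact le_trans (by linarith) (le_max_left _ _)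
  · exact (hC x ⟨hxd, hx.2⟩).trans (le_max_right _ _)

theorem hasDerivAt_mul (hφ : IsRegularSolution l q lam φ) (hg : ContDiff ℝ 2 g) {x : ℝ}
    (hx : 0 < x) : HasDerivAt (fun x => ((φ x * g x : ℝ) : ℂ))
      ((deriv φ x * g x + φ x * deriv g x : ℝ) : ℂ) x :=
  ((hφ.1.1.hasDerivAt hx).mul (hg.differentiable (by norm_num) x).hasDerivAt).ofReal_comp

theorem prim_deriv_mul (hφ : IsRegularSolution l q lam φ) (hg : ContDiff ℝ 2 g) :
    Prim (deriv (fun x => ((φ x * g x : ℝ) : ℂ))) (fun x =>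
      ((((l * (l + 1) / x ^ 2 + q x - lam) * φ x) * g x + 2 * deriv φ x * deriv g x +
        φ x * deriv (deriv g) x : ℝ) : ℂ)) := by
  have hg1 : ContDiff ℝ 1 (deriv g) := by
    have : ContDiff ℝ (1 + 1) g := by convert hg using 1; norm_num
    exact (contDiff_succ_iff_deriv.1 this).2.2
  have p1 : Prim g (deriv g) := Prim.of_hasDerivAt
    (fun x _ => (hg.differentiable (by norm_num) x).hasDerivAt) hg1.continuous.continuousOn
  have p2 : Prim (deriv g) (deriv (deriv g)) := Prim.of_hasDerivAt
    (fun x _ => (hg1.differentiable (by norm_num) x).hasDerivAt)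
    (hg1.continuous_deriv le_rfl).continuousOn
  have h := ((hφ.1.prim_deriv.mul p1).add (hφ.1.1.prim.mul p2)).ofReal
  refine (h.congr_left fun x hx => ?_).congr_ae (Eventually.of_forall fun x => ?_)
  · exact (hφ.hasDerivAt_mul hg hx).deriv.symm
  · push_cast; ring

theorem locAC2_mul (hφ : IsRegularSolution l q lam φ) (hg : ContDiff ℝ 2 g) :
    LocAC2 (fun x => ((φ x * g x : ℝ) : ℂ)) :=
  ⟨fun _ hx => (hφ.hasDerivAt_mul hg hx).differentiableAt.differentiableWithinAt,
    (hφ.prim_deriv_mul hg).1⟩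

theorem tau_mul (hφ : IsRegularSolution l q lam φ) (hg : ContDiff ℝ 2 g) :
    ∀ᵐ x ∂(volume.restrict (Ioi (0 : ℝ))), tau l q (fun x => ((φ x * g x : ℝ) : ℂ)) x =
      lam * ((φ x * g x : ℝ) : ℂ) +
        ((-(2 * deriv φ x * deriv g x + φ x * deriv (deriv g) x) : ℝ) : ℂ) := by
  filter_upwards [(hφ.prim_deriv_mul hg).deriv_ae] with x hx
  rw [tau, hx, Complex.real_smul]
  push_cast
  ring

/-- Where `g = 1` the boundary expression of `φ g` is exactly `-quasiDeriv l φ`. -/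
theorem bdryCond_mul (hφ : IsRegularSolution l q lam φ) (hyp : Hyp l q) (hg : ContDiff ℝ 2 g)
    {δ : ℝ} (hδ : 0 < δ) (hg1 : ∀ x < δ, g x = 1) :
    BdryCond l (fun x => ((φ x * g x : ℝ) : ℂ)) := by
  intro _
  have h1 : Tendsto (fun x => ((-quasiDeriv l φ x : ℝ) : ℂ)) (𝓝[>] 0) (𝓝 0) := by
    have := (hφ.tendsto_quasiDeriv hyp).neg
    rw [neg_zero] at this
    exact_mod_cast (Complex.continuous_ofReal.tendsto 0).comp this
  refine h1.congr' ?_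
  filter_upwards [Ioo_mem_nhdsGT hδ] with x hx
  have e1 : deriv g x = 0 := by
    have : g =ᶠ[𝓝 x] fun _ => 1 := by
      filter_upwards [Iio_mem_nhds hx.2] with y hy using hg1 y hy
    rw [this.deriv_eq]; simp
  have e2 : x ^ (l + 1) = x ^ l * x := Real.rpow_add_one hx.1.ne' l
  rw [(hφ.hasDerivAt_mul hg hx.1).deriv, e1, hg1 x hx.2, Complex.real_smul, quasiDeriv, e2]
  push_cast
  ring

/-- The quadratic form of `H` is bounded below by `c` on the level of functions. -/
def _root_.Bessel.FormBound (l : ℝ) (q : ℝ → ℝ) (c : ℝ) : Prop :=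
  ∀ u : ℝ → ℂ, InDom l q u → c * ∫ x in Ioi (0 : ℝ), ‖u x‖ ^ 2 ≤
    (∫ x in Ioi (0 : ℝ), starRingEnd ℂ (u x) * tau l q u x).re

theorem integrableOn_sq (hφ : IsRegularSolution l q lam φ) (hl : -(1 / 2) ≤ l) (X : ℝ) :
    IntegrableOn (fun x => φ x ^ 2) (Ioc 0 X) := by
  obtain ⟨B, hB⟩ := hφ.exists_bound hl X
  refine IntegrableOn.of_bound (by simp) (((hφ.1.1.prim.continuousOn.pow 2).mono
    Ioc_subset_Ioi_self).aestronglyMeasurable measurableSet_Ioc) (B ^ 2) ?_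
  refine (ae_restrict_mem measurableSet_Ioc).mono fun x hx => ?_
  rw [norm_pow]
  exact pow_le_pow_left₀ (norm_nonneg _) (hB x hx) 2

theorem setIntegral_sq_pos (hφ : IsRegularSolution l q lam φ) (hl : -(1 / 2) ≤ l) {X : ℝ}
    (hX : 0 < X) : 0 < ∫ x in Ioc 0 X, φ x ^ 2 := by
  obtain ⟨d, hd, hd1, hb⟩ := hφ.exists_bounds
  rw [setIntegral_pos_iff_support_of_nonneg_ae (Eventually.of_forall fun x => sq_nonneg _)
    (hφ.integrableOn_sq hl X)]
  have hm : 0 < min d X := lt_min hd hX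
  refine lt_of_lt_of_le ?_ (measure_mono (show Ioc 0 (min d X) ⊆ _ from fun x hx => ⟨?_, ?_⟩))
  · simpa using ⟨hd, hX⟩
  · have h1 := (hb x ⟨hx.1, hx.2.trans (min_le_left _ _)⟩).1
    have hp := Real.rpow_pos_of_pos hx.1 (l + 1)
    have : 0 < φ x := lt_of_lt_of_le (by positivity) h1
    exact (pow_pos this 2).ne'
  · exact ⟨hx.1, hx.2.trans (min_le_right _ _)⟩

/-- Otherwise `φ` would be an eigenfunction with eigenvalue `lam`, below the form bound. -/
theorem not_memLp (hφ : IsRegularSolution l q lam φ) (hyp : Hyp l q) {η : ℝ} (hη : 0 < η)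
    (hF : FormBound l q (lam + η)) {X : ℝ} (hX : 0 < X) :
    ¬ MemLp φ 2 (volume.restrict (Ioi X)) := by
  intro hmem
  -- The factor 1 is the trivial cutoff, so that the lemmas on `φ g` apply verbatim.
  have hm : AEStronglyMeasurable (fun x => ((φ x * 1 : ℝ) : ℂ)) (volume.restrict (Ioi (0 : ℝ))) := by
    simp only [mul_one]
    exact hφ.1.1.prim.ofReal.continuousOn.aestronglyMeasurable measurableSet_Ioi
  have h1 : IntegrableOn (fun x => φ x ^ 2) (Ioi 0) := by
    have := (hφ.integrableOn_sq hyp.le_l X).union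
      ((memLp_two_iff_integrable_sq hmem.1).1 hmem)
    rwa [Ioc_union_Ioi_eq_Ioi hX.le] at this
  have hn : ∀ x, ‖((φ x * 1 : ℝ) : ℂ)‖ ^ 2 = φ x ^ 2 := fun x => by
    rw [Complex.norm_real, mul_one, Real.norm_eq_abs, sq_abs]
  have hu2 : MemLp (fun x => ((φ x * 1 : ℝ) : ℂ)) 2 (volume.restrict (Ioi (0 : ℝ))) := by
    rw [memLp_two_iff_integrable_sq_norm hm]
    simp only [hn]
    exact h1
  have hg : ContDiff ℝ 2 (fun _ : ℝ => (1 : ℝ)) := contDiff_const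
  have htau : ∀ᵐ x ∂(volume.restrict (Ioi (0 : ℝ))), lam * ((φ x * 1 : ℝ) : ℂ) =
      tau l q (fun x => ((φ x * 1 : ℝ) : ℂ)) x := by
    filter_upwards [hφ.tau_mul hg] with x hx
    rw [hx]; simp
  have hdom : InDom l q (fun x => ((φ x * 1 : ℝ) : ℂ)) :=
    ⟨hφ.locAC2_mul hg, hφ.bdryCond_mul hyp hg one_pos fun _ _ => rfl, hu2,
      (memLp_congr_ae htau).1 (hu2.const_mul _)⟩
  have h2 := hF _ hdom
  have h3 : ∫ x in Ioi (0 : ℝ), starRingEnd ℂ ((φ x * 1 : ℝ) : ℂ) *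
      tau l q (fun x => ((φ x * 1 : ℝ) : ℂ)) x = ((lam * ∫ x in Ioi (0 : ℝ), φ x ^ 2 : ℝ) : ℂ) := by
    rw [← integral_const_mul, ← integral_complex_ofReal]
    refine integral_congr_ae ?_
    filter_upwards [htau] with x hx
    rw [← hx, Complex.conj_ofReal]
    push_cast
    ring
  rw [h3, Complex.ofReal_re] at h2
  simp only [hn] at h2
  have h4 := hφ.setIntegral_sq_pos hyp.le_l hX
  have h5 : ∫ x in Ioc 0 X, φ x ^ 2 ≤ ∫ x in Ioi (0 : ℝ), φ x ^ 2 :=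
    setIntegral_mono_set h1 (Eventually.of_forall fun x => sq_nonneg _)
      (LE.le.eventuallyLE Ioc_subset_Ioi_self)
  nlinarith

/-- The difference of the integrands is the derivative of `φ ^ 2 g g'`, which vanishes at both ends.
-/
theorem integral_remainder (hφ : IsRegularSolution l q lam φ) (hg : ContDiff ℝ 2 g) {a b : ℝ}
    (ha : 0 < a) (hab : a ≤ b) (hga : deriv g a = 0) (hgb : deriv g b = 0) :
    ∫ x in a..b, φ x * g x * -(2 * deriv φ x * deriv g x + φ x * deriv (deriv g) x) =
      ∫ x in a..b, (φ x * deriv g x) ^ 2 := by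
  have hg1 : ContDiff ℝ 1 (deriv g) := by
    have : ContDiff ℝ (1 + 1) g := by convert hg using 1; norm_num
    exact (contDiff_succ_iff_deriv.1 this).2.2
  have p1 : Prim g (deriv g) := Prim.of_hasDerivAt
    (fun x _ => (hg.differentiable (by norm_num) x).hasDerivAt) hg1.continuous.continuousOn
  have p2 : Prim (deriv g) (deriv (deriv g)) := Prim.of_hasDerivAt
    (fun x _ => (hg1.differentiable (by norm_num) x).hasDerivAt)
    (hg1.continuous_deriv le_rfl).continuousOn
  obtain ⟨i1, h1⟩ := ((hφ.1.1.prim.mul hφ.1.1.prim).mul (p1.mul p2)).real_integral ha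
    (ha.trans_le hab)
  have hsub : uIcc a b ⊆ Ioi 0 := by
    rw [uIcc_of_le hab]; exact fun x hx => ha.trans_le hx.1
  have i2 : IntervalIntegrable (fun x => (φ x * deriv g x) ^ 2) volume a b :=
    (((hφ.1.1.prim.continuousOn.mul p2.continuousOn).pow 2).mono hsub).intervalIntegrable
  rw [hga, hgb] at h1
  simp only [mul_zero, sub_zero] at h1
  rw [← sub_zero (∫ x in a..b, (φ x * deriv g x) ^ 2), ← h1, ← intervalIntegral.integral_sub i2 i1]
  refine intervalIntegral.integral_congr fun x _ => ?_
  ring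

/-- The form of `φ g` is `lam ‖φ g‖ ^ 2 + ∫ (φ g') ^ 2`: cutting off a solution costs only the
second term. -/
theorem form_cutoff_le (hφ : IsRegularSolution l q lam φ) (hyp : Hyp l q) {c : ℝ}
    (hF : FormBound l q c) (hg : ContDiff ℝ 2 g) {a b : ℝ} (ha : 0 < a) (hab : a ≤ b)
    (h1 : ∀ x ≤ a, g x = 1) (h0 : ∀ x, b ≤ x → g x = 0) (hga : deriv g a = 0)
    (hgb : deriv g b = 0) :
    (c - lam) * ∫ x in Ioi (0 : ℝ), (φ x * g x) ^ 2 ≤ ∫ x in a..b, (φ x * deriv g x) ^ 2 := by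
  have hg1 : ContDiff ℝ 1 (deriv g) := by
    have : ContDiff ℝ (1 + 1) g := by convert hg using 1; norm_num
    exact (contDiff_succ_iff_deriv.1 this).2.2
  have hb : 0 < b := ha.trans_le hab
  set R : ℝ → ℝ := fun x => -(2 * deriv φ x * deriv g x + φ x * deriv (deriv g) x) with hR
  have hRc : ContinuousOn R (Ioi 0) :=
    (((continuousOn_const.mul hφ.1.1.2.continuousOn).mul hg1.continuous.continuousOn).add
      (hφ.1.1.prim.continuousOn.mul (hg1.continuous_deriv le_rfl).continuousOn)).neg
  have hg0 : ∀ x, x < a → deriv g x = 0 ∧ deriv (deriv g) x = 0 := by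
    intro x hx
    have h : ∀ y < a, deriv g y = 0 := fun y hy => by
      have : g =ᶠ[𝓝 y] fun _ => 1 := by
        filter_upwards [Iio_mem_nhds hy] with z hz using h1 z (le_of_lt hz)
      rw [this.deriv_eq]; simp
    refine ⟨h x hx, ?_⟩
    have : deriv g =ᶠ[𝓝 x] fun _ => 0 := by
      filter_upwards [Iio_mem_nhds hx] with z hz using h z hz
    rw [this.deriv_eq]; simp
  have hg2 : ∀ x, b < x → deriv g x = 0 ∧ deriv (deriv g) x = 0 := by
    intro x hx
    have h : ∀ y, b < y → deriv g y = 0 := fun y hy => by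
      have : g =ᶠ[𝓝 y] fun _ => 0 := by
        filter_upwards [Ioi_mem_nhds hy] with z hz using h0 z (le_of_lt hz)
      rw [this.deriv_eq]; simp
    refine ⟨h x hx, ?_⟩
    have : deriv g =ᶠ[𝓝 x] fun _ => 0 := by
      filter_upwards [Ioi_mem_nhds hx] with z hz using h z hz
    rw [this.deriv_eq]; simp
  have hR0 : ∀ x, x < a → R x = 0 := fun x hx => by simp [hR, hg0 x hx]
  have hR2 : ∀ x, b < x → R x = 0 := fun x hx => by simp [hR, hg2 x hx]
  obtain ⟨C, hC⟩ := isCompact_Icc.exists_bound_of_continuousOn (s := Icc a b) (f := R)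
    (hRc.mono fun x hx => ha.trans_le hx.1)
  obtain ⟨D, hD⟩ := isCompact_Icc.exists_bound_of_continuousOn (s := Icc 0 b) (f := g)
    hg.continuous.continuousOn
  obtain ⟨B, hB⟩ := hφ.exists_bound hyp.le_l b
  have hpc : ContinuousOn (fun x => ((φ x * g x : ℝ) : ℂ)) (Ioi 0) :=
    Complex.continuous_ofReal.comp_continuousOn
      (hφ.1.1.prim.continuousOn.mul hg.continuous.continuousOn)
  have m1 : MemLp (fun x => ((φ x * g x : ℝ) : ℂ)) 2 (volume.restrict (Ioi (0 : ℝ))) := by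
    refine memLp_of_bounded_support (hpc.aestronglyMeasurable measurableSet_Ioi) (B := B * D)
      (X := b) (fun x hx => ?_) fun x hx => by rw [h0 x hx.le]; simp
    rw [Complex.norm_real, norm_mul]
    exact mul_le_mul (hB x hx) (hD x ⟨hx.1.le, hx.2⟩) (norm_nonneg _)
      ((norm_nonneg _).trans (hB x hx))
  have m2 : MemLp (fun x => (R x : ℂ)) 2 (volume.restrict (Ioi (0 : ℝ))) := by
    refine memLp_of_bounded_support ((Complex.continuous_ofReal.comp_continuousOn
      hRc).aestronglyMeasurable measurableSet_Ioi) (B := max C 0)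
      (X := b) (fun x hx => ?_) fun x hx => by rw [hR2 x hx]; simp
    rw [Complex.norm_real]
    rcases lt_or_ge x a with hxa | hxa
    · rw [hR0 x hxa, norm_zero]; exact le_max_right _ _
    · exact (hC x ⟨hxa, hx.2⟩).trans (le_max_left _ _)
  have htau := hφ.tau_mul hg
  have hdom : InDom l q (fun x => ((φ x * g x : ℝ) : ℂ)) :=
    ⟨hφ.locAC2_mul hg, hφ.bdryCond_mul hyp hg ha fun x hx => h1 x hx.le, m1,
      (memLp_congr_ae htau).2 ((m1.const_mul _).add m2)⟩
  have h2 := hF _ hdom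
  have n1 : Integrable (fun x => (φ x * g x) ^ 2) (volume.restrict (Ioi (0 : ℝ))) := by
    refine (MemLp.norm_sq_integrable m1).congr (Eventually.of_forall fun x => ?_)
    simp only [Complex.norm_real, Real.norm_eq_abs, sq_abs]
  have n2 : Integrable (fun x => φ x * g x * R x) (volume.restrict (Ioi (0 : ℝ))) := by
    refine (MemLp.conj_mul_integrable m1 m2).re.congr (Eventually.of_forall fun x => ?_)
    change (starRingEnd ℂ ((φ x * g x : ℝ) : ℂ) * (R x : ℂ)).re = φ x * g x * R x
    rw [Complex.conj_ofReal, ← Complex.ofReal_mul, Complex.ofReal_re]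
  have h3 : ∫ x in Ioi (0 : ℝ), starRingEnd ℂ ((φ x * g x : ℝ) : ℂ) *
      tau l q (fun x => ((φ x * g x : ℝ) : ℂ)) x =
      ((lam * (∫ x in Ioi (0 : ℝ), (φ x * g x) ^ 2) +
        ∫ x in Ioi (0 : ℝ), φ x * g x * R x : ℝ) : ℂ) := by
    rw [← integral_const_mul, ← integral_add (n1.const_mul _) n2, ← integral_complex_ofReal]
    refine integral_congr_ae ?_
    filter_upwards [htau] with x hx
    rw [hx, Complex.conj_ofReal]
    simp only [hR]
    push_cast
    ring
  have h4 : ∫ x in Ioi (0 : ℝ), φ x * g x * R x = ∫ x in a..b, (φ x * deriv g x) ^ 2 := by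
    rw [← hφ.integral_remainder hg ha hab hga hgb, intervalIntegral.integral_of_le hab,
      ← integral_Icc_eq_integral_Ioc]
    refine setIntegral_eq_of_subset_of_forall_sdiff_eq_zero (s := Icc a b) measurableSet_Ioi
      (fun x hx => ha.trans_le hx.1) fun x hx => ?_
    have : R x = 0 := by
      by_contra hne
      refine hx.2 ⟨not_lt.1 fun h => hne (hR0 x h), not_lt.1 fun h => hne (hR2 x h)⟩
    rw [this, mul_zero]
  rw [h3, Complex.ofReal_re, h4] at h2
  simp only [Complex.norm_real, Real.norm_eq_abs, sq_abs] at h2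
  linarith

/-- Cut `φ` off just before a zero `x0`. Over a length of order `ε` one has `φ = O(ε)` and `g' = O(1
/ ε)`, so the cost is `O(ε)`, whereas the form bound demands at least `η ∫ φ ^ 2` over a fixed
interval. -/
theorem pos (hφ : IsRegularSolution l q lam φ) (hyp : Hyp l q) {η : ℝ} (hη : 0 < η)
    (hF : FormBound l q (lam + η)) : ∀ x, 0 < x → 0 < φ x := by
  intro x1 hx1
  by_contra hneg
  obtain ⟨x0, hx0, hz⟩ : ∃ x0, 0 < x0 ∧ φ x0 = 0 := by
    obtain ⟨d, hd, hd1, hb⟩ := hφ.exists_bounds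
    have hpos : 0 < φ d := lt_of_lt_of_le
      (by have := Real.rpow_pos_of_pos hd (l + 1); positivity) (hb d ⟨hd, le_rfl⟩).1
    obtain ⟨x0, h, h'⟩ := isPreconnected_Ioi.intermediate_value (show x1 ∈ Ioi (0 : ℝ) from hx1)
      (show d ∈ Ioi (0 : ℝ) from hd) hφ.1.1.prim.continuousOn ⟨not_lt.1 hneg, hpos.le⟩
    exact ⟨x0, h, h'⟩
  obtain ⟨M, hM⟩ := isCompact_Icc.exists_bound_of_continuousOn (s := Icc (x0 / 4) x0)
    (f := deriv φ) (hφ.1.1.2.continuousOn.mono fun x hx =>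
      (show (0 : ℝ) < x0 / 4 by positivity).trans_le hx.1)
  have hS : ContDiff ℝ 2 Real.smoothTransition := Real.smoothTransition.contDiff
  obtain ⟨N, hN⟩ := isCompact_Icc.exists_bound_of_continuousOn (s := Icc (-1 : ℝ) 2)
    (f := deriv Real.smoothTransition) (hS.continuous_deriv (by norm_num)).continuousOn
  set c := ∫ x in Ioc 0 (x0 / 4), φ x ^ 2 with hc
  have hcpos : 0 < c := hφ.setIntegral_sq_pos hyp.le_l (by positivity)
  have key : ∀ ε, 0 < ε → ε ≤ x0 / 4 → η * c ≤ 27 * (M * N) ^ 2 * ε := by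
    intro ε hε hεx
    -- Equal to 1 up to `x0 - 2 ε` and to 0 from `x0 - ε` on. The larger interval from `x0 - 3 ε` to
    -- `x0` is used so that `g` is locally constant at both endpoints; it accounts for `27 = 9 * 3`.
    set g : ℝ → ℝ := fun x => Real.smoothTransition ((x0 - x) / ε - 1) with hg
    have hgd : ContDiff ℝ 2 g :=
      hS.comp (((contDiff_const.sub contDiff_id).div_const ε).sub contDiff_const)
    have hg' : ∀ x, deriv g x = deriv Real.smoothTransition ((x0 - x) / ε - 1) * (-1 / ε) := by
      intro x
      have h1 : HasDerivAt (fun x : ℝ => (x0 - x) / ε - 1) (-1 / ε) x :=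
        (((hasDerivAt_id x).const_sub x0).div_const ε).sub_const 1
      exact ((hS.differentiable (by norm_num) _).hasDerivAt.comp x h1).deriv
    have hg1 : ∀ x ≤ x0 - 2 * ε, g x = 1 := by
      intro x hx
      refine Real.smoothTransition.one_of_one_le ?_
      rw [le_sub_iff_add_le, le_div_iff₀ hε]; linarith
    have hg0 : ∀ x, x0 - ε ≤ x → g x = 0 := by
      intro x hx
      refine Real.smoothTransition.zero_of_nonpos ?_
      rw [sub_nonpos, div_le_one hε]; linarith
    have hd1 : deriv g (x0 - 3 * ε) = 0 := by
      have : g =ᶠ[𝓝 (x0 - 3 * ε)] fun _ => 1 := by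
        filter_upwards [Iio_mem_nhds (show x0 - 3 * ε < x0 - 2 * ε by linarith)] with z hz
          using hg1 z (le_of_lt hz)
      rw [this.deriv_eq]; simp
    have hd0 : deriv g x0 = 0 := by
      have : g =ᶠ[𝓝 x0] fun _ => 0 := by
        filter_upwards [Ioi_mem_nhds (show x0 - ε < x0 by linarith)] with z hz
          using hg0 z (le_of_lt hz)
      rw [this.deriv_eq]; simp
    have ha : 0 < x0 - 3 * ε := by linarith
    have hab : x0 - 3 * ε ≤ x0 := by linarith
    have h1 := hφ.form_cutoff_le hyp hF hgd ha hab (fun x hx => hg1 x (by linarith))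
      (fun x hx => hg0 x (by linarith)) hd1 hd0
    have hsub : Icc (x0 - 3 * ε) x0 ⊆ Icc (x0 / 4) x0 := Icc_subset_Icc_left (by linarith)
    have h2 : ∫ x in (x0 - 3 * ε)..x0, (φ x * deriv g x) ^ 2 ≤
        ∫ x in (x0 - 3 * ε)..x0, 9 * (M * N) ^ 2 := by
      refine intervalIntegral.integral_mono_on hab ?_ intervalIntegrable_const fun x hx => ?_
      · refine ContinuousOn.intervalIntegrable ?_
        rw [uIcc_of_le hab]
        exact ((hφ.1.1.prim.continuousOn.mul
          (hgd.continuous_deriv (by norm_num)).continuousOn).pow 2).mono fun x hx => ha.trans_le hx.1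
      · have hx0' : 0 < x := ha.trans_le hx.1
        have e1 : ‖φ x‖ ≤ M * (3 * ε) := by
          have := (convex_Icc (x0 / 4) x0).norm_image_sub_le_of_norm_hasDerivWithin_le
            (fun y hy => (hφ.1.1.hasDerivAt (show 0 < y by linarith [hy.1])).hasDerivWithinAt) hM
            (right_mem_Icc.2 (by linarith)) (hsub hx)
          rw [hz, sub_zero] at this
          refine this.trans ?_
          have hM0 : 0 ≤ M := (norm_nonneg _).trans (hM x (hsub hx))
          gcongr
          rw [Real.norm_eq_abs, abs_le]
          constructor <;> linarith [hx.1, hx.2]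
        have e2 : ‖deriv g x‖ ≤ N / ε := by
          have h3 : (x0 - x) / ε - 1 ∈ Icc (-1 : ℝ) 2 := by
            have h4 : (x0 - x) / ε ≤ 3 := by rw [div_le_iff₀ hε]; linarith [hx.1]
            have h5 : 0 ≤ (x0 - x) / ε := div_nonneg (by linarith [hx.2]) hε.le
            constructor <;> linarith
          rw [hg' x, norm_mul, norm_div, norm_neg, norm_one, Real.norm_of_nonneg hε.le, mul_one_div]
          gcongr
          exact hN _ h3
        have e3 : ‖φ x * deriv g x‖ ≤ M * (3 * ε) * (N / ε) := by
          rw [norm_mul]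
          exact mul_le_mul e1 e2 (norm_nonneg _) ((norm_nonneg _).trans e1)
        have e4 : M * (3 * ε) * (N / ε) = 3 * (M * N) := by field_simp
        rw [e4] at e3
        calc (φ x * deriv g x) ^ 2 = ‖φ x * deriv g x‖ ^ 2 := by
              rw [Real.norm_eq_abs, sq_abs]
          _ ≤ (3 * (M * N)) ^ 2 := pow_le_pow_left₀ (norm_nonneg _) e3 2
          _ = _ := by ring
    rw [intervalIntegral.integral_const, smul_eq_mul] at h2
    have h3 : c ≤ ∫ x in Ioi (0 : ℝ), (φ x * g x) ^ 2 := by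
      have e : c = ∫ x in Ioc 0 (x0 / 4), (φ x * g x) ^ 2 :=
        setIntegral_congr_fun measurableSet_Ioc fun x hx => by
          rw [hg1 x (by linarith [hx.2]), mul_one]
      rw [e]
      refine setIntegral_mono_set ?_ (Eventually.of_forall fun x => sq_nonneg _)
        (LE.le.eventuallyLE Ioc_subset_Ioi_self)
      obtain ⟨B, hB⟩ := hφ.exists_bound hyp.le_l x0
      have hm := memLp_of_bounded_support (f := fun x => ((φ x * g x : ℝ) : ℂ)) (B := B) (X := x0)
        ((Complex.continuous_ofReal.comp_continuousOn (hφ.1.1.prim.continuousOn.mul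
          hgd.continuous.continuousOn)).aestronglyMeasurable measurableSet_Ioi) (fun x hx => by
          rw [Complex.norm_real, norm_mul, Real.norm_of_nonneg (Real.smoothTransition.nonneg _)]
          exact (mul_le_of_le_one_right (norm_nonneg _) (Real.smoothTransition.le_one _)).trans
            (hB x hx)) (fun x hx => by rw [hg0 x (by linarith)]; simp)
      refine (MemLp.norm_sq_integrable hm).congr (Eventually.of_forall fun x => ?_)
      simp only [Complex.norm_real, Real.norm_eq_abs, sq_abs]
    have h4 : η * c ≤ η * ∫ x in Ioi (0 : ℝ), (φ x * g x) ^ 2 := by gcongr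
    rw [show lam + η - lam = η by ring] at h1
    nlinarith
  have hpos1 : 0 < 27 * (M * N) ^ 2 + 1 := by positivity
  set ε := min (x0 / 4) (η * c / (2 * (27 * (M * N) ^ 2 + 1))) with hε
  have hε0 : 0 < ε := by positivity
  have h1 := key ε hε0 (min_le_left _ _)
  have h2 : ε * (2 * (27 * (M * N) ^ 2 + 1)) ≤ η * c := by
    rw [← le_div_iff₀ (by positivity)]; exact min_le_right _ _
  have h3 : 0 < η * c := by positivity
  nlinarith

end IsRegularSolution

end Bessel

namespace Bessel

/-! ### Form domains and lower bounds of unbounded operators -/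

section Abstract

variable {E : Type*} [NormedAddCommGroup E] [InnerProductSpace ℂ E] {T : E →ₗ.[ℂ] E}

/-- `G` is the graph of a closed operator `A` with `⟨A f, A u⟩ = ⟨f, (T - lam) u⟩` for `f` in the
domain of `A` and `u` in the domain of `T`. -/
structure IsFactor (T : E →ₗ.[ℂ] E) (lam : ℝ) (G : Submodule ℂ (E × E)) : Prop where
  closed : IsClosed (G : Set (E × E))
  single : ∀ k, ((0 : E), k) ∈ G → k = 0
  dom : ∀ u : T.domain, ∃ a, ((u : E), a) ∈ G
  form : ∀ f k, (f, k) ∈ G → ∀ (u : T.domain) (a : E), ((u : E), a) ∈ G →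
    inner ℂ k a = inner ℂ f (T u - (lam : ℂ) • (u : E))

namespace IsFactor

variable {lam : ℝ} {G : Submodule ℂ (E × E)}

/-- Both sides differ from ⟨A u, A v⟩ by the same multiple of ⟨u, v⟩, as `lam` is real. -/
theorem symmetric (h : IsFactor T lam G) (u v : T.domain) :
    inner ℂ (T u) (v : E) = inner ℂ (u : E) (T v) := by
  obtain ⟨a, ha⟩ := h.dom u
  obtain ⟨b, hb⟩ := h.dom v
  have h1 := h.form _ _ ha v b hb
  have h2 := congrArg (starRingEnd ℂ) (h.form _ _ hb u a ha)
  rw [inner_conj_symm, inner_conj_symm, h1, inner_sub_left, inner_sub_right, inner_smul_left,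
    inner_smul_right, Complex.conj_ofReal] at h2
  exact (sub_left_inj.1 h2).symm

theorem inner_eq (h : IsFactor T lam G) (u : T.domain) {a : E} (ha : ((u : E), a) ∈ G) :
    inner ℂ (u : E) (T u) = (‖a‖ ^ 2 + lam * ‖(u : E)‖ ^ 2 : ℝ) := by
  have h1 := h.form _ _ ha u a ha
  rw [inner_sub_right, inner_smul_right, inner_self_eq_norm_sq_to_K,
    inner_self_eq_norm_sq_to_K] at h1
  push_cast
  rw [eq_comm, sub_eq_iff_eq_add] at h1
  simpa using h1

/-- A form-Cauchy sequence converging in norm is Cauchy for the graph norm of `A`, and `A` is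
closed. -/
theorem formDomain_subset [CompleteSpace E] (h : IsFactor T lam G) {f : E}
    (hf : f ∈ formDomain T) : ∃ k, (f, k) ∈ G := by
  obtain ⟨u, hu, hc⟩ := hf
  choose a ha using fun n => h.dom (u n)
  have hsub : ∀ n m, (((u n - u m : T.domain) : E), a n - a m) ∈ G := fun n m => by
    have := G.sub_mem (ha n) (ha m)
    simpa using this
  have hun : Tendsto (fun p : ℕ × ℕ => ‖((u p.1 - u p.2 : T.domain) : E)‖ ^ 2) atTop (𝓝 0) := by
    have h1 : Tendsto (fun p : ℕ × ℕ => ((u p.1 : E) - u p.2)) atTop (𝓝 (f - f)) := by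
      rw [← prod_atTop_atTop_eq]
      exact (hu.comp tendsto_fst).sub (hu.comp tendsto_snd)
    have h2 := (h1.norm.pow 2)
    simpa using h2
  have han : Tendsto (fun p : ℕ × ℕ => ‖a p.1 - a p.2‖ ^ 2) atTop (𝓝 0) := by
    have h1 := (Complex.continuous_re.tendsto _).comp hc
    have h2 := h1.sub (hun.const_mul lam)
    simp only [Complex.zero_re, mul_zero, sub_zero] at h2
    refine h2.congr fun p => ?_
    simp only [Function.comp_apply]
    rw [h.inner_eq _ (hsub p.1 p.2), Complex.ofReal_re]
    ring
  have hcau : CauchySeq a := by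
    rw [cauchySeq_iff_tendsto_dist_atTop_0]
    have h1 := han.sqrt
    rw [Real.sqrt_zero] at h1
    refine h1.congr fun p => ?_
    rw [Real.sqrt_sq (norm_nonneg _), dist_eq_norm]
  obtain ⟨k, hk⟩ := cauchySeq_tendsto_of_complete hcau
  exact ⟨k, h.closed.mem_of_tendsto (hu.prodMk_nhds hk) (Eventually.of_forall ha)⟩

/-- The domain of `T` is a core: `(f, k)` is projected onto the closure of the graph of `A`
restricted to it, and surjectivity of `T - (lam - 1)` makes the orthogonal remainder vanish. -/
theorem subset_formDomain [CompleteSpace E] (h : IsFactor T lam G)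
    (hsurj : ∀ g : E, ∃ u : T.domain, T u - ((lam - 1 : ℝ) : ℂ) • (u : E) = g) {f k : E}
    (hfk : (f, k) ∈ G) : f ∈ formDomain T := by
  let L : WithLp 2 (E × E) →ₗ[ℂ] E × E := (WithLp.linearEquiv 2 ℂ (E × E)).toLinearMap
  let S : Submodule ℂ (WithLp 2 (E × E)) :=
    G.comap L ⊓ T.domain.comap ((LinearMap.fst ℂ E E).comp L)
  have hLc : Continuous L := WithLp.prod_continuous_ofLp 2 E E
  have hGc : IsClosed ((G.comap L : Submodule ℂ (WithLp 2 (E × E))) : Set (WithLp 2 (E × E))) :=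
    h.closed.preimage hLc
  set K := S.topologicalClosure with hK
  have hKG : K ≤ G.comap L := S.topologicalClosure_minimal inf_le_left hGc
  have : CompleteSpace K := S.isClosed_topologicalClosure.completeSpace_coe
  set x : WithLp 2 (E × E) := WithLp.toLp 2 (f, k) with hx
  set y := x - K.starProjection x with hy
  have hyK : y ∈ Kᗮ := K.sub_starProjection_mem_orthogonal x
  have hyG : L y ∈ G := by
    rw [hy, map_sub]
    exact G.sub_mem hfk (hKG (K.starProjection_apply_mem x))
  have hy1 : (L y).1 = 0 := by
    -- With this `u`, the graph inner product of `y` with `(u, A u)` is the squared norm of the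
    -- first component of `y`.
    obtain ⟨u, hu⟩ := hsurj (L y).1
    obtain ⟨a, ha⟩ := h.dom u
    have hmem : (WithLp.toLp 2 ((u : E), a) : WithLp 2 (E × E)) ∈ K :=
      S.le_topologicalClosure ⟨ha, u.2⟩
    have h1 := Submodule.inner_left_of_mem_orthogonal hmem hyK
    have h2 := h.form (L y).1 (L y).2 hyG u a ha
    rw [WithLp.prod_inner_apply] at h1
    change inner ℂ (L y).1 (u : E) + inner ℂ (L y).2 a = 0 at h1
    rw [h2, ← inner_add_right] at h1
    have e : (u : E) + (T u - (lam : ℂ) • (u : E)) = (L y).1 := by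
      rw [← hu]; push_cast; module
    rwa [e, inner_self_eq_zero] at h1
  have hy2 : (L y).2 = 0 := h.single _ (by rw [← hy1]; exact hyG)
  have hy0 : y = 0 := (WithLp.linearEquiv 2 ℂ (E × E)).injective (by
    rw [map_zero]; exact Prod.ext hy1 hy2)
  have hxK : x ∈ K := by
    rw [sub_eq_zero.1 hy0]; exact K.starProjection_apply_mem x
  obtain ⟨z, hz, hzl⟩ := mem_closure_iff_seq_limit.1
    (show x ∈ closure (S : Set (WithLp 2 (E × E))) from hxK)
  have hzL := (hLc.tendsto x).comp hzl
  have hz1 : Tendsto (fun n => (L (z n)).1) atTop (𝓝 f) := (continuous_fst.tendsto _).comp hzL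
  have hz2 : Tendsto (fun n => (L (z n)).2) atTop (𝓝 k) := (continuous_snd.tendsto _).comp hzL
  refine ⟨fun n => ⟨(L (z n)).1, (hz n).2⟩, hz1, ?_⟩
  have hn : ∀ (w : ℕ → E) (v : E), Tendsto w atTop (𝓝 v) →
      Tendsto (fun p : ℕ × ℕ => ‖w p.1 - w p.2‖ ^ 2) atTop (𝓝 0) := fun w v hw => by
    have h1 : Tendsto (fun p : ℕ × ℕ => w p.1 - w p.2) atTop (𝓝 (v - v)) := by
      rw [← prod_atTop_atTop_eq]
      exact (hw.comp tendsto_fst).sub (hw.comp tendsto_snd)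
    have h2 := (h1.norm.pow 2)
    simpa using h2
  have hlim := (hn _ _ hz2).add ((hn _ _ hz1).const_mul lam)
  rw [mul_zero, add_zero] at hlim
  have hlimc := (Complex.continuous_ofReal.tendsto _).comp hlim
  rw [Complex.ofReal_zero] at hlimc
  refine hlimc.congr fun p => ?_
  have hmem := G.sub_mem (hz p.1).1 (hz p.2).1
  exact (h.inner_eq (⟨(L (z p.1)).1, (hz p.1).2⟩ - ⟨(L (z p.2)).1, (hz p.2).2⟩ : T.domain)
    (a := (L (z p.1)).2 - (L (z p.2)).2) hmem).symm

end IsFactor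

/-- Let `s` be the best lower bound. If `s ≤ lam`, it has a resolvent `R`, and the nonnegative form
of `T - s` at `u - t R u` gives ⟨u, (T - s) u⟩ ≥ 2 t ‖u‖² - t² Re ⟨u, R u⟩ ≥ t ‖u‖² for small `t >
0`, improving `s`. -/
theorem exists_lower_bound (hsym : ∀ u v : T.domain, inner ℂ (T u) (v : E) = inner ℂ (u : E) (T v))
    (hb : BoundedBelow T) {lam : ℝ} (hres : ∀ s : ℝ, s ≤ lam → InResolventSet T (s : ℂ)) :
    ∃ ε, 0 < ε ∧ ∀ u : T.domain, (lam + ε) * ‖(u : E)‖ ^ 2 ≤ (inner ℂ (u : E) (T u)).re := by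
  set S : Set ℝ := {c | ∀ u : T.domain, c * ‖(u : E)‖ ^ 2 ≤ (inner ℂ (u : E) (T u)).re} with hS
  by_cases hcase : ∃ c ∈ S, lam < c
  · obtain ⟨c, hc, hlt⟩ := hcase
    exact ⟨c - lam, by linarith, fun u => by have := hc u; rwa [add_sub_cancel]⟩
  exfalso
  push Not at hcase
  have hne : S.Nonempty := hb
  have hbdd : BddAbove S := ⟨lam, hcase⟩
  set s := sSup S with hs
  have hsS : ∀ u : T.domain, s * ‖(u : E)‖ ^ 2 ≤ (inner ℂ (u : E) (T u)).re := by
    intro u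
    rcases (norm_nonneg (u : E)).eq_or_lt with h0 | h0
    · obtain ⟨c, hc⟩ := hne
      have := hc u
      rw [← h0] at this ⊢
      simpa using this
    · have h2 : 0 < ‖(u : E)‖ ^ 2 := by positivity
      rw [← le_div_iff₀ h2]
      exact csSup_le hne fun c hc => (le_div_iff₀ h2).2 (hc u)
  obtain ⟨R, hR1, hR2⟩ := hres s (csSup_le hne hcase)
  set t := 1 / (‖R‖ + 1) with ht
  have ht0 : 0 < t := by positivity
  have htR : t * ‖R‖ ≤ 1 := by
    rw [ht, one_div, inv_mul_le_iff₀ (by positivity)]; linarith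
  have hmem : s + t ∈ S := by
    intro u
    obtain ⟨hv, hvu⟩ := hR1 u
    set v : T.domain := ⟨R u, hv⟩ with hvdef
    have hTv : T v = (u : E) + (s : ℂ) • (v : E) := by rw [← hvu]; simp [hvdef]
    have hnn := hsS (u - (t : ℂ) • v)
    have e1 : T (u - (t : ℂ) • v) = T u - (t : ℂ) • T v := by
      rw [LinearPMap.map_sub, LinearPMap.map_smul]
    have e2 : ((u - (t : ℂ) • v : T.domain) : E) = (u : E) - (t : ℂ) • (v : E) := rfl
    have e3 : (inner ℂ (u : E) (T v)).re = ‖(u : E)‖ ^ 2 + s * (inner ℂ (u : E) (v : E)).re := by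
      rw [hTv, inner_add_right, inner_smul_right, inner_self_eq_norm_sq_to_K, Complex.add_re,
        Complex.re_ofReal_mul]
      norm_cast
    have e4 : (inner ℂ (v : E) (T u)).re = (inner ℂ (u : E) (T v)).re := by
      rw [← hsym v u, ← inner_conj_symm, Complex.conj_re]
    have e5 : (inner ℂ (v : E) (T v)).re = (inner ℂ (u : E) (v : E)).re + s * ‖(v : E)‖ ^ 2 := by
      rw [hTv, inner_add_right, inner_smul_right, inner_self_eq_norm_sq_to_K, Complex.add_re,
        Complex.re_ofReal_mul, ← inner_conj_symm, Complex.conj_re]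
      norm_cast
    have e6 : ‖(u : E) - (t : ℂ) • (v : E)‖ ^ 2 =
        ‖(u : E)‖ ^ 2 - 2 * t * (inner ℂ (u : E) (v : E)).re + t ^ 2 * ‖(v : E)‖ ^ 2 := by
      rw [norm_sub_sq (𝕜 := ℂ), inner_smul_right, norm_smul, Complex.norm_real,
        Real.norm_of_nonneg ht0.le]
      change _ - 2 * ((t : ℂ) * inner ℂ (u : E) (v : E)).re + _ = _
      rw [Complex.re_ofReal_mul]
      ring
    have e7 : (inner ℂ ((u : E) - (t : ℂ) • (v : E)) (T u - (t : ℂ) • T v)).re =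
        (inner ℂ (u : E) (T u)).re - 2 * t * (inner ℂ (u : E) (T v)).re +
          t ^ 2 * (inner ℂ (v : E) (T v)).re := by
      rw [inner_sub_left, inner_sub_right, inner_sub_right, inner_smul_left, inner_smul_left,
        inner_smul_right, inner_smul_right, Complex.conj_ofReal]
      simp only [Complex.sub_re, Complex.re_ofReal_mul]
      rw [e4]
      ring
    rw [e1, e2, e6, e7, e5, e3] at hnn
    have h8 : (inner ℂ (u : E) (v : E)).re ≤ ‖R‖ * ‖(u : E)‖ ^ 2 := by
      calc (inner ℂ (u : E) (v : E)).re ≤ ‖(u : E)‖ * ‖(v : E)‖ :=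
            (Complex.re_le_norm _).trans (norm_inner_le_norm _ _)
        _ ≤ ‖(u : E)‖ * (‖R‖ * ‖(u : E)‖) := by
            gcongr; exact R.le_opNorm _
        _ = _ := by ring
    have h9 : t ^ 2 * (inner ℂ (u : E) (v : E)).re ≤ t * ‖(u : E)‖ ^ 2 := by
      calc t ^ 2 * (inner ℂ (u : E) (v : E)).re ≤ t ^ 2 * (‖R‖ * ‖(u : E)‖ ^ 2) := by gcongr
        _ = t * (t * ‖R‖) * ‖(u : E)‖ ^ 2 := by ring
        _ ≤ t * 1 * ‖(u : E)‖ ^ 2 := by gcongr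
        _ = _ := by ring
    nlinarith
  have := le_csSup hbdd hmem
  linarith

end Abstract

end Bessel

namespace Bessel

variable {l lam : ℝ} {q φ : ℝ → ℝ}

/-! ### The closed first order operator -/

theorem LocAC.eqOn_of_ae {F G : ℝ → ℂ} (hF : LocAC F) (hG : LocAC G)
    (h : F =ᵐ[volume.restrict (Ioi (0 : ℝ))] G) : EqOn F G (Ioi 0) :=
  Measure.eqOn_open_of_ae_eq h isOpen_Ioi hF.continuousOn hG.continuousOn

theorem factor_congr {F G : ℝ → ℂ} (h : EqOn F G (Ioi 0)) :
    EqOn (factor φ F) (factor φ G) (Ioi 0) := fun x hx => by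
  rw [factor, factor, (h.eventuallyEq_of_mem (Ioi_mem_nhds hx)).deriv_eq, h hx]

/-- The graph of the maximal operator `- d/dx + φ' / φ` in `L²(ℝ₊)`. -/
def factorGraph (φ : ℝ → ℝ) : Submodule ℂ (L2 × L2) where
  carrier := {p | ∃ F : ℝ → ℂ, LocAC F ∧ p.1 =ᵐ[volume.restrict (Ioi (0 : ℝ))] F ∧
    p.2 =ᵐ[volume.restrict (Ioi (0 : ℝ))] factor φ F}
  add_mem' := by
    rintro p r ⟨F, hF, f1, f2⟩ ⟨G, hG, g1, g2⟩
    refine ⟨F + G, fun a b ha hab => (hF a b ha hab).add (hG a b ha hab),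
      (Lp.coeFn_add p.1 r.1).trans (f1.add g1),
      (Lp.coeFn_add p.2 r.2).trans ((f2.add g2).trans ?_)⟩
    filter_upwards [hF.ae_differentiableAt, hG.ae_differentiableAt] with x h1 h2
    simp only [Pi.add_apply, factor, deriv_add h1 h2]
    ring
  zero_mem' := by
    refine ⟨fun _ => 0, LocAC.of_contDiffOn contDiffOn_const, Lp.coeFn_zero _ _ _,
      (Lp.coeFn_zero _ _ _).trans (Eventually.of_forall fun x => ?_)⟩
    simp [factor]
  smul_mem' := by
    rintro c p ⟨F, hF, f1, f2⟩
    refine ⟨c • F, fun a b ha hab => (hF a b ha hab).const_smul c,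
      (Lp.coeFn_smul c p.1).trans (f1.const_smul c),
      (Lp.coeFn_smul c p.2).trans ((f2.const_smul c).trans (Eventually.of_forall fun x => ?_))⟩
    simp only [factor, deriv_smul_eq, Pi.smul_apply, smul_eq_mul]
    ring

theorem exists_mem_factorGraph_iff (f : L2) : (∃ k, (f, k) ∈ factorGraph φ) ↔
    ∃ F : ℝ → ℂ, f =ᵐ[volume.restrict (Ioi (0 : ℝ))] F ∧ LocAC F ∧
      MemLp (factor φ F) 2 (volume.restrict (Ioi (0 : ℝ))) := by
  constructor
  · rintro ⟨k, F, hF, h1, h2⟩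
    exact ⟨F, h1, hF, (memLp_congr_ae h2).1 (Lp.memLp k)⟩
  · rintro ⟨F, h1, hF, h2⟩
    exact ⟨h2.toLp _, F, hF, h1, h2.coeFn_toLp⟩

theorem factorGraph_single {k : L2} (h : ((0 : L2), k) ∈ factorGraph φ) : k = 0 := by
  obtain ⟨F, hF, h1, h2⟩ := h
  have h0 := hF.eqOn_of_ae (G := fun _ => 0) (LocAC.of_contDiffOn contDiffOn_const)
    (h1.symm.trans (Lp.coeFn_zero _ _ _))
  refine Lp.ext (h2.trans (EventuallyEq.trans ?_ (Lp.coeFn_zero _ _ _).symm))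
  filter_upwards [ae_restrict_mem measurableSet_Ioi] with x hx
  rw [factor_congr h0 hx]
  simp [factor]

theorem L2.inner_eq_integral {f g : L2} {F G : ℝ → ℂ}
    (hf : f =ᵐ[volume.restrict (Ioi (0 : ℝ))] F) (hg : g =ᵐ[volume.restrict (Ioi (0 : ℝ))] G) :
    inner ℂ f g = ∫ x in Ioi (0 : ℝ), starRingEnd ℂ (F x) * G x := by
  rw [MeasureTheory.L2.inner_def]
  refine integral_congr_ae ?_
  filter_upwards [hf, hg] with x h1 h2
  rw [h1, h2, RCLike.inner_apply, mul_comm]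

theorem L2.norm_sq_eq_integral {f : L2} {F : ℝ → ℂ}
    (hf : f =ᵐ[volume.restrict (Ioi (0 : ℝ))] F) :
    ‖f‖ ^ 2 = ∫ x in Ioi (0 : ℝ), ‖F x‖ ^ 2 := by
  have h := L2.inner_eq_integral hf hf
  rw [inner_self_eq_norm_sq_to_K] at h
  have e : ∀ x, starRingEnd ℂ (F x) * F x = ((‖F x‖ ^ 2 : ℝ) : ℂ) := fun x => by
    rw [mul_comm, Complex.mul_conj, Complex.normSq_eq_norm_sq]
  simp only [e, integral_complex_ofReal] at h
  refine Complex.ofReal_injective (Eq.trans ?_ h)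
  push_cast
  rfl

theorem H_exists_inDom (u : (H l q).domain) : ∃ U : ℝ → ℂ, InDom l q U ∧
    (u : L2) =ᵐ[volume.restrict (Ioi (0 : ℝ))] U ∧
    (H l q u : L2) =ᵐ[volume.restrict (Ioi (0 : ℝ))] tau l q U := by
  have h : ((u : L2), H l q u) ∈ (H l q).graph := LinearPMap.mem_graph _ u
  rw [H_graph] at h
  obtain ⟨U, h1, h2, h3, h4⟩ := h
  exact ⟨U, ⟨h1, h2, (memLp_congr_ae h3).1 (Lp.memLp _), (memLp_congr_ae h4).1 (Lp.memLp _)⟩, h3, h4⟩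

theorem InDom.exists_domain {U : ℝ → ℂ} (hU : InDom l q U) : ∃ u : (H l q).domain,
    (u : L2) =ᵐ[volume.restrict (Ioi (0 : ℝ))] U ∧
    (H l q u : L2) =ᵐ[volume.restrict (Ioi (0 : ℝ))] tau l q U := by
  have h : (hU.memLp.toLp U, hU.memLp_tau.toLp (tau l q U)) ∈ (H l q).graph := by
    rw [H_graph]
    exact ⟨U, hU.locAC2, hU.bdry, hU.memLp.coeFn_toLp, hU.memLp_tau.coeFn_toLp⟩
  obtain ⟨u, h1, h2⟩ := (LinearPMap.mem_graph_iff _).1 h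
  refine ⟨u, ?_, ?_⟩
  · rw [h1]; exact hU.memLp.coeFn_toLp
  · rw [h2]; exact hU.memLp_tau.coeFn_toLp

theorem formBound_of_lower_bound {c : ℝ}
    (h : ∀ u : (H l q).domain, c * ‖(u : L2)‖ ^ 2 ≤ (inner ℂ (u : L2) (H l q u)).re) :
    FormBound l q c := by
  intro U hU
  obtain ⟨u, h1, h2⟩ := hU.exists_domain
  have := h u
  rwa [L2.norm_sq_eq_integral h1, L2.inner_eq_integral h1 h2] at this

theorem memLp_indicator_inv (hφ : LocAC2 φ) (hpos : ∀ x, 0 < x → 0 < φ x) {x : ℝ} (hx : 0 < x) :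
    MemLp ((uIoc 1 x).indicator fun t => ((φ t : ℂ))⁻¹) 2 (volume.restrict (Ioi (0 : ℝ))) := by
  have hsub : uIcc 1 x ⊆ Ioi 0 := fun t ht => (lt_min one_pos hx).trans_le ht.1
  have hc : ContinuousOn (fun t => ((φ t : ℂ))⁻¹) (Ioi 0) :=
    (hφ.prim.ofReal.continuousOn).inv₀ fun t ht => by exact_mod_cast (hpos t ht).ne'
  obtain ⟨C, hC⟩ := isCompact_uIcc.exists_bound_of_continuousOn (hc.mono hsub)
  refine memLp_of_bounded_support ((hc.aestronglyMeasurable measurableSet_Ioi).indicator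
    measurableSet_uIoc) (B := max C 0) (X := max 1 x) (fun t _ => ?_) fun t ht => ?_
  · by_cases htm : t ∈ uIoc 1 x
    · rw [indicator_of_mem htm]
      exact (hC t (uIoc_subset_uIcc htm)).trans (le_max_left _ _)
    · rw [indicator_of_notMem htm, norm_zero]; exact le_max_right _ _
  · exact indicator_of_notMem (fun h => not_lt.2 h.2 ht) _

/-- Makes the integral continuous in `k ∈ L²`. The sign is the orientation of the interval. -/
theorem integral_div_eq_inner (hφ : LocAC2 φ) (hpos : ∀ x, 0 < x → 0 < φ x) {x : ℝ}
    (hx : 0 < x) (k : L2) : ∫ t in (1 : ℝ)..x, k t / φ t =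
      (if 1 ≤ x then 1 else -1 : ℝ) • inner ℂ ((memLp_indicator_inv hφ hpos hx).toLp _) k := by
  rw [intervalIntegral.intervalIntegral_eq_integral_uIoc,
    L2.inner_eq_integral (memLp_indicator_inv hφ hpos hx).coeFn_toLp EventuallyEq.rfl]
  congr 1
  have e : ∀ t, starRingEnd ℂ ((uIoc 1 x).indicator (fun t => ((φ t : ℂ))⁻¹) t) * k t =
      (uIoc 1 x).indicator (fun t => k t / φ t) t := by
    intro t
    by_cases htm : t ∈ uIoc 1 x
    · rw [indicator_of_mem htm, indicator_of_mem htm, map_inv₀, Complex.conj_ofReal]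
      ring
    · rw [indicator_of_notMem htm, indicator_of_notMem htm, map_zero, zero_mul]
  simp only [e]
  rw [integral_indicator measurableSet_uIoc, Measure.restrict_restrict measurableSet_uIoc,
    inter_eq_left.2 (show uIoc 1 x ⊆ Ioi 0 from fun t ht => (lt_min one_pos hx).trans ht.1)]

theorem intervalIntegrable_div (hφ : LocAC2 φ) (hpos : ∀ x, 0 < x → 0 < φ x) (k : L2) {a b : ℝ}
    (ha : 0 < a) (hab : a ≤ b) : IntervalIntegrable (fun t => k t / φ t) volume a b := by
  have h1 : IntervalIntegrable k volume a b := by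
    have h := (integral_norm_le_sqrt (Lp.memLp k) (ha.trans_le hab)).1
    refine h.mono_set ?_
    rw [uIcc_of_le hab, uIcc_of_le (ha.le.trans hab)]
    exact Icc_subset_Icc_left ha.le
  have hc : ContinuousOn (fun t => ((φ t : ℂ))⁻¹) (Ioi 0) :=
    (hφ.prim.ofReal.continuousOn).inv₀ fun t ht => by exact_mod_cast (hpos t ht).ne'
  simp only [div_eq_mul_inv]
  refine h1.mul_continuousOn (hc.mono ?_)
  rw [uIcc_of_le hab]
  exact fun x hx => ha.trans_le hx.1

/-- Solving `A F = k` gives `F / φ = F 1 / φ 1 - ∫ k / φ`. The integral passes to the L² limit at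
each point and `F` does so almost everywhere along a subsequence, so the constants converge and the
limit has the same form. -/
theorem factorGraph_isClosed (hφ : LocAC2 φ) (hpos : ∀ x, 0 < x → 0 < φ x) :
    IsClosed (factorGraph φ : Set (L2 × L2)) := by
  refine isSeqClosed_iff_isClosed.1 fun p f hp hlim => ?_
  have h1 : Tendsto (fun n => (p n).1) atTop (𝓝 f.1) := (continuous_fst.tendsto _).comp hlim
  have h2 : Tendsto (fun n => (p n).2) atTop (𝓝 f.2) := (continuous_snd.tendsto _).comp hlim
  choose F hF hF1 hF2 using hp
  have hN : ∀ x, 0 < x → Tendsto (fun n => ∫ t in (1 : ℝ)..x, (p n).2 t / φ t) atTop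
      (𝓝 (∫ t in (1 : ℝ)..x, f.2 t / φ t)) := by
    intro x hx
    simp only [integral_div_eq_inner hφ hpos hx]
    exact (Tendsto.inner tendsto_const_nhds h2).const_smul _
  have hrep : ∀ n x, 0 < x →
      F n x / φ x = F n 1 / φ 1 - ∫ t in (1 : ℝ)..x, (p n).2 t / φ t := by
    intro n x hx
    have hP : Prim (fun x => F n x / φ x) (fun x => -((p n).2 x / φ x)) := by
      refine (prim_div hφ hpos (hF n)).congr_ae ?_
      filter_upwards [hF2 n] with x hx
      rw [hx, neg_div]
    have := (hP.complex_integral one_pos hx).2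
    rw [intervalIntegral.integral_neg] at this
    linear_combination -this
  obtain ⟨ns, hns, hae⟩ := (tendstoInMeasure_of_tendsto_Lp h1).exists_seq_tendsto_ae
  have hlimae : ∀ᵐ x ∂(volume.restrict (Ioi (0 : ℝ))),
      0 < x ∧ Tendsto (fun i => F (ns i) 1 / φ 1) atTop
        (𝓝 (f.1 x / φ x + ∫ t in (1 : ℝ)..x, f.2 t / φ t)) := by
    filter_upwards [hae, ae_all_iff.2 hF1, ae_restrict_mem measurableSet_Ioi] with x hx hx1 hx0
    refine ⟨hx0, ((hx.div_const (φ x : ℂ)).add ((hN x hx0).comp hns.tendsto_atTop)).congr fun i => ?_⟩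
    rw [hx1, hrep (ns i) x hx0]
    simp
  have hne : NeBot (ae (volume.restrict (Ioi (0 : ℝ)))) := by
    rw [ae_neBot]; simp
  -- One good point fixes the limiting constant; uniqueness of limits makes it the same at almost
  -- every other point.
  obtain ⟨x₁, -, hx₁⟩ := hlimae.exists
  set c := f.1 x₁ / φ x₁ + ∫ t in (1 : ℝ)..x₁, f.2 t / φ t
  have hQ := (Prim.of_complex_integral (k := fun t => -(f.2 t / φ t))
    (fun a b ha hab => (intervalIntegrable_div hφ hpos f.2 ha hab).neg) c)
  have hG := hφ.prim.ofReal.mul hQ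
  refine ⟨_, hG.1, ?_, ?_⟩
  · filter_upwards [hlimae] with x hx
    have h3 := tendsto_nhds_unique hx₁ hx.2
    have h4 : (φ x : ℂ) ≠ 0 := by exact_mod_cast (hpos x hx.1).ne'
    rw [h3, intervalIntegral.integral_neg]
    field_simp
    ring
  · filter_upwards [hG.deriv_ae, ae_restrict_mem measurableSet_Ioi] with x hx hx0
    have h4 : (φ x : ℂ) ≠ 0 := by exact_mod_cast (hpos x hx0).ne'
    rw [factor, hx]
    push_cast
    field_simp
    ring

theorem IsRegularSolution.isFactor (hφ : IsRegularSolution l q lam φ) (hyp : Hyp l q) {η : ℝ}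
    (hη : 0 < η) (hF : FormBound l q (lam + η)) : IsFactor (H l q) lam (factorGraph φ) := by
  have hpos := hφ.pos hyp hη hF
  have hnot : ∀ X, 0 < X → ¬ MemLp φ 2 (volume.restrict (Ioi X)) :=
    fun X hX => hφ.not_memLp hyp hη hF hX
  refine ⟨factorGraph_isClosed hφ.1.1 hpos, fun k hk => factorGraph_single hk, fun u => ?_, ?_⟩
  · obtain ⟨U, hU, h1, -⟩ := H_exists_inDom u
    exact (exists_mem_factorGraph_iff _).2 ⟨U, h1, hU.locAC2.prim.1,
      hU.memLp_factor hyp hφ hpos hnot⟩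
  · rintro f k ⟨F, hFA, f1, f2⟩ u a ⟨V, hV, v1, v2⟩
    obtain ⟨U, hU, u1, u2⟩ := H_exists_inDom u
    have hVU := hV.eqOn_of_ae hU.locAC2.prim.1 (v1.symm.trans u1)
    have v3 : a =ᵐ[volume.restrict (Ioi (0 : ℝ))] factor φ U := by
      refine v2.trans ?_
      filter_upwards [ae_restrict_mem measurableSet_Ioi] with x hx using factor_congr hVU hx
    have u3 : (H l q u - (lam : ℂ) • (u : L2) : L2) =ᵐ[volume.restrict (Ioi (0 : ℝ))]
        fun x => tau l q U x - lam * U x := by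
      filter_upwards [Lp.coeFn_sub (H l q u) ((lam : ℂ) • (u : L2)),
        Lp.coeFn_smul (lam : ℂ) (u : L2), u1, u2] with x h1 h2 h3 h4
      rw [h1, Pi.sub_apply, h2, Pi.smul_apply, h3, h4, smul_eq_mul]
    rw [L2.inner_eq_integral f2 v3, L2.inner_eq_integral f1 u3]
    exact hU.integral_factor_eq hyp hφ hpos (hU.memLp_factor hyp hφ hpos hnot) hFA
      ((memLp_congr_ae f1).1 (Lp.memLp f)) ((memLp_congr_ae f2).1 (Lp.memLp k))

end Bessel

namespace Bessel

variable {l lam : ℝ} {q φ : ℝ → ℝ}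

/-! ### Hardy's inequality -/

theorem IsRegularSolution.exists_global_bounds (hφ : IsRegularSolution l q lam φ)
    (hl : -(1 / 2) ≤ l) (hpos : ∀ x, 0 < x → 0 < φ x) : ∃ c C : ℝ, 0 < c ∧ 0 < C ∧
      ∀ x ∈ Ioc (0 : ℝ) 1, c * x ^ (l + 1) ≤ φ x ∧ φ x ≤ C * x ^ (l + 1) := by
  obtain ⟨d, hd, hd1, hb⟩ := hφ.exists_bounds
  have hcont : ContinuousOn φ (Icc d 1) := hφ.1.1.prim.continuousOn.mono fun x hx => hd.trans_le hx.1
  obtain ⟨x₀, hx₀, hmin⟩ := isCompact_Icc.exists_isMinOn ⟨d, left_mem_Icc.2 hd1⟩ hcont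
  obtain ⟨x₁, hx₁, hmax⟩ := isCompact_Icc.exists_isMaxOn ⟨d, left_mem_Icc.2 hd1⟩ hcont
  have h0 := hpos x₀ (hd.trans_le hx₀.1)
  have h1 := hpos x₁ (hd.trans_le hx₁.1)
  have hdp := Real.rpow_pos_of_pos hd (l + 1)
  refine ⟨min (1 / 2) (φ x₀), max 2 (φ x₁ / d ^ (l + 1)), by positivity, by positivity,
    fun x hx => ?_⟩
  have hp := Real.rpow_pos_of_pos hx.1 (l + 1)
  rcases le_total x d with hxd | hxd
  · have h2 := hb x ⟨hx.1, hxd⟩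
    constructor
    · exact le_trans (by gcongr; exact min_le_left _ _) h2.1
    · exact h2.2.trans (by gcongr; exact le_max_left _ _)
  · have h2 : x ^ (l + 1) ≤ 1 := Real.rpow_le_one hx.1.le hx.2 (by linarith)
    have h3 : d ^ (l + 1) ≤ x ^ (l + 1) := Real.rpow_le_rpow hd.le hxd (by linarith)
    constructor
    · calc _ ≤ φ x₀ * 1 := by gcongr; exact min_le_right _ _
        _ ≤ φ x := by rw [mul_one]; exact hmin ⟨hxd, hx.2⟩
    · calc φ x ≤ φ x₁ := hmax ⟨hxd, hx.2⟩
        _ = φ x₁ / d ^ (l + 1) * d ^ (l + 1) := by field_simp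
        _ ≤ max 2 (φ x₁ / d ^ (l + 1)) * x ^ (l + 1) := by gcongr; exact le_max_right _ _

/-- With `m = F / φ`, `k = A F` and `s = 2 l + 1 > 0`, the derivative of `x ^ s ‖m‖ ^ 2` is at least
`(s / 2) x ^ (s - 1) ‖m‖ ^ 2 - D ‖k‖ ^ 2`. Integrating from `x` to 1 bounds both `x ^ s ‖m‖ ^ 2`,
which gives the pointwise estimate, and the integral of `x ^ (s - 1) ‖m‖ ^ 2`, which dominates `‖F /
x‖ ^ 2`. -/
theorem IsRegularSolution.hardy (hφ : IsRegularSolution l q lam φ) (hl : -(1 / 2) < l)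
    (hpos : ∀ x, 0 < x → 0 < φ x) {F : ℝ → ℂ} (hF : LocAC F)
    (hA : MemLp (factor φ F) 2 (volume.restrict (Ioi (0 : ℝ)))) :
    MemLp (fun x => F x / x) 2 (volume.restrict (Ioo (0 : ℝ) 1)) ∧
      ∃ C : ℝ, ∀ x ∈ Ioo (0 : ℝ) 1, ‖F x / x‖ ≤ C / Real.sqrt x := by
  obtain ⟨c, C, hc, hC, hb⟩ := hφ.exists_global_bounds hl.le hpos
  set s := 2 * l + 1 with hs
  have hs0 : 0 < s := by linarith
  set k := factor φ F with hk
  have hm := prim_div hφ.1.1 hpos hF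
  set m : ℝ → ℂ := fun x => F x / φ x with hmdef
  have hmc : ContinuousOn m (Ioi 0) := hm.continuousOn
  have hy := (prim_rpow s).mul (hm.conj.mul hm).re
  have e : ∀ z : ℂ, (starRingEnd ℂ z * z).re = ‖z‖ ^ 2 := fun z => by
    rw [mul_comm, Complex.mul_conj, Complex.ofReal_re, Complex.normSq_eq_norm_sq]
  set D := 2 / (s * c ^ 2) with hD
  have hN := MemLp.norm_sq_integrable hA
  set N := ∫ x in Ioi (0 : ℝ), ‖k x‖ ^ 2 with hNdef
  have hN0 : 0 ≤ N := integral_nonneg fun x => by positivity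
  set Q := ‖m 1‖ ^ 2 + D * N with hQ
  have hD0 : 0 < D := by positivity
  have hQ0 : 0 ≤ Q := by positivity
  have hVc : ContinuousOn (fun t => s / 2 * (t ^ (s - 1) * ‖m t‖ ^ 2)) (Ioi 0) :=
    continuousOn_const.mul ((continuousOn_rpow_Ioi _).mul (hmc.norm.pow 2))
  have hVi : ∀ x, 0 < x → x ≤ 1 →
      IntervalIntegrable (fun t => s / 2 * (t ^ (s - 1) * ‖m t‖ ^ 2)) volume x 1 :=
    fun x hx hx1 => (hVc.mono (by
      rw [uIcc_of_le hx1]; exact fun t ht => hx.trans_le ht.1)).intervalIntegrable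
  have key : ∀ x, 0 < x → x ≤ 1 →
      x ^ s * ‖m x‖ ^ 2 + ∫ t in x..1, s / 2 * (t ^ (s - 1) * ‖m t‖ ^ 2) ≤ Q := by
    intro x hx hx1
    obtain ⟨i1, i2⟩ := hy.real_integral hx one_pos
    have i3 : IntervalIntegrable (fun t => D * ‖k t‖ ^ 2) volume x 1 := by
      rw [intervalIntegrable_iff_integrableOn_Ioc_of_le hx1]
      exact (IntegrableOn.mono_set hN fun t ht => hx.trans ht.1).const_mul D
    have h1 := intervalIntegral.integral_mono_on hx1 ((hVi x hx hx1).sub i3) i1 fun t ht => by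
      have ht0 : 0 < t := hx.trans_le ht.1
      have hp := Real.rpow_pos_of_pos ht0 (l + 1)
      have hφt := hpos t ht0
      have hts := Real.rpow_pos_of_pos ht0 (s - 1)
      have hb1 := (hb t ⟨ht0, ht.2⟩).1
      have e1 : t ^ s = t ^ (s - 1) * t := by
        rw [← Real.rpow_add_one ht0.ne']; ring_nf
      have e2 : t ^ (s - 1) * t ^ 2 = (t ^ (l + 1)) ^ 2 := by
        rw [← Real.rpow_natCast, ← Real.rpow_add ht0, ← Real.rpow_natCast (t ^ (l + 1)),
          ← Real.rpow_mul ht0.le, hs]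
        push_cast; ring_nf
      have hre : -(2 * (‖m t‖ * (‖k t‖ / φ t))) ≤
          (starRingEnd ℂ (-k t / φ t) * m t + starRingEnd ℂ (m t) * (-k t / φ t)).re := by
        have h3 : ‖starRingEnd ℂ (-k t / φ t) * m t + starRingEnd ℂ (m t) * (-k t / φ t)‖ ≤
            2 * (‖m t‖ * (‖k t‖ / φ t)) := by
          refine (norm_add_le _ _).trans (le_of_eq ?_)
          rw [norm_mul, norm_mul, RCLike.norm_conj, RCLike.norm_conj, norm_div, norm_neg,
            Complex.norm_real, Real.norm_of_nonneg hφt.le]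
          ring
        exact (neg_le_neg h3).trans (neg_le_of_abs_le (Complex.abs_re_le_norm _))
      -- Completing the square splits the cross term so that half of `s t ^ (s - 1) ‖m‖ ^ 2` is
      -- kept; what is left over, with `φ ≥ c t ^ (l + 1)`, determines `D`.
      have hsq : 0 ≤ t ^ (s - 1) * (s / 2) * (‖m t‖ - 2 / s * (t * (‖k t‖ / φ t))) ^ 2 := by
        positivity
      have hkb : t ^ (s - 1) * t ^ 2 * (‖k t‖ / φ t) ^ 2 ≤ ‖k t‖ ^ 2 / c ^ 2 := by
        rw [e2, div_pow, ← mul_div_assoc, div_le_div_iff₀ (by positivity) (by positivity)]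
        have : (c * t ^ (l + 1)) ^ 2 ≤ φ t ^ 2 := pow_le_pow_left₀ (by positivity) hb1 2
        calc (t ^ (l + 1)) ^ 2 * ‖k t‖ ^ 2 * c ^ 2 = ‖k t‖ ^ 2 * (c * t ^ (l + 1)) ^ 2 := by ring
          _ ≤ _ := by gcongr
      have hkb2 : 2 / s * (t ^ (s - 1) * t ^ 2 * (‖k t‖ / φ t) ^ 2) ≤ D * ‖k t‖ ^ 2 := by
        calc _ ≤ 2 / s * (‖k t‖ ^ 2 / c ^ 2) := by gcongr
          _ = _ := by rw [hD]; field_simp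
      have hre2 := mul_le_mul_of_nonneg_left hre (show 0 ≤ t ^ (s - 1) * t by positivity)
      have hexp : t ^ (s - 1) * (s / 2) * (‖m t‖ - 2 / s * (t * (‖k t‖ / φ t))) ^ 2 =
          s / 2 * (t ^ (s - 1) * ‖m t‖ ^ 2) - t ^ (s - 1) * t * (2 * (‖m t‖ * (‖k t‖ / φ t))) +
          2 / s * (t ^ (s - 1) * t ^ 2 * (‖k t‖ / φ t) ^ 2) := by
        field_simp
        ring
      rw [e, e1]
      linarith
    rw [i2, intervalIntegral.integral_sub (hVi x hx hx1) i3, e, e, Real.one_rpow, one_mul,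
      intervalIntegral.integral_const_mul D] at h1
    have h2 : ∫ t in x..1, ‖k t‖ ^ 2 ≤ N := by
      rw [intervalIntegral.integral_of_le hx1]
      exact setIntegral_mono_set hN (Eventually.of_forall fun t => by positivity)
        (LE.le.eventuallyLE fun t ht => hx.trans ht.1)
    have h3 : D * ∫ t in x..1, ‖k t‖ ^ 2 ≤ D * N := by gcongr
    rw [hQ]
    linarith
  have hVnn : ∀ t, 0 < t → 0 ≤ s / 2 * (t ^ (s - 1) * ‖m t‖ ^ 2) := fun t ht => by
    have := Real.rpow_pos_of_pos ht (s - 1)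
    positivity
  have hFm : ∀ x, 0 < x → x ≤ 1 → ‖F x‖ ^ 2 ≤ C ^ 2 * (x ^ 2 * (x ^ (s - 1) * ‖m x‖ ^ 2)) := by
    intro x hx hx1
    have hφx := hpos x hx
    have h1 : ‖F x‖ = φ x * ‖m x‖ := by
      simp only [hmdef]
      rw [norm_div, Complex.norm_real, Real.norm_of_nonneg hφx.le]
      field_simp
    have e2 : x ^ (s - 1) * x ^ 2 = (x ^ (l + 1)) ^ 2 := by
      rw [← Real.rpow_natCast, ← Real.rpow_add hx, ← Real.rpow_natCast (x ^ (l + 1)),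
        ← Real.rpow_mul hx.le, hs]
      push_cast; ring_nf
    have h2 : φ x ^ 2 ≤ (C * x ^ (l + 1)) ^ 2 := pow_le_pow_left₀ hφx.le (hb x ⟨hx, hx1⟩).2 2
    calc ‖F x‖ ^ 2 = φ x ^ 2 * ‖m x‖ ^ 2 := by rw [h1, mul_pow]
      _ ≤ (C * x ^ (l + 1)) ^ 2 * ‖m x‖ ^ 2 := by gcongr
      _ = C ^ 2 * ((x ^ (s - 1) * x ^ 2) * ‖m x‖ ^ 2) := by rw [e2]; ring
      _ = _ := by ring
  have hsub : Ioo (0 : ℝ) 1 ⊆ Ioi 0 := Ioo_subset_Ioi_self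
  have hmeas : AEStronglyMeasurable (fun x => F x / x) (volume.restrict (Ioo (0 : ℝ) 1)) := by
    refine ContinuousOn.aestronglyMeasurable ?_ measurableSet_Ioo
    exact (hF.continuousOn.mono hsub).div Complex.continuous_ofReal.continuousOn
      fun x hx => by exact_mod_cast hx.1.ne'
  constructor
  · rw [memLp_two_iff_integrable_sq_norm hmeas]
    have hint : IntegrableOn (fun t => s / 2 * (t ^ (s - 1) * ‖m t‖ ^ 2)) (Ioc 0 1) := by
      refine integrableOn_Ioc_of_intervalIntegral_norm_bounded (I := Q)
        (a := fun n : ℕ => 1 / ((n : ℝ) + 1)) (b := fun _ => 1) (l := atTop) (fun n => ?_)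
        tendsto_one_div_add_atTop_nhds_zero_nat tendsto_const_nhds (Eventually.of_forall fun n => ?_)
      · have h1 : 1 / ((n : ℝ) + 1) ≤ 1 := by
          rw [div_le_one (by positivity)]; linarith [Nat.cast_nonneg (α := ℝ) n]
        exact (hVi _ (by positivity) h1).1
      · have h1 : 1 / ((n : ℝ) + 1) ≤ 1 := by
          rw [div_le_one (by positivity)]; linarith [Nat.cast_nonneg (α := ℝ) n]
        have h0 : 0 < 1 / ((n : ℝ) + 1) := by positivity
        have h2 := key _ h0 h1
        have h3 := Real.rpow_pos_of_pos h0 s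
        have h4 : 0 ≤ (1 / ((n : ℝ) + 1)) ^ s * ‖m (1 / ((n : ℝ) + 1))‖ ^ 2 := by positivity
        rw [intervalIntegral.integral_of_le h1] at h2
        rw [setIntegral_congr_fun measurableSet_Ioc fun t ht =>
          Real.norm_of_nonneg (hVnn t (h0.trans ht.1))]
        linarith
    refine ((hint.mono_set Ioo_subset_Ioc_self).const_mul (C ^ 2 * (2 / s))).mono'
      (hmeas.norm.pow 2) ((ae_restrict_mem measurableSet_Ioo).mono fun x hx => ?_)
    have hx2 : 0 < x ^ 2 := pow_pos hx.1 2
    rw [norm_pow, norm_norm, norm_div, Complex.norm_real, Real.norm_of_nonneg hx.1.le, div_pow,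
      div_le_iff₀ hx2]
    refine (hFm x hx.1 hx.2.le).trans (le_of_eq ?_)
    field_simp
  · refine ⟨C * Real.sqrt Q, fun x hx => ?_⟩
    have hsx := Real.sqrt_pos.2 hx.1
    have e1 : x ^ s = x ^ (s - 1) * x := by
      rw [← Real.rpow_add_one hx.1.ne']; ring_nf
    have h1 := key x hx.1 hx.2.le
    have h2 : 0 ≤ ∫ t in x..1, s / 2 * (t ^ (s - 1) * ‖m t‖ ^ 2) :=
      intervalIntegral.integral_nonneg hx.2.le fun t ht => hVnn t (hx.1.trans_le ht.1)
    have h3 : ‖F x‖ ^ 2 ≤ (C * Real.sqrt Q * Real.sqrt x) ^ 2 := by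
      rw [mul_pow, mul_pow, Real.sq_sqrt hQ0, Real.sq_sqrt hx.1.le]
      calc ‖F x‖ ^ 2 ≤ C ^ 2 * (x ^ 2 * (x ^ (s - 1) * ‖m x‖ ^ 2)) := hFm x hx.1 hx.2.le
        _ = C ^ 2 * (x ^ s * ‖m x‖ ^ 2) * x := by rw [e1]; ring
        _ ≤ C ^ 2 * Q * x := by
          have := hx.1.le
          gcongr; linarith
    have h4 := le_of_sq_le_sq h3 (by positivity)
    rw [norm_div, Complex.norm_real, Real.norm_of_nonneg hx.1.le, div_le_div_iff₀ hx.1 hsx]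
    calc ‖F x‖ * Real.sqrt x ≤ C * Real.sqrt Q * Real.sqrt x * Real.sqrt x := by gcongr
      _ = _ := by rw [mul_assoc, Real.mul_self_sqrt hx.1.le]

end Bessel

/-! ### From the spectrum to the form bound and the form domain -/

namespace Bessel

variable {l lam : ℝ} {q φ : ℝ → ℝ}

/-- The factorization at `γ - 1`, with room 1 below the given bound `γ`, serves only to make `H`
symmetric; the spectral hypothesis then enters through `exists_lower_bound`. -/
theorem exists_formBound (hyp : Hyp l q) (hbelow : BoundedBelow (H l q))
    (hspec : ∀ z ∈ opSpectrum (H l q), lam < z.re) :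
    ∃ ε, 0 < ε ∧ FormBound l q (lam + ε) := by
  obtain ⟨γ, hγ⟩ := hbelow
  obtain ⟨φ₀, hφ₀⟩ := hyp.exists_isRegularSolution (γ - 1)
  have hF₀ : FormBound l q (γ - 1 + 1) := by
    rw [sub_add_cancel]; exact formBound_of_lower_bound hγ
  obtain ⟨ε, hε, h⟩ := exists_lower_bound (hφ₀.isFactor hyp one_pos hF₀).symmetric ⟨γ, hγ⟩
    (lam := lam) fun s hs => by
      by_contra hn
      have := hspec s hn
      rw [Complex.ofReal_re] at this
      linarith
  exact ⟨ε, hε, formBound_of_lower_bound h⟩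

theorem formDomain_eq (hyp : Hyp l q) (hφ : IsRegularSolution l q lam φ) {ε : ℝ} (hε : 0 < ε)
    (hF : FormBound l q (lam + ε)) (hres : InResolventSet (H l q) ((lam - 1 : ℝ) : ℂ)) :
    formDomain (H l q) = {f : L2 | ∃ F : ℝ → ℂ, f =ᵐ[volume.restrict (Ioi (0 : ℝ))] F ∧
      LocAC F ∧ MemLp (factor φ F) 2 (volume.restrict (Ioi (0 : ℝ)))} := by
  have hfac := hφ.isFactor hyp hε hF
  obtain ⟨R, hR, -⟩ := hres
  ext f
  rw [mem_ofPred_eq, ← exists_mem_factorGraph_iff]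
  refine ⟨hfac.formDomain_subset, fun ⟨k, hk⟩ => hfac.subset_formDomain (fun g => ?_) hk⟩
  obtain ⟨h, hg⟩ := hR g
  exact ⟨⟨R g, h⟩, hg⟩

end Bessel

end

theorem lemma4p2 (l : ℝ) (q : ℝ → ℝ) (hyp : Bessel.Hyp l q)
    (hbelow : Bessel.BoundedBelow (Bessel.H l q)) :
    (∀ lam : ℝ, (∀ z ∈ Bessel.opSpectrum (Bessel.H l q), lam < z.re) →
      (∃ φ : ℝ → ℝ, Bessel.IsRegularSolution l q lam φ) ∧
      ∀ φ : ℝ → ℝ, Bessel.IsRegularSolution l q lam φ →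
        (∀ x : ℝ, 0 < x → 0 < φ x) ∧
        Bessel.formDomain (Bessel.H l q) =
          {f : Bessel.L2 | ∃ F : ℝ → ℂ, f =ᵐ[volume.restrict (Ioi (0 : ℝ))] F ∧
            Bessel.LocAC F ∧
            MemLp (fun x : ℝ => -deriv F x + ((deriv φ x / φ x : ℝ) : ℂ) * F x) 2
              (volume.restrict (Ioi (0 : ℝ)))}) ∧
    (-(1 / 2) < l → ∀ f ∈ Bessel.formDomain (Bessel.H l q),
      ∃ g : ℝ → ℂ, f =ᵐ[volume.restrict (Ioi (0 : ℝ))] (fun x : ℝ => (x : ℂ) * g x) ∧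
        MemLp g 2 (volume.restrict (Ioo (0 : ℝ) 1)) ∧
        ∃ C : ℝ, ∀ x ∈ Ioo (0 : ℝ) 1, ‖g x‖ ≤ C / Real.sqrt x) := by
  refine ⟨fun lam hspec => ⟨hyp.exists_isRegularSolution lam, fun φ hφ => ?_⟩, fun hl f hf => ?_⟩
  · obtain ⟨ε, hε, hF⟩ := Bessel.exists_formBound hyp hbelow hspec
    refine ⟨hφ.pos hyp hε hF, Bessel.formDomain_eq hyp hφ hε hF ?_⟩
    by_contra hn
    have := hspec _ hn
    rw [Complex.ofReal_re] at this
    linarith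
  -- No spectral information is needed here: the factorization at `γ - 1` suffices, since only the
  -- inclusion of the form domain in the domain of `A` is used.
  · obtain ⟨γ, hγ⟩ := hbelow
    obtain ⟨φ, hφ⟩ := hyp.exists_isRegularSolution (γ - 1)
    have hF : Bessel.FormBound l q (γ - 1 + 1) := by
      rw [sub_add_cancel]; exact Bessel.formBound_of_lower_bound hγ
    obtain ⟨F, hfF, hFA, hF2⟩ := (Bessel.exists_mem_factorGraph_iff f).1
      ((hφ.isFactor hyp one_pos hF).formDomain_subset hf)
    obtain ⟨h1, h2⟩ := hφ.hardy hl (hφ.pos hyp one_pos hF) hFA hF2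
    refine ⟨fun x => F x / x, ?_, h1, h2⟩
    filter_upwards [hfF, ae_restrict_mem measurableSet_Ioi] with x hx hx0
    have : (x : ℂ) ≠ 0 := by exact_mod_cast ne_of_gt hx0
    rw [hx]
    field_simp
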